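/- **Proposition (additivity of complete coherence powers).** All systems are finite-dimensional and nonzero, with a fixed orthonormal (incoherent) basis $\{|i\rangle\}$; composite systems carry the product basis, $\mathrm{id}_k$ is the identity channel on $\mathbb{C}^k$ ($k\ge 1$), and logarithms are to base $2$. A state is *incoherent* if it is diagonal in the fixed basis; $\Delta(\rho)=\sum_i |i\rangle\langle i|\rho|i\rangle\langle i|$ is the dephasing map and $S(\rho)=-\operatorname{tr}\rho\log\rho$. For pure states $\varphi=|\varphi\rangle\langle\varphi|$ put $C(\varphi)=S(\Delta(\varphi))$; for arbitrary states put $$C_r(\rho)=\min_{\sigma\text{ incoherent}} D(\rho\|\sigma),\qquad C_f(\rho)=\min\Big\{\sum_i p_i\,C(\psi_i) : \rho=\sum_i p_i|\psi_i\rangle\langle\psi_i|\Big\},$$ where $D(\rho\|\sigma)=\operatorname{tr}\rho(\log\rho-\log\sigma)$ is the relative entropy ($+\infty$ unless $\ker\sigma\subseteq\ker\rho$). For a CPTP map $T:A\to B$ and $X\in\{r,f\}$ put $$P_X(T)=\sup_{\rho\text{ on }A} \big[C_X(T(\rho))-C_X(\rho)\big],\qquad \widetilde P_r(T)=\sup_{|\varphi\rangle\in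 A}\big[C_r(T(\varphi))-C(\varphi)\big],$$ with suprema over states, respectively pure states, and define the complete coherence powers $$\mathbb P_X(T)=\sup_{k\ge1}P_X(T\otimes\mathrm{id}_k),\qquad \widetilde{\mathbb P}_r(T)=\sup_{k\ge1}\widetilde P_r(T\otimes\mathrm{id}_k).$$ An *incoherent operation* is a map $X\mapsto\sum_\alpha K_\alpha XK_\alpha^\dagger$ (finite sum) with $\sum_\alpha K_\alpha^\dagger K_\alpha=1$ such that $K_\alpha\delta K_\alpha^\dagger$ is diagonal for every incoherent state $\delta$ and every $\alpha$. A *coherence generation protocol* with $n$ uses of $T:A\to B$, rate $R$ and error $\epsilon$ consists of ancillary systems $A_0,\dots,A_n$ with $|A_n|=2^{nR}$, an incoherent state $\rho_0$ on $A\otimes A_0$, and incoherent operations $\mathcal I_{t+1}:B\otimes A_t\to A\otimes A_{t+1}$ $(0\le t<n)$ such that the states $\rho_{t+1}=\mathcal I_{t+1}\big((T\otimes\mathrm{id})\rho_t\big)$ satisfy $$\langle\Psi_{2^{nR}}|\operatorname{tr}_A\rho_n|\Psi_{2^{nR}}\rangle\ge1-\epsilon,\qquad |\Psi_d\rangle=\tfrac1{\sqrt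 d}\sum_{i=0}^{d-1}|i\rangle.$$ The *coherence generating capacity* $C_{\mathrm{gen}}(T)$ is the supremum of all $R$ for which there are protocols for all $n$ whose errors tend to $0$ and whose rates converge to $R$. Then for any CPTP maps $T_1:A_1\to B_1$ and $T_2:A_2\to B_2$, $$\mathbb P_r(T_1\otimes T_2)=\mathbb P_r(T_1)+\mathbb P_r(T_2),\qquad \mathbb P_f(T_1\otimes T_2)=\mathbb P_f(T_1)+\mathbb P_f(T_2).$$ Furthermore, if $T_i(\rho)=V_i\rho V_i^\dagger$ with isometries $V_i:A_i\to B_i$ $(i=1,2)$, then $$\widetilde{\mathbb P}_r(T_i)=\widetilde P_r(T_i)=C_{\mathrm{gen}}(T_i)\quad(i=1,2),\qquad \widetilde P_r(T_1\otimes T_2)=\widetilde P_r(T_1)+\widetilde P_r(T_2),$$ and hence $C_{\mathrm{gen}}(T_1\otimes T_2)=C_{\mathrm{gen}}(T_1)+C_{\mathrm{gen}}(T_2)$. -/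

import Mathlib

open scoped Matrix Kronecker ComplexOrder
open Filter Topology

namespace Coherence

noncomputable section

/-! Finite-dimensional quantum systems: a system is a finite type `ι` labelling the fixed incoherent
basis of `ℂ^ι`; the composite of `ι` and `κ` is `ι × κ`, with the product basis. -/

/-- Superoperators (linear maps) from operators on `ℂ^ι` to operators on `ℂ^κ`. -/
abbrev SuperOp (ι κ : Type*) := Matrix ι ι ℂ →ₗ[ℂ] Matrix κ κ ℂ

section Systems

variable {ι κ : Type*} [Fintype ι] [DecidableEq ι] [Fintype κ] [DecidableEq κ]

/-! ### States -/

/-- Density matrices. -/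
def IsState (ρ : Matrix ι ι ℂ) : Prop := ρ.PosSemidef ∧ ρ.trace = 1

/-- Incoherent states: density matrices that are diagonal in the fixed basis. -/
def IsIncoherent (ρ : Matrix ι ι ℂ) : Prop := IsState ρ ∧ ρ.IsDiag

/-- Unit vectors `|ψ⟩`. -/
def IsUnitVector (ψ : ι → ℂ) : Prop := star ψ ⬝ᵥ ψ = 1

/-- The rank-one operator `|ψ⟩⟨ψ|`. -/
def proj (ψ : ι → ℂ) : Matrix ι ι ℂ := Matrix.vecMulVec ψ (star ψ)

/-- The dephasing map `Δ(ρ) = ∑ i, |i⟩⟨i| ρ |i⟩⟨i|`. -/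
def dephase (ρ : Matrix ι ι ℂ) : Matrix ι ι ℂ := Matrix.diagonal ρ.diag

/-- The maximally coherent vector `d^{-1/2} ∑ i, |i⟩`. -/
def maxCoherent (d : ℕ) : Fin d → ℂ := fun _ => ((1 / Real.sqrt d : ℝ) : ℂ)

/-- Partial trace over the first factor. -/
def traceLeft (ρ : Matrix (ι × κ) (ι × κ) ℂ) : Matrix κ κ ℂ :=
  Matrix.of fun k l => ∑ i, ρ (i, k) (i, l)

/-! ### Entropies and coherence measures (all logarithms are to base 2) -/

/-- The von Neumann entropy `S(ρ) = -tr (ρ log ρ)`; the logarithm is the spectral functional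
calculus, and `0 log 0 = 0`. -/
def entropy (ρ : Matrix ι ι ℂ) : ℝ := -(ρ * cfc (Real.logb 2) ρ).trace.re

open Classical in
/-- The relative entropy `D(ρ‖σ) = tr ρ (log ρ - log σ)`, which is `+∞` unless
`ker σ ⊆ ker ρ`. -/
def relEntropy (ρ σ : Matrix ι ι ℂ) : EReal :=
  if ∀ v : ι → ℂ, σ *ᵥ v = 0 → ρ *ᵥ v = 0 then
    (((ρ * (cfc (Real.logb 2) ρ - cfc (Real.logb 2) σ)).trace.re : ℝ) : EReal)
  else ⊤

/-- The relative entropy of coherence: the minimum of `D(ρ‖σ)` over incoherent states `σ`. -/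
def cohRel (ρ : Matrix ι ι ℂ) : ℝ :=
  (⨅ σ : {σ : Matrix ι ι ℂ // IsIncoherent σ}, relEntropy ρ σ).toReal

/-- The entropy of coherence of a pure state, `C(φ) = S(Δ(|φ⟩⟨φ|))`. -/
def cohPure (φ : ι → ℂ) : ℝ := entropy (dephase (proj φ))

/-- The coherence of formation: the minimum of `∑ i, p i * C(ψ i)` over all finite ensembles of
pure states with `ρ = ∑ i, p i |ψ i⟩⟨ψ i|`. -/
def cohForm (ρ : Matrix ι ι ℂ) : ℝ :=
  sInf {x : ℝ | ∃ (m : ℕ) (p : Fin m → ℝ) (ψ : Fin m → ι → ℂ),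
    (∀ i, 0 ≤ p i) ∧ ∑ i, p i = 1 ∧ (∀ i, IsUnitVector (ψ i)) ∧
    ρ = ∑ i, (p i : ℂ) • proj (ψ i) ∧ x = ∑ i, p i * cohPure (ψ i)}

end Systems

/-! ### Channels -/

section Channels

variable {ι κ ι' κ' : Type*} [Fintype ι] [DecidableEq ι] [Fintype κ] [DecidableEq κ]
  [Fintype ι'] [DecidableEq ι'] [Fintype κ'] [DecidableEq κ']

/-- The tensor product `S ⊗ T` of superoperators. -/
def tensor (S : SuperOp ι κ) (T : SuperOp ι' κ') : SuperOp (ι × ι') (κ × κ') where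
  toFun X := ∑ i, ∑ j, ∑ k, ∑ l,
    X (i, k) (j, l) • (S (Matrix.single i j 1) ⊗ₖ T (Matrix.single k l 1))
  map_add' X Y := by
    simp only [Matrix.add_apply, add_smul, Finset.sum_add_distrib]
  map_smul' c X := by
    simp only [Matrix.smul_apply, smul_eq_mul, mul_smul, Finset.smul_sum, RingHom.id_apply]

/-- `T ⊗ id_k`, with an ancilla of dimension `k`. -/
def ampl (T : SuperOp ι κ) (k : ℕ) : SuperOp (ι × Fin k) (κ × Fin k) :=
  tensor T (LinearMap.id : SuperOp (Fin k) (Fin k))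

/-- Completely positive and trace preserving maps. -/
def IsCPTP (T : SuperOp ι κ) : Prop :=
  (∀ (k : ℕ) (X : Matrix (ι × Fin k) (ι × Fin k) ℂ), X.PosSemidef → (ampl T k X).PosSemidef) ∧
  ∀ X : Matrix ι ι ℂ, (T X).trace = X.trace

/-- The map `X ↦ V X V†`. -/
def conjMap (V : Matrix κ ι ℂ) : SuperOp ι κ where
  toFun X := V * X * Vᴴ
  map_add' X Y := by rw [Matrix.mul_add, Matrix.add_mul]
  map_smul' c X := by simp

/-- `V` is an isometry: `V† V = 1`. -/
def IsIsometry (V : Matrix κ ι ℂ) : Prop := Vᴴ * V = 1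

/-- A Kraus operator is incoherent if it maps every incoherent state to a (not necessarily
normalized) incoherent state. -/
def IsIncoherentKraus (K : Matrix κ ι ℂ) : Prop :=
  ∀ δ : Matrix ι ι ℂ, IsIncoherent δ → (K * δ * Kᴴ).IsDiag

/-- Incoherent operations (IO): maps `X ↦ ∑ α, K α X (K α)†` with incoherent Kraus operators
satisfying `∑ α, (K α)† (K α) = 1`. -/
def IsIncoherentOp (Λ : SuperOp ι κ) : Prop :=
  ∃ (m : ℕ) (K : Fin m → Matrix κ ι ℂ),
    ∑ α, (K α)ᴴ * K α = 1 ∧ (∀ α, IsIncoherentKraus (K α)) ∧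
    ∀ X, Λ X = ∑ α, K α * X * (K α)ᴴ

/-! ### Coherence powers (as suprema in the extended reals) -/

/-- `P_r(T)`: supremum over all states `ρ` of `C_r(T ρ) - C_r(ρ)`. -/
def powRel (T : SuperOp ι κ) : EReal :=
  ⨆ ρ : {ρ : Matrix ι ι ℂ // IsState ρ},
    ((cohRel (T (ρ : Matrix ι ι ℂ)) - cohRel (ρ : Matrix ι ι ℂ) : ℝ) : EReal)

/-- `P_f(T)`: supremum over all states `ρ` of `C_f(T ρ) - C_f(ρ)`. -/
def powForm (T : SuperOp ι κ) : EReal :=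
  ⨆ ρ : {ρ : Matrix ι ι ℂ // IsState ρ},
    ((cohForm (T (ρ : Matrix ι ι ℂ)) - cohForm (ρ : Matrix ι ι ℂ) : ℝ) : EReal)

/-- `P̃_r(T)`: supremum over all pure states `φ` of `C_r(T φ) - C(φ)`. -/
def powRelPure (T : SuperOp ι κ) : EReal :=
  ⨆ φ : {φ : ι → ℂ // IsUnitVector φ},
    ((cohRel (T (proj (φ : ι → ℂ))) - cohPure (φ : ι → ℂ) : ℝ) : EReal)

/-- The complete coherence power `ℙ_r(T) = sup_k P_r(T ⊗ id_k)`. -/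
def completePowRel (T : SuperOp ι κ) : EReal := ⨆ (k : ℕ) (_ : 1 ≤ k), powRel (ampl T k)

/-- The complete coherence power `ℙ_f(T) = sup_k P_f(T ⊗ id_k)`. -/
def completePowForm (T : SuperOp ι κ) : EReal := ⨆ (k : ℕ) (_ : 1 ≤ k), powForm (ampl T k)

/-- The complete coherence power `ℙ̃_r(T) = sup_k P̃_r(T ⊗ id_k)`. -/
def completePowRelPure (T : SuperOp ι κ) : EReal :=
  ⨆ (k : ℕ) (_ : 1 ≤ k), powRelPure (ampl T k)

/-! ### Coherence generating capacity -/

/-- There is a coherence generation protocol with `n` uses of `T`, of rate `R` and error `ε`: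
ancillas `A_t` of dimension `dim t`, an incoherent initial state `ρ 0` on `A ⊗ A_0`, and states
`ρ (t + 1) = I_{t+1} ((T ⊗ id) (ρ t))` on `A ⊗ A_{t+1}` with incoherent operations
`I_{t+1} : B ⊗ A_t → A ⊗ A_{t+1}`, such that `|A_n| = 2 ^ (n R)` and the reduced state of `ρ n`
on `A_n` has fidelity at least `1 - ε` with the maximally coherent state. -/
def HasProtocol (T : SuperOp ι κ) (n : ℕ) (R ε : ℝ) : Prop :=
  ∃ (dim : ℕ → ℕ) (ρ : (t : ℕ) → Matrix (ι × Fin (dim t)) (ι × Fin (dim t)) ℂ),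
    IsIncoherent (ρ 0) ∧
    (∀ t < n, ∃ Λ : SuperOp (κ × Fin (dim t)) (ι × Fin (dim (t + 1))),
      IsIncoherentOp Λ ∧ ρ (t + 1) = Λ (ampl T (dim t) (ρ t))) ∧
    (dim n : ℝ) = (2 : ℝ) ^ ((n : ℝ) * R) ∧
    1 - ε ≤ (star (maxCoherent (dim n)) ⬝ᵥ
      (traceLeft (ρ n) *ᵥ maxCoherent (dim n))).re

/-- `R` is achievable: for all `n` there are protocols, with errors tending to zero and rates
converging to `R`. -/
def IsAchievable (T : SuperOp ι κ) (R : ℝ) : Prop :=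
  ∃ r ε : ℕ → ℝ, (∀ n, HasProtocol T n (r n) (ε n)) ∧
    Tendsto ε atTop (𝓝 0) ∧ Tendsto r atTop (𝓝 R)

/-- The coherence generating capacity: the largest achievable rate. -/
def genCapacity (T : SuperOp ι κ) : EReal := ⨆ R : {R : ℝ // IsAchievable T R}, ((R : ℝ) : EReal)

end Channels

end

end Coherence

open Coherence

namespace Coherence

open Real Finset

/-! Everything is reduced to the Shannon entropy of unnormalized weights, homogeneous of degree one,
and to the coherence `vcoh` of unnormalized vectors; the weights of an ensemble are then absorbed
into its vectors.

Complete powers. Both measures are additive on tensor products. For `C_r` this follows from `C_r(ρ)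
= S(Δρ) - S(ρ)` (`cohRel_eq`). For `C_f` the nontrivial inequality is `le_cohForm_kronecker`: the
slices of a decomposition of `ρ ⊗ σ` along either factor decompose the other factor, and the chain
rule together with concavity of entropy compares the costs. For any additive functional, writing `T₁
⊗ T₂` as `T₁ ⊗ id` after `id ⊗ T₂` splits a gain into two gains with ancillas, and product inputs
give the reverse inequality (`completePow_tensor_le`, `le_completePow_tensor`).

Isometries. An isometry `V ⊗ 1` acts separately on the slices of a vector along the ancilla and
keeps their weights. By the chain rule its gain is therefore the average of the gains of `V` on the
slices, and ancillas do not help (`vcoh_kronecker_one_mulVec_le`). Additivity of the pure power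
follows.

Converse for the capacity. `C_f` vanishes on incoherent states, does not increase under incoherent
operations (`sum_vcoh_kraus_le`) and grows by at most the pure power at each use. A state of
dimension `d` with fidelity close to one with the maximally coherent state has `C_f` close to `log
d` (`cohForm_ge_of_maxFid`).

Achievability. Choose `φ` with gain `g > 0`. Copies of `Vφ` can be turned by incoherent operations
into as many copies of `φ` together with a maximally coherent state at any rate below `g`
(`transforms_asymptotic`: equipartition, then Birkhoff's theorem for the flat case). So copies of
`φ` act as a catalyst: `m` uses of `V` on `m` copies return the copies and leave coherence behind.
The initial copies cost a bounded number of uses each, since an isometry with positive gain sends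
some basis state to a coherent one (`exists_coherent_column`). Repeating the cycle `K` times on the
same copies makes that cost negligible as `K` grows (`isAchievable_of_gain`). -/

/-- The function `t ↦ -t log t` with the logarithm to base 2. -/
noncomputable def eta (t : ℝ) : ℝ := -(t * logb 2 t)

/-- The Shannon entropy of an unnormalized distribution, homogeneous of degree one. -/
noncomputable def shannon {ι : Type*} [Fintype ι] (a : ι → ℝ) : ℝ :=
  ∑ x, eta (a x) - eta (∑ x, a x)

/-! ### Shannon entropy of unnormalized weights -/

section Shannon

variable {ι κ : Type*} [Fintype ι] [Fintype κ]

@[simp] lemma eta_zero : eta 0 = 0 := by simp [eta]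

@[simp] lemma eta_one : eta 1 = 0 := by simp [eta]

lemma eta_mul (s t : ℝ) : eta (s * t) = s * eta t + t * eta s := by
  rcases eq_or_ne s 0 with rfl | hs
  · simp
  rcases eq_or_ne t 0 with rfl | ht
  · simp
  rw [eta, eta, eta, logb_mul hs ht]; ring

lemma eta_nonneg {t : ℝ} (h0 : 0 ≤ t) (h1 : t ≤ 1) : 0 ≤ eta t := by
  rw [eta, neg_nonneg]
  exact mul_nonpos_of_nonneg_of_nonpos h0 (logb_nonpos one_lt_two h0 h1)

lemma shannon_eq_sum_of_sum_eq_one {a : ι → ℝ} (h : ∑ x, a x = 1) :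
    shannon a = ∑ x, eta (a x) := by
  rw [shannon, h]; simp

/-- This is `log x ≤ x - 1` at `x = s * A / a`, multiplied by `a`. With `A` the total of the `a`'s
and the `s`'s summing to at most one, the correction terms add up to something nonpositive. -/
lemma gibbs_term {a s A : ℝ} (ha : 0 ≤ a) (hs : 0 ≤ s) (hA : a ≤ A) (h : s = 0 → a = 0) :
    eta a + a * logb 2 A ≤ -(a * logb 2 s) + (s * A - a) / log 2 := by
  rcases eq_or_lt_of_le ha with rfl | ha
  · simp only [eta_zero, zero_mul, add_zero, neg_zero, sub_zero, zero_add]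
    have := log_pos one_lt_two
    positivity
  have hs : 0 < s := lt_of_le_of_ne hs fun h' => ha.ne' (h h'.symm)
  have hA : 0 < A := ha.trans_le hA
  have key : log (s * A / a) ≤ s * A / a - 1 := log_le_sub_one_of_pos (by positivity)
  rw [log_div (by positivity) ha.ne', log_mul hs.ne' hA.ne'] at key
  have key2 := mul_le_mul_of_nonneg_left key ha.le
  have e : a * (s * A / a - 1) = s * A - a := by field_simp
  rw [e] at key2
  have h2 : 0 < log 2 := log_pos one_lt_two
  have := div_le_div_of_nonneg_right key2 h2.le
  simp only [eta, logb]
  have e2 : a * (log s + log A - log a) / log 2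
    = a * (log s / log 2) + a * (log A / log 2) - a * (log a / log 2) := by ring
  linarith

/-- Gibbs' inequality. -/
lemma shannon_le_cross {a s : ι → ℝ} (ha : ∀ x, 0 ≤ a x) (hs : ∀ x, 0 ≤ s x)
    (hs1 : ∑ x, s x ≤ 1) (h : ∀ x, s x = 0 → a x = 0) :
    shannon a ≤ ∑ x, -(a x * logb 2 (s x)) := by
  set A := ∑ x, a x with hA
  have hA0 : 0 ≤ A := sum_nonneg fun x _ => ha x
  have key : ∑ x, (eta (a x) + a x * logb 2 A) ≤
      ∑ x, (-(a x * logb 2 (s x)) + (s x * A - a x) / log 2) :=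
    sum_le_sum fun x _ => gibbs_term (ha x) (hs x)
      (single_le_sum (f := a) (fun i _ => ha i) (mem_univ x)) (h x)
  rw [sum_add_distrib, sum_add_distrib, ← sum_mul, ← sum_div, sum_sub_distrib, ← sum_mul] at key
  have h2 : 0 < log 2 := log_pos one_lt_two
  have : ((∑ x, s x) * A - A) / log 2 ≤ 0 :=
    div_nonpos_of_nonpos_of_nonneg (by nlinarith) h2.le
  rw [shannon, ← hA, eta]
  linarith

lemma shannon_nonneg {a : ι → ℝ} (ha : ∀ x, 0 ≤ a x) : 0 ≤ shannon a := by
  have : eta (∑ x, a x) = ∑ x, -(a x * logb 2 (∑ x, a x)) := by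
    rw [eta, sum_neg_distrib, ← sum_mul]
  rw [shannon, this, sub_nonneg]
  refine sum_le_sum fun x _ => ?_
  rw [eta, neg_le_neg_iff]
  rcases eq_or_lt_of_le (ha x) with h | h
  · simp [← h]
  · exact mul_le_mul_of_nonneg_left (logb_le_logb_of_le one_lt_two h
      (single_le_sum (f := a) (fun i _ => ha i) (mem_univ x))) h.le

lemma shannon_mul_left (c : ℝ) (a : ι → ℝ) : shannon (fun x => c * a x) = c * shannon a := by
  simp only [shannon, ← mul_sum, eta_mul, sum_add_distrib, ← sum_mul]
  ring

lemma shannon_equiv (e : κ ≃ ι) (a : ι → ℝ) : shannon (fun x => a (e x)) = shannon a := by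
  rw [shannon, shannon, e.sum_comp a, e.sum_comp fun x => eta (a x)]

lemma shannon_eq_cross (a : ι → ℝ) (ha : ∀ x, 0 ≤ a x) :
    shannon a = ∑ x, -(a x * logb 2 (a x / ∑ y, a y)) := by
  have : eta (∑ x, a x) = ∑ x, -(a x * logb 2 (∑ x, a x)) := by
    rw [eta, sum_neg_distrib, ← sum_mul]
  rw [shannon, this, ← sum_sub_distrib]
  refine sum_congr rfl fun x _ => ?_
  rcases eq_or_lt_of_le (ha x) with h | h
  · simp [← h]
  have hA : 0 < ∑ y, a y := h.trans_le (single_le_sum (f := a) (fun i _ => ha i) (mem_univ x))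
  rw [logb_div h.ne' hA.ne', eta]; ring

lemma shannon_prod (a : ι → ℝ) (b : κ → ℝ) :
    shannon (fun x : ι × κ => a x.1 * b x.2)
      = (∑ z, b z) * shannon a + (∑ x, a x) * shannon b := by
  simp only [shannon, Fintype.sum_prod_type, eta_mul, sum_add_distrib, ← mul_sum, ← sum_mul]
  ring

/-- The chain rule. -/
lemma shannon_chain (f : ι × κ → ℝ) :
    shannon f = ∑ z, shannon (fun x => f (x, z)) + shannon (fun z => ∑ x, f (x, z)) := by
  simp only [shannon, Fintype.sum_prod_type_right, sum_sub_distrib]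
  ring

/-- Concavity of entropy: Gibbs' inequality for each `a z` against one common distribution, the
normalized total, and the cross entropies then add up to the entropy of the total. -/
lemma sum_shannon_le (a : κ → ι → ℝ) (ha : ∀ z x, 0 ≤ a z x) :
    ∑ z, shannon (a z) ≤ shannon (fun x => ∑ z, a z x) := by
  have hn : ∀ x, 0 ≤ ∑ z, a z x := fun x => sum_nonneg fun z _ => ha z x
  rw [shannon_eq_cross (fun x => ∑ z, a z x) hn]
  have : ∀ z, shannon (a z) ≤
      ∑ x, -(a z x * logb 2 ((∑ z, a z x) / ∑ y, ∑ z, a z y)) := by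
    intro z
    refine shannon_le_cross (ha z) (fun x => div_nonneg (hn x) (sum_nonneg fun y _ => hn y)) ?_ ?_
    · rw [← sum_div]; exact div_self_le_one _
    · intro x hx
      have h0 : ∑ z, a z x = 0 := by
        rcases div_eq_zero_iff.1 hx with h | h
        · exact h
        · exact (sum_eq_zero_iff_of_nonneg fun y _ => hn y).1 h x (mem_univ x)
      exact (sum_eq_zero_iff_of_nonneg fun z _ => ha z x).1 h0 z (mem_univ z)
  refine (sum_le_sum fun z _ => this z).trans_eq ?_
  rw [sum_comm]
  refine sum_congr rfl fun x _ => ?_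
  rw [sum_neg_distrib, sum_mul]

lemma integral_ite_le {L M : ℝ} (h0 : 0 ≤ L) (hM : L ≤ M) :
    IntervalIntegrable (fun t : ℝ => if t ≤ L then (1 : ℝ) else 0) MeasureTheory.volume 0 M ∧
    ∫ t in (0 : ℝ)..M, (if t ≤ L then (1 : ℝ) else 0) = L := by
  have h1 : Set.EqOn (fun _ : ℝ => (1 : ℝ)) (fun t : ℝ => if t ≤ L then (1 : ℝ) else 0)
      (Set.uIoc 0 L) := by
    intro t ht
    rw [Set.uIoc_of_le h0] at ht
    simp [ht.2]
  have h2 : Set.EqOn (fun _ : ℝ => (0 : ℝ)) (fun t : ℝ => if t ≤ L then (1 : ℝ) else 0)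
      (Set.uIoc L M) := by
    intro t ht
    rw [Set.uIoc_of_le hM] at ht
    simp [ht.1]
  have i1 := (intervalIntegrable_const (μ := MeasureTheory.volume)
    (a := 0) (b := L) (c := (1 : ℝ))).congr h1
  have i2 := (intervalIntegrable_const (μ := MeasureTheory.volume)
    (a := L) (b := M) (c := (0 : ℝ))).congr h2
  refine ⟨i1.trans i2, ?_⟩
  rw [← intervalIntegral.integral_add_adjacent_intervals i1 i2,
    ← intervalIntegral.integral_congr_uIoo (h1.mono Set.Ioo_subset_Ioc_self),
    ← intervalIntegral.integral_congr_uIoo (h2.mono Set.Ioo_subset_Ioc_self)]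
  simp

lemma sum_mul_eq_integral {M : ℝ} (R : ι → ℝ) (r : ι → ℝ) (hr : ∀ z, 0 ≤ r z ∧ r z ≤ M) :
    IntervalIntegrable (fun t => ∑ z with t ≤ r z, R z) MeasureTheory.volume 0 M ∧
      ∑ z, R z * r z = ∫ t in (0 : ℝ)..M, ∑ z with t ≤ r z, R z := by
  have e : (fun t => ∑ z with t ≤ r z, R z)
      = fun t => ∑ z, R z * (if t ≤ r z then (1 : ℝ) else 0) := by
    ext t; simp [sum_filter]
  rw [e]
  have hi : ∀ z ∈ (univ : Finset ι), IntervalIntegrable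
      (fun t => R z * (if t ≤ r z then (1 : ℝ) else 0)) MeasureTheory.volume 0 M := fun z _ =>
    (integral_ite_le (hr z).1 (hr z).2).1.const_mul _
  refine ⟨by simpa [← Finset.sum_fn] using IntervalIntegrable.sum _ hi, ?_⟩
  rw [intervalIntegral.integral_finsetSum hi]
  refine sum_congr rfl fun z _ => ?_
  rw [intervalIntegral.integral_const_mul, (integral_ite_le (hr z).1 (hr z).2).2]

/-- A layer-cake comparison: if all the superlevel sets of `L` weigh at most those of `l`, then so
do the weighted sums. -/
lemma sum_mul_le_of_superlevel {M : ℝ} (hM : 0 ≤ M) (P : ι → ℝ) (l : ι → ℝ) (Q : κ → ℝ)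
    (L : κ → ℝ) (hl : ∀ x, 0 ≤ l x ∧ l x ≤ M) (hL : ∀ z, 0 ≤ L z ∧ L z ≤ M)
    (h : ∀ t, ∑ z with t ≤ L z, Q z ≤ ∑ x with t ≤ l x, P x) :
    ∑ z, Q z * L z ≤ ∑ x, P x * l x := by
  rw [(sum_mul_eq_integral P l hl).2, (sum_mul_eq_integral Q L hL).2]
  exact intervalIntegral.integral_mono_on hM (sum_mul_eq_integral Q L hL).1 (sum_mul_eq_integral P l hl).1 fun t _ => h t

end Shannon

end Coherence

namespace Coherence

set_option linter.unusedSectionVars false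

open Finset Matrix

/-! ### Coherence of unnormalized vectors -/

section Vectors

variable {ι κ ν : Type*} [Fintype ι] [DecidableEq ι] [Fintype κ] [DecidableEq κ]
  [Fintype ν] [DecidableEq ν]

/-- The unnormalized outcome distribution of `v` in the incoherent basis. -/
noncomputable def wt (v : ι → ℂ) : ι → ℝ := fun x => Complex.normSq (v x)

/-- The coherence of an unnormalized vector, homogeneous of degree two. -/
noncomputable def vcoh (v : ι → ℂ) : ℝ := shannon (wt v)


lemma wt_nonneg (v : ι → ℂ) (x : ι) : 0 ≤ wt v x := Complex.normSq_nonneg _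

lemma proj_apply (v : ι → ℂ) (x y : ι) : proj v x y = v x * star (v y) := rfl

lemma proj_self_apply (v : ι → ℂ) (x : ι) : proj v x x = (wt v x : ℂ) := by
  rw [proj_apply, wt, Complex.star_def, Complex.mul_conj]

lemma proj_posSemidef (v : ι → ℂ) : (proj v).PosSemidef := posSemidef_vecMulVec_self_star v

lemma trace_proj (v : ι → ℂ) : (proj v).trace = ((∑ x, wt v x : ℝ) : ℂ) := by
  simp [Matrix.trace, proj_self_apply]

lemma isUnitVector_iff (v : ι → ℂ) : IsUnitVector v ↔ ∑ x, wt v x = 1 := by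
  have : star v ⬝ᵥ v = ((∑ x, wt v x : ℝ) : ℂ) := by
    rw [← trace_proj, proj, Matrix.trace_vecMulVec, dotProduct_comm]
  rw [IsUnitVector, this]
  norm_cast

lemma isState_proj {v : ι → ℂ} (h : ∑ x, wt v x = 1) : IsState (proj v) :=
  ⟨proj_posSemidef v, by rw [trace_proj, h]; simp⟩

lemma wt_smul (c : ℂ) (v : ι → ℂ) : wt (c • v) = fun x => Complex.normSq c * wt v x := by
  ext x; simp [wt]

lemma vcoh_smul (c : ℂ) (v : ι → ℂ) : vcoh (c • v) = Complex.normSq c * vcoh v := by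
  rw [vcoh, wt_smul, shannon_mul_left, vcoh]

lemma vcoh_nonneg (v : ι → ℂ) : 0 ≤ vcoh v := shannon_nonneg (wt_nonneg v)

lemma proj_smul (c : ℂ) (v : ι → ℂ) : proj (c • v) = (Complex.normSq c : ℂ) • proj v := by
  ext x y
  simp only [proj_apply, Pi.smul_apply, smul_eq_mul, Matrix.smul_apply, star_mul',
    Complex.normSq_eq_conj_mul_self, Complex.star_def]
  ring

lemma mul_proj_mul (K : Matrix κ ι ℂ) (v : ι → ℂ) : K * proj v * Kᴴ = proj (K *ᵥ v) := by
  rw [proj, proj, mul_vecMulVec, vecMulVec_mul, star_mulVec]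

/-- The tensor product of vectors. -/
def tmul (v : ι → ℂ) (w : κ → ℂ) : ι × κ → ℂ := fun x => v x.1 * w x.2

lemma wt_tmul (v : ι → ℂ) (w : κ → ℂ) : wt (tmul v w) = fun x => wt v x.1 * wt w x.2 := by
  ext x; simp [wt, tmul]

lemma sum_wt_tmul (v : ι → ℂ) (w : κ → ℂ) :
    ∑ x, wt (tmul v w) x = (∑ x, wt v x) * ∑ x, wt w x := by
  simp only [wt_tmul, Fintype.sum_prod_type, sum_mul_sum]

lemma vcoh_tmul (v : ι → ℂ) (w : κ → ℂ) :
    vcoh (tmul v w) = (∑ z, wt w z) * vcoh v + (∑ x, wt v x) * vcoh w := by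
  rw [vcoh, wt_tmul, shannon_prod, vcoh, vcoh]

lemma vcoh_comp_equiv (e : κ ≃ ι) (v : ι → ℂ) : vcoh (v ∘ e) = vcoh v :=
  shannon_equiv e (wt v)

lemma sum_wt_comp_equiv (e : κ ≃ ι) (v : ι → ℂ) : ∑ x, wt (v ∘ e) x = ∑ x, wt v x :=
  e.sum_comp (wt v)

lemma proj_tmul (v : ι → ℂ) (w : κ → ℂ) : proj (tmul v w) = proj v ⊗ₖ proj w := by
  ext x y
  simp only [proj_apply, tmul, kroneckerMap_apply, star_mul']
  ring

lemma vcoh_chain (v : ι × κ → ℂ) :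
    vcoh v = ∑ z, vcoh (fun x => v (x, z)) + shannon (fun z => ∑ x, wt v (x, z)) :=
  shannon_chain (wt v)

lemma kronecker_mulVec_tmul (K : Matrix κ ι ℂ) {ι' κ' : Type*} [Fintype ι'] [Fintype κ']
    (L : Matrix κ' ι' ℂ) (v : ι → ℂ) (w : ι' → ℂ) :
    (K ⊗ₖ L) *ᵥ tmul v w = tmul (K *ᵥ v) (L *ᵥ w) := by
  ext x
  simp only [mulVec, dotProduct, tmul, kroneckerMap_apply, Fintype.sum_prod_type, sum_mul_sum]
  exact sum_congr rfl fun _ _ => sum_congr rfl fun _ _ => by ring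

lemma kronecker_one_mulVec (K : Matrix κ ι ℂ) (v : ι × ν → ℂ) (y : κ) (z : ν) :
    ((K ⊗ₖ (1 : Matrix ν ν ℂ)) *ᵥ v) (y, z) = (K *ᵥ fun x => v (x, z)) y := by
  simp [mulVec, dotProduct, Fintype.sum_prod_type, Matrix.one_apply]

lemma sum_wt_mulVec_of_isometry {V : Matrix κ ι ℂ} (hV : IsIsometry V) (v : ι → ℂ) :
    ∑ y, wt (V *ᵥ v) y = ∑ x, wt v x := by
  have : (proj (V *ᵥ v)).trace = (proj v).trace := by
    rw [← mul_proj_mul, Matrix.trace_mul_comm, ← Matrix.mul_assoc, hV, Matrix.one_mul]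
  rw [trace_proj, trace_proj] at this
  exact_mod_cast this

lemma sum_wt_kraus {α : Type*} [Fintype α] {K : α → Matrix κ ι ℂ} (hK : ∑ a, (K a)ᴴ * K a = 1)
    (v : ι → ℂ) : ∑ a, ∑ y, wt (K a *ᵥ v) y = ∑ x, wt v x := by
  have h : ∀ a, (proj (K a *ᵥ v)).trace = ((K a)ᴴ * K a * proj v).trace := fun a => by
    rw [← mul_proj_mul, Matrix.trace_mul_comm, ← Matrix.mul_assoc]
  have : ∑ a, (proj (K a *ᵥ v)).trace = (proj v).trace := by
    simp only [h, ← Matrix.trace_sum, ← Matrix.sum_mul, hK, Matrix.one_mul]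
  simp only [trace_proj] at this
  exact_mod_cast this

end Vectors

/-! ### Tensor products and relabellings of superoperators -/

section Tensor

variable {ι κ ι' κ' ι'' κ'' : Type*} [Fintype ι] [DecidableEq ι] [Fintype κ] [DecidableEq κ]
  [Fintype ι'] [DecidableEq ι'] [Fintype κ'] [DecidableEq κ']
  [Fintype ι''] [DecidableEq ι''] [Fintype κ''] [DecidableEq κ'']

lemma linearMap_sum_single {M : Type*} [AddCommGroup M] [Module ℂ M]
    (S : Matrix ι ι ℂ →ₗ[ℂ] M) (A : Matrix ι ι ℂ) :
    S A = ∑ i, ∑ j, A i j • S (single i j 1) := by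
  conv_lhs => rw [matrix_eq_sum_single A]
  simp only [map_sum]
  refine sum_congr rfl fun i _ => sum_congr rfl fun j _ => ?_
  rw [← map_smul, smul_single, smul_eq_mul, mul_one]

lemma tensor_kronecker (S : SuperOp ι κ) (T : SuperOp ι' κ') (A : Matrix ι ι ℂ)
    (B : Matrix ι' ι' ℂ) : tensor S T (A ⊗ₖ B) = S A ⊗ₖ T B := by
  rw [linearMap_sum_single S A, linearMap_sum_single T B]
  ext x y
  simp only [tensor, LinearMap.coe_mk, AddHom.coe_mk, Matrix.sum_apply, Matrix.smul_apply,
    kroneckerMap_apply, smul_eq_mul, sum_mul_sum]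
  refine sum_congr rfl fun i _ => ?_
  rw [sum_comm]
  exact sum_congr rfl fun k _ => sum_congr rfl fun j _ => sum_congr rfl fun l _ => by ring

lemma linearMap_kronecker_ext {M : Type*} [AddCommGroup M] [Module ℂ M]
    {S T : Matrix (ι × ι') (ι × ι') ℂ →ₗ[ℂ] M}
    (h : ∀ (A : Matrix ι ι ℂ) (B : Matrix ι' ι' ℂ), S (A ⊗ₖ B) = T (A ⊗ₖ B)) : S = T := by
  refine LinearMap.ext fun X => ?_
  rw [linearMap_sum_single S X, linearMap_sum_single T X]
  refine sum_congr rfl fun i _ => sum_congr rfl fun j _ => ?_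
  have : single i j (1 : ℂ) = single i.1 j.1 (1 : ℂ) ⊗ₖ single i.2 j.2 (1 : ℂ) := by
    rw [single_kronecker_single]; simp
  rw [this, h]

lemma tensor_comp (S : SuperOp ι ι') (S' : SuperOp ι' ι'') (T : SuperOp κ κ') (T' : SuperOp κ' κ'') :
    tensor S' T' ∘ₗ tensor S T = tensor (S' ∘ₗ S) (T' ∘ₗ T) :=
  linearMap_kronecker_ext fun A B => by simp [tensor_kronecker]

lemma tensor_conjMap (V : Matrix κ ι ℂ) (W : Matrix κ' ι' ℂ) :
    tensor (conjMap V) (conjMap W) = conjMap (V ⊗ₖ W) :=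
  linearMap_kronecker_ext fun A B => by
    rw [tensor_kronecker]
    simp [conjMap, conjTranspose_kronecker, mul_kronecker_mul]

lemma conjMap_one : conjMap (1 : Matrix ι ι ℂ) = LinearMap.id := by
  ext1 X; simp [conjMap]

lemma conjMap_apply (V : Matrix κ ι ℂ) (X : Matrix ι ι ℂ) : conjMap V X = V * X * Vᴴ := rfl

lemma tensor_conjMap_id (V : Matrix κ ι ℂ) :
    tensor (conjMap V) (LinearMap.id : SuperOp ι' ι') = conjMap (V ⊗ₖ (1 : Matrix ι' ι' ℂ)) := by
  rw [← conjMap_one, tensor_conjMap]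

lemma conjMap_proj (V : Matrix κ ι ℂ) (v : ι → ℂ) : conjMap V (proj v) = proj (V *ᵥ v) :=
  mul_proj_mul V v

lemma isIsometry_kronecker {V : Matrix κ ι ℂ} {W : Matrix κ' ι' ℂ} (hV : IsIsometry V)
    (hW : IsIsometry W) : IsIsometry (V ⊗ₖ W) := by
  rw [IsIsometry, conjTranspose_kronecker, ← mul_kronecker_mul, hV, hW, one_kronecker_one]

lemma isIsometry_one : IsIsometry (1 : Matrix ι ι ℂ) := by simp [IsIsometry]

/-- Relabelling of the basis as a superoperator. -/
def relabel (e : ι ≃ κ) : SuperOp ι κ where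
  toFun X := X.submatrix e.symm e.symm
  map_add' _ _ := rfl
  map_smul' _ _ := rfl

lemma relabel_apply (e : ι ≃ κ) (X : Matrix ι ι ℂ) : relabel e X = X.submatrix e.symm e.symm := rfl

lemma relabel_symm_relabel (e : ι ≃ κ) (X : Matrix ι ι ℂ) : relabel e.symm (relabel e X) = X := by
  ext; simp [relabel_apply]

lemma tensor_relabel (e : ι ≃ κ) (f : ι' ≃ κ') :
    tensor (relabel e) (relabel f) = relabel (e.prodCongr f) :=
  linearMap_kronecker_ext fun A B => by
    rw [tensor_kronecker]; ext; simp [relabel_apply]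

lemma relabel_refl : relabel (Equiv.refl ι) = LinearMap.id := rfl

lemma tensor_assoc (S : SuperOp ι κ) (T : SuperOp ι' κ') (U : SuperOp ι'' κ'') :
    tensor S (tensor T U) ∘ₗ relabel (Equiv.prodAssoc ι ι' ι'')
      = relabel (Equiv.prodAssoc κ κ' κ'') ∘ₗ tensor (tensor S T) U := by
  refine LinearMap.ext fun X => ?_
  suffices h : ∀ (A : Matrix (ι × ι') (ι × ι') ℂ) (B : Matrix ι'' ι'' ℂ),
      (tensor S (tensor T U) ∘ₗ relabel (Equiv.prodAssoc ι ι' ι'')) (A ⊗ₖ B)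
      = (relabel (Equiv.prodAssoc κ κ' κ'') ∘ₗ tensor (tensor S T) U) (A ⊗ₖ B) from
    LinearMap.congr_fun (linearMap_kronecker_ext h) X
  intro A B
  -- With `B` fixed, both sides are linear in `A`, so extensionality on Kronecker products applies a
  -- second time, now to the inner factor.
  let F : SuperOp (ι × ι') (κ × κ' × κ'') :=
    { toFun := fun A => (tensor S (tensor T U) ∘ₗ relabel (Equiv.prodAssoc ι ι' ι'')) (A ⊗ₖ B)
      map_add' := fun A A' => by rw [add_kronecker, map_add]
      map_smul' := fun c A => by rw [smul_kronecker, map_smul]; rfl }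
  let G : SuperOp (ι × ι') (κ × κ' × κ'') :=
    { toFun := fun A => (relabel (Equiv.prodAssoc κ κ' κ'') ∘ₗ tensor (tensor S T) U) (A ⊗ₖ B)
      map_add' := fun A A' => by rw [add_kronecker, map_add]
      map_smul' := fun c A => by rw [smul_kronecker, map_smul]; rfl }
  suffices h : F = G from LinearMap.congr_fun h A
  refine linearMap_kronecker_ext fun A₁ A₂ => ?_
  change tensor S (tensor T U) (relabel (Equiv.prodAssoc ι ι' ι'') ((A₁ ⊗ₖ A₂) ⊗ₖ B))
    = relabel (Equiv.prodAssoc κ κ' κ'') (tensor (tensor S T) U ((A₁ ⊗ₖ A₂) ⊗ₖ B))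
  rw [tensor_kronecker, tensor_kronecker, relabel_apply, relabel_apply, kronecker_assoc',
    kronecker_assoc', tensor_kronecker, tensor_kronecker]

lemma tensor_swap (S : SuperOp ι κ) (T : SuperOp ι' κ') :
    tensor T S ∘ₗ relabel (Equiv.prodComm ι ι') = relabel (Equiv.prodComm κ κ') ∘ₗ tensor S T := by
  refine linearMap_kronecker_ext fun A B => ?_
  have e : relabel (Equiv.prodComm ι ι') (A ⊗ₖ B) = B ⊗ₖ A := by
    ext; simp [relabel_apply, mul_comm]
  have e' : relabel (Equiv.prodComm κ κ') (S A ⊗ₖ T B) = T B ⊗ₖ S A := by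
    ext; simp [relabel_apply, mul_comm]
  rw [LinearMap.comp_apply, LinearMap.comp_apply, e, tensor_kronecker, tensor_kronecker, e']

lemma isState_relabel (e : ι ≃ κ) {ρ : Matrix ι ι ℂ} (h : IsState ρ) : IsState (relabel e ρ) := by
  refine ⟨h.1.submatrix _, ?_⟩
  rw [← h.2, Matrix.trace, Matrix.trace]
  exact e.symm.sum_comp fun i => ρ i i

lemma isState_kronecker {ρ : Matrix ι ι ℂ} {σ : Matrix κ κ ℂ} (h : IsState ρ) (h' : IsState σ) :
    IsState (ρ ⊗ₖ σ) :=
  ⟨h.1.kronecker h'.1, by rw [trace_kronecker, h.2, h'.2, mul_one]⟩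

lemma IsState.nonempty {ρ : Matrix ι ι ℂ} (h : IsState ρ) : Nonempty ι := by
  by_contra hn
  rw [not_nonempty_iff] at hn
  simpa [Matrix.trace] using h.2

lemma trace_tensor {S : SuperOp ι κ} {T : SuperOp ι' κ'} (hS : ∀ X, (S X).trace = X.trace)
    (hT : ∀ X, (T X).trace = X.trace) (X : Matrix (ι × ι') (ι × ι') ℂ) :
    (tensor S T X).trace = X.trace := by
  have : traceLinearMap (κ × κ') ℂ ℂ ∘ₗ tensor S T = traceLinearMap (ι × ι') ℂ ℂ :=
    linearMap_kronecker_ext fun A B => by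
      simp [tensor_kronecker, trace_kronecker, hS, hT]
  exact LinearMap.congr_fun this X

lemma IsCPTP.posSemidef_tensor {T : SuperOp ι κ} (hT : IsCPTP T)
    {ρ : Matrix (ι × ι') (ι × ι') ℂ} (h : ρ.PosSemidef) :
    (tensor T (LinearMap.id : SuperOp ι' ι') ρ).PosSemidef := by
  set e := Fintype.equivFin ι'
  have key := hT.1 (Fintype.card ι') (relabel ((Equiv.refl ι).prodCongr e) ρ) (h.submatrix _)
  have : tensor T (LinearMap.id : SuperOp ι' ι') ρ = relabel ((Equiv.refl κ).prodCongr e.symm)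
      (ampl T (Fintype.card ι') (relabel ((Equiv.refl ι).prodCongr e) ρ)) := by
    rw [← tensor_relabel, ← tensor_relabel, ampl, ← LinearMap.comp_apply, ← LinearMap.comp_apply,
      tensor_comp, tensor_comp]
    congr 2
    ext1 X
    exact (relabel_symm_relabel e X).symm
  rw [this]
  exact key.submatrix _

lemma IsCPTP.isState_tensor {T : SuperOp ι κ} (hT : IsCPTP T) {ρ : Matrix (ι × ι') (ι × ι') ℂ}
    (h : IsState ρ) : IsState (tensor T (LinearMap.id : SuperOp ι' ι') ρ) :=
  ⟨hT.posSemidef_tensor h.1, by rw [trace_tensor hT.2 (fun _ => rfl), h.2]⟩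

lemma tensor_id_id : tensor (LinearMap.id : SuperOp ι ι) (LinearMap.id : SuperOp κ κ)
    = LinearMap.id :=
  linearMap_kronecker_ext fun A B => by rw [tensor_kronecker]; rfl

lemma tensor_id_tensor_id (T : SuperOp ι κ) :
    tensor T (LinearMap.id : SuperOp (ι' × ι'') (ι' × ι'')) ∘ₗ relabel (Equiv.prodAssoc ι ι' ι'')
      = relabel (Equiv.prodAssoc κ ι' ι'') ∘ₗ tensor (tensor T (LinearMap.id : SuperOp ι' ι'))
        (LinearMap.id : SuperOp ι'' ι'') := by
  rw [← tensor_assoc, tensor_id_id]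

lemma tensor_id_tensor_id' (T : SuperOp ι κ) :
    tensor T (LinearMap.id : SuperOp (ι' × ι'') (ι' × ι'')) ∘ₗ
        relabel (((Equiv.prodComm ι' ι).prodCongr (Equiv.refl ι'')).trans
          (Equiv.prodAssoc ι ι' ι''))
      = relabel (((Equiv.prodComm ι' κ).prodCongr (Equiv.refl ι'')).trans
          (Equiv.prodAssoc κ ι' ι'')) ∘ₗ tensor (tensor (LinearMap.id : SuperOp ι' ι') T)
        (LinearMap.id : SuperOp ι'' ι'') := by
  have h : ∀ (f : ι' × ι ≃ ι × ι'), relabel ((f.prodCongr (Equiv.refl ι'')).trans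
      (Equiv.prodAssoc ι ι' ι''))
      = relabel (Equiv.prodAssoc ι ι' ι'') ∘ₗ tensor (relabel f) LinearMap.id := fun f => by
    rw [← relabel_refl, tensor_relabel]; rfl
  have h' : ∀ (f : ι' × κ ≃ κ × ι'), relabel ((f.prodCongr (Equiv.refl ι'')).trans
      (Equiv.prodAssoc κ ι' ι''))
      = relabel (Equiv.prodAssoc κ ι' ι'') ∘ₗ tensor (relabel f) LinearMap.id := fun f => by
    rw [← relabel_refl, tensor_relabel]; rfl
  rw [h, h', ← LinearMap.comp_assoc, tensor_id_tensor_id, LinearMap.comp_assoc,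
    LinearMap.comp_assoc, tensor_comp, tensor_comp, tensor_swap]

/-- One factor acts at a time, with everything else as its ancilla. Complete positivity of the
product and the telescoping of its gain both come from this. -/
lemma ampl_tensor_eq (S : SuperOp ι κ) (T : SuperOp ι' κ') (k : ℕ) :
    ampl (tensor S T) k
      = tensor (tensor S (LinearMap.id : SuperOp κ' κ')) (LinearMap.id : SuperOp (Fin k) (Fin k)) ∘ₗ
        tensor (tensor (LinearMap.id : SuperOp ι ι) T) (LinearMap.id : SuperOp (Fin k) (Fin k)) := by
  rw [tensor_comp, tensor_comp]; rfl

lemma eq_relabel_symm_of_intertwine {S : SuperOp ι κ} {T : SuperOp ι' κ'} {e : ι ≃ ι'}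
    {f : κ ≃ κ'} (h : T ∘ₗ relabel e = relabel f ∘ₗ S) (X : Matrix ι ι ℂ) :
    S X = relabel f.symm (T (relabel e X)) := by
  rw [← LinearMap.comp_apply T, h, LinearMap.comp_apply, relabel_symm_relabel]

lemma IsCPTP.tensor {S : SuperOp ι κ} {T : SuperOp ι' κ'} (hS : IsCPTP S) (hT : IsCPTP T) :
    IsCPTP (tensor S T) := by
  refine ⟨fun k X hX => ?_, trace_tensor hS.2 hT.2⟩
  rw [ampl_tensor_eq, LinearMap.comp_apply, eq_relabel_symm_of_intertwine (tensor_id_tensor_id S)]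
  refine (hS.posSemidef_tensor (PosSemidef.submatrix ?_ _)).submatrix _
  rw [eq_relabel_symm_of_intertwine (tensor_id_tensor_id' T)]
  exact (hT.posSemidef_tensor (hX.submatrix _)).submatrix _

lemma isState_conjMap {V : Matrix κ ι ℂ} (hV : IsIsometry V) {ρ : Matrix ι ι ℂ} (h : IsState ρ) :
    IsState (conjMap V ρ) := by
  refine ⟨h.1.mul_mul_conjTranspose_same V, ?_⟩
  rw [conjMap_apply, Matrix.trace_mul_comm, ← Matrix.mul_assoc, hV, Matrix.one_mul, h.2]

end Tensor

/-! ### Von Neumann entropy through diagonalizations -/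

section Entropy

variable {ι κ : Type*} [Fintype ι] [DecidableEq ι] [Fintype κ] [DecidableEq κ]

/-- The diagonal matrix with the given real entries. -/
def realDiag (d : ι → ℝ) : Matrix ι ι ℂ := diagonal fun i => (d i : ℂ)

/-- A diagonalization of `ρ` with real spectrum `d`, along a unitary between possibly different
index types. -/
def IsDiagonalization (ρ : Matrix ι ι ℂ) (V : Matrix ι κ ℂ) (d : κ → ℝ) : Prop :=
  Vᴴ * V = 1 ∧ V * Vᴴ = 1 ∧ ρ = V * realDiag d * Vᴴ

lemma cfc_of_isDiagonalization {ρ : Matrix ι ι ℂ} {V : Matrix ι κ ℂ} {d : κ → ℝ}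
    (h : IsDiagonalization ρ V d) (f : ℝ → ℝ) :
    cfc f ρ = V * realDiag (fun k => f (d k)) * Vᴴ := by
  obtain ⟨h1, h2, h3⟩ := h
  let Φ : (κ → ℝ) →ₐ[ℝ] Matrix ι ι ℂ :=
    { toFun := fun z => V * realDiag z * Vᴴ
      map_one' := by simp [h2, realDiag]
      map_mul' := fun z w => by
        have : realDiag (z * w) = realDiag z * (Vᴴ * V) * realDiag w := by
          simp [h1, realDiag]
        rw [this]
        simp only [Matrix.mul_assoc]
      map_zero' := by simp [realDiag]
      map_add' := fun z w => by
        rw [← Matrix.add_mul, ← Matrix.mul_add, realDiag, realDiag, realDiag, diagonal_add]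
        simp
      commutes' := fun r => by
        have : realDiag ((algebraMap ℝ (κ → ℝ)) r) = r • (1 : Matrix κ κ ℂ) := by
          ext i j; by_cases hij : i = j <;> simp [hij, realDiag]
        rw [this]
        simp [h2, Algebra.algebraMap_eq_smul_one] }
  have hΦ : Φ d = ρ := h3.symm
  have hsa : IsSelfAdjoint ρ := by
    rw [h3, IsSelfAdjoint, star_eq_conjTranspose, conjTranspose_mul, conjTranspose_mul,
      conjTranspose_conjTranspose, Matrix.mul_assoc, realDiag, diagonal_conjTranspose]
    congr 3
    ext k; simp
  have hsp : spectrum ℝ ρ ⊆ Set.range d := by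
    rw [← hΦ]
    refine (AlgHom.spectrum_apply_subset Φ d).trans ?_
    rw [Pi.spectrum_eq]
    refine Set.iUnion_subset fun k => ?_
    have : spectrum ℝ (d k) = {d k} := spectrum.scalar_eq (𝕜 := ℝ) (A := ℝ) (d k)
    rw [this, Set.singleton_subset_iff]
    exact Set.mem_range_self k
  -- The spectrum lies in the finite range of `d`, so `f` may be replaced by an interpolating
  -- polynomial, which commutes with the algebra homomorphism `Φ`.
  let q := Lagrange.interpolate (univ.image d) id f
  have hq : ∀ k, q.eval (d k) = f (d k) := fun k =>
    Lagrange.eval_interpolate_at_node (v := id) f (Set.injOn_id _)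
      (mem_image_of_mem d (mem_univ k))
  have h4 : cfc f ρ = cfc q.eval ρ := cfc_congr fun x hx => by
    obtain ⟨k, rfl⟩ := hsp hx
    exact (hq k).symm
  rw [h4, cfc_polynomial q ρ, ← hΦ, Polynomial.aeval_algHom_apply]
  change V * realDiag (Polynomial.aeval d q) * Vᴴ = _
  congr 3
  ext k
  rw [← hq k, ← Polynomial.coe_aeval_eq_eval]
  exact (Polynomial.aeval_algHom_apply (Pi.evalAlgHom ℝ (fun _ : κ => ℝ) k) d q).symm

lemma trace_mul_cfc_of_isDiagonalization {ρ : Matrix ι ι ℂ} {V : Matrix ι κ ℂ} {d : κ → ℝ}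
    (h : IsDiagonalization ρ V d) (f : ℝ → ℝ) :
    (ρ * cfc f ρ).trace = ((∑ k, d k * f (d k) : ℝ) : ℂ) := by
  rw [cfc_of_isDiagonalization h]
  obtain ⟨h1, h2, h3⟩ := h
  rw [h3]
  have : V * realDiag d * Vᴴ * (V * realDiag (fun k => f (d k)) * Vᴴ)
      = V * (realDiag d * (Vᴴ * V) * realDiag (fun k => f (d k)) * Vᴴ) := by
    simp only [Matrix.mul_assoc]
  rw [this, h1, Matrix.trace_mul_comm, Matrix.mul_assoc, h1]
  simp [realDiag, Matrix.trace]

lemma entropy_eq_of_isDiagonalization {ρ : Matrix ι ι ℂ} {V : Matrix ι κ ℂ} {d : κ → ℝ}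
    (h : IsDiagonalization ρ V d) : entropy ρ = ∑ k, eta (d k) := by
  rw [entropy, trace_mul_cfc_of_isDiagonalization h, Complex.ofReal_re, ← sum_neg_distrib]
  rfl

lemma isDiagonalization_realDiag (d : ι → ℝ) :
    IsDiagonalization (realDiag d) (1 : Matrix ι ι ℂ) d := by simp [IsDiagonalization]

lemma exists_isDiagonalization {ρ : Matrix ι ι ℂ} (h : ρ.IsHermitian) :
    ∃ V : Matrix ι ι ℂ, IsDiagonalization ρ V h.eigenvalues := by
  refine ⟨h.eigenvectorUnitary, ?_, ?_, ?_⟩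
  · exact Unitary.coe_star_mul_self h.eigenvectorUnitary
  · exact Unitary.coe_mul_star_self h.eigenvectorUnitary
  · conv_lhs => rw [h.spectral_theorem]
    rfl

lemma isDiagonalization_kronecker {ι' κ' : Type*} [Fintype ι'] [DecidableEq ι'] [Fintype κ']
    [DecidableEq κ'] {ρ : Matrix ι ι ℂ} {V : Matrix ι κ ℂ} {d : κ → ℝ} {ρ' : Matrix ι' ι' ℂ}
    {V' : Matrix ι' κ' ℂ} {d' : κ' → ℝ} (h : IsDiagonalization ρ V d)
    (h' : IsDiagonalization ρ' V' d') :
    IsDiagonalization (ρ ⊗ₖ ρ') (V ⊗ₖ V') (fun x => d x.1 * d' x.2) := by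
  refine ⟨?_, ?_, ?_⟩
  · rw [conjTranspose_kronecker, ← mul_kronecker_mul, h.1, h'.1, one_kronecker_one]
  · rw [conjTranspose_kronecker, ← mul_kronecker_mul, h.2.1, h'.2.1, one_kronecker_one]
  · have : realDiag (fun x : κ × κ' => d x.1 * d' x.2) = realDiag d ⊗ₖ realDiag d' := by
      rw [realDiag, realDiag, realDiag, diagonal_kronecker_diagonal]; simp
    rw [this, conjTranspose_kronecker, ← mul_kronecker_mul, ← mul_kronecker_mul, ← h.2.2, ← h'.2.2]

lemma isDiagonalization_relabel (e : ι ≃ κ) {ρ : Matrix ι ι ℂ} {V : Matrix ι ι ℂ} {d : ι → ℝ}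
    (h : IsDiagonalization ρ V d) :
    IsDiagonalization (relabel e ρ) (V.submatrix e.symm id) d := by
  refine ⟨?_, ?_, ?_⟩
  · rw [conjTranspose_submatrix, submatrix_mul_equiv Vᴴ V id e.symm id, h.1]; simp
  · rw [conjTranspose_submatrix, ← submatrix_mul V Vᴴ e.symm id e.symm Function.bijective_id,
      h.2.1]
    simp
  · rw [relabel_apply, h.2.2, submatrix_mul _ _ e.symm id e.symm Function.bijective_id,
      submatrix_mul _ _ e.symm id id Function.bijective_id]
    rfl

lemma sum_eigenvalues_eq_one {ρ : Matrix ι ι ℂ} (h : IsState ρ) :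
    ∑ k, h.1.isHermitian.eigenvalues k = 1 := by
  have := h.1.isHermitian.trace_eq_sum_eigenvalues
  have e := congrArg Complex.re (h.2.symm.trans this)
  simpa using e.symm

lemma entropy_kronecker {ρ : Matrix ι ι ℂ} {σ : Matrix κ κ ℂ} (h : IsState ρ) (h' : IsState σ) :
    entropy (ρ ⊗ₖ σ) = entropy ρ + entropy σ := by
  obtain ⟨V, hV⟩ := exists_isDiagonalization h.1.isHermitian
  obtain ⟨W, hW⟩ := exists_isDiagonalization h'.1.isHermitian
  rw [entropy_eq_of_isDiagonalization hV, entropy_eq_of_isDiagonalization hW,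
    entropy_eq_of_isDiagonalization (isDiagonalization_kronecker hV hW)]
  simp only [Fintype.sum_prod_type, eta_mul, sum_add_distrib, ← mul_sum, ← sum_mul,
    sum_eigenvalues_eq_one h, sum_eigenvalues_eq_one h']
  ring

lemma entropy_relabel (e : ι ≃ κ) {ρ : Matrix ι ι ℂ} (h : ρ.IsHermitian) :
    entropy (relabel e ρ) = entropy ρ := by
  obtain ⟨V, hV⟩ := exists_isDiagonalization h
  rw [entropy_eq_of_isDiagonalization hV,
    entropy_eq_of_isDiagonalization (isDiagonalization_relabel e hV)]

lemma entropy_realDiag (d : ι → ℝ) : entropy (realDiag d) = ∑ i, eta (d i) :=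
  entropy_eq_of_isDiagonalization (isDiagonalization_realDiag d)

lemma cfc_realDiag (f : ℝ → ℝ) (d : ι → ℝ) : cfc f (realDiag d) = realDiag fun i => f (d i) := by
  rw [cfc_of_isDiagonalization (isDiagonalization_realDiag d)]; simp

lemma cohPure_eq_sum (v : ι → ℂ) : cohPure v = ∑ x, eta (wt v x) := by
  rw [← entropy_realDiag, cohPure]
  congr 1
  ext i j
  by_cases hij : i = j
  · subst hij; simp [dephase, realDiag, proj_self_apply]
  · simp [dephase, realDiag, hij]

lemma cohPure_eq_vcoh {v : ι → ℂ} (h : ∑ x, wt v x = 1) : cohPure v = vcoh v := by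
  rw [cohPure_eq_sum, vcoh, shannon_eq_sum_of_sum_eq_one h]

lemma proj_mul_proj {v : ι → ℂ} (h : ∑ x, wt v x = 1) : proj v * proj v = proj v := by
  have : star v ⬝ᵥ v = 1 := (isUnitVector_iff v).2 h
  rw [proj, vecMulVec_mul_vecMulVec, this]
  simp

/-- A rank-one projection is idempotent, so its eigenvalues are `0` and `1`, where `eta` vanishes.
-/
lemma entropy_proj {v : ι → ℂ} (h : ∑ x, wt v x = 1) : entropy (proj v) = 0 := by
  have hh := (proj_posSemidef v).isHermitian
  obtain ⟨V, hV⟩ := exists_isDiagonalization hh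
  rw [entropy_eq_of_isDiagonalization hV]
  refine sum_eq_zero fun k _ => ?_
  obtain ⟨h1, h2, h3⟩ := hV
  have e1 : realDiag hh.eigenvalues = Vᴴ * proj v * V := by
    conv_rhs => rw [h3]
    calc _ = 1 * realDiag hh.eigenvalues * 1 := by simp
      _ = _ := by rw [← h1]; simp only [Matrix.mul_assoc]
  have e2 : realDiag hh.eigenvalues * realDiag hh.eigenvalues = realDiag hh.eigenvalues := by
    rw [e1]
    calc _ = Vᴴ * proj v * (V * Vᴴ) * proj v * V := by simp only [Matrix.mul_assoc]
      _ = Vᴴ * (proj v * proj v) * V := by rw [h2]; simp only [Matrix.mul_assoc, Matrix.one_mul]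
      _ = _ := by rw [proj_mul_proj h]
  have e3 := congrFun (congrFun e2 k) k
  simp only [realDiag, diagonal_mul_diagonal, diagonal_apply_eq] at e3
  have e4 : hh.eigenvalues k * hh.eigenvalues k = hh.eigenvalues k := by exact_mod_cast e3
  rcases (IsIdempotentElem.iff_eq_zero_or_one.1 e4) with h | h <;> rw [h] <;> simp

end Entropy

/-! ### Closed form and additivity of the relative entropy of coherence -/

section RelativeEntropy

variable {ι κ : Type*} [Fintype ι] [DecidableEq ι] [Fintype κ] [DecidableEq κ]

/-- The distribution of outcomes of the incoherent measurement. -/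
def diagDist (ρ : Matrix ι ι ℂ) : ι → ℝ := fun x => (ρ x x).re

lemma IsState.diagDist_nonneg {ρ : Matrix ι ι ℂ} (h : IsState ρ) (x : ι) : 0 ≤ diagDist ρ x :=
  (Complex.nonneg_iff.1 (h.1.diag_nonneg (i := x))).1

lemma IsState.ofReal_diagDist {ρ : Matrix ι ι ℂ} (h : IsState ρ) (x : ι) :
    (diagDist ρ x : ℂ) = ρ x x := by
  have := (Complex.nonneg_iff.1 (h.1.diag_nonneg (i := x))).2
  apply Complex.ext
  · simp [diagDist]
  · simpa using this

lemma IsState.sum_diagDist {ρ : Matrix ι ι ℂ} (h : IsState ρ) : ∑ x, diagDist ρ x = 1 := by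
  have := congrArg Complex.re h.2
  simpa [Matrix.trace, diagDist] using this

lemma isIncoherent_realDiag {d : ι → ℝ} (h0 : ∀ x, 0 ≤ d x) (h1 : ∑ x, d x = 1) :
    IsIncoherent (realDiag d) := by
  refine ⟨⟨?_, ?_⟩, ?_⟩
  · exact PosSemidef.diagonal fun i => by simpa using h0 i
  · simp only [realDiag, Matrix.trace, diag_diagonal]; exact_mod_cast h1
  · exact isDiag_diagonal _

lemma IsIncoherent.eq_realDiag {σ : Matrix ι ι ℂ} (h : IsIncoherent σ) :
    σ = realDiag (diagDist σ) := by
  ext i j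
  by_cases hij : i = j
  · subst hij; simp [realDiag, h.1.ofReal_diagDist]
  · simp [realDiag, hij, h.2 hij]

lemma apply_eq_zero_of_diag {ρ : Matrix ι ι ℂ} (h : ρ.PosSemidef) {x : ι} (hx : ρ x x = 0)
    (y : ι) : ρ y x = 0 := by
  have : ρ *ᵥ (Pi.single x 1) = 0 := by
    rw [← h.dotProduct_mulVec_zero_iff]
    simp [hx]
  simpa using congrFun this y

lemma relEntropy_realDiag {ρ : Matrix ι ι ℂ} (h : IsState ρ) {d : ι → ℝ}
    (hd : ∀ x, d x = 0 → diagDist ρ x = 0) :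
    relEntropy ρ (realDiag d)
      = ((∑ x, -(diagDist ρ x * Real.logb 2 (d x)) - entropy ρ : ℝ) : EReal) := by
  rw [relEntropy, if_pos]
  · congr 1
    rw [Matrix.mul_sub, Matrix.trace_sub, Complex.sub_re, entropy, cfc_realDiag]
    have : ((ρ * realDiag fun i => Real.logb 2 (d i)).trace).re
        = ∑ x, diagDist ρ x * Real.logb 2 (d x) := by
      simp [realDiag, Matrix.trace, diagDist]
    rw [this, sum_neg_distrib]; ring
  · intro v hv
    have hv' : ∀ x, d x = 0 ∨ v x = 0 := fun x => by
      have := congrFun hv x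
      simpa [realDiag, mulVec_diagonal] using this
    ext y
    simp only [mulVec, dotProduct, Pi.zero_apply]
    refine sum_eq_zero fun x _ => ?_
    rcases hv' x with h0 | h0
    · rw [apply_eq_zero_of_diag h.1, zero_mul]
      rw [← h.ofReal_diagDist, hd x h0]; simp
    · rw [h0, mul_zero]

lemma relEntropy_realDiag_eq_top {ρ : Matrix ι ι ℂ} {d : ι → ℝ} {x : ι}
    (hx : d x = 0) (hx' : diagDist ρ x ≠ 0) : relEntropy ρ (realDiag d) = ⊤ := by
  rw [relEntropy, if_neg]
  intro hc
  have := congrFun (hc (Pi.single x 1) ?_) x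
  · apply hx'
    simp only [mulVec_single_one, Pi.zero_apply, col_apply] at this
    simp [diagDist, this]
  · ext y
    by_cases hy : y = x
    · subst hy; simp [realDiag, hx]
    · simp [realDiag, hy]

/-- Against a diagonal `σ`, the cross term sees only the diagonal of `ρ`, so by Gibbs' inequality
the dephased state is the minimizer. A `σ` whose support misses part of that diagonal gives `⊤`. -/
lemma cohRel_eq {ρ : Matrix ι ι ℂ} (h : IsState ρ) :
    cohRel ρ = ∑ x, eta (diagDist ρ x) - entropy ρ := by
  have hinf : (⨅ σ : {σ : Matrix ι ι ℂ // IsIncoherent σ}, relEntropy ρ σ)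
      = ((∑ x, eta (diagDist ρ x) - entropy ρ : ℝ) : EReal) := by
    apply le_antisymm
    · refine (iInf_le _ ⟨realDiag (diagDist ρ),
        isIncoherent_realDiag h.diagDist_nonneg h.sum_diagDist⟩).trans_eq ?_
      exact relEntropy_realDiag h fun _ => id
    · refine le_iInf fun ⟨σ, hσ⟩ => ?_
      simp only
      rw [hσ.eq_realDiag]
      by_cases hd : ∀ x, diagDist σ x = 0 → diagDist ρ x = 0
      · rw [relEntropy_realDiag h hd, EReal.coe_le_coe_iff]
        have := shannon_le_cross h.diagDist_nonneg hσ.1.diagDist_nonneg hσ.1.sum_diagDist.le hd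
        rw [shannon_eq_sum_of_sum_eq_one h.sum_diagDist] at this
        linarith
      · push Not at hd
        obtain ⟨x, hx, hx'⟩ := hd
        rw [relEntropy_realDiag_eq_top hx hx']
        exact le_top
  rw [cohRel, hinf, EReal.toReal_coe]

lemma cohRel_kronecker {ρ : Matrix ι ι ℂ} {σ : Matrix κ κ ℂ} (h : IsState ρ) (h' : IsState σ) :
    cohRel (ρ ⊗ₖ σ) = cohRel ρ + cohRel σ := by
  have e : diagDist (ρ ⊗ₖ σ) = fun x => diagDist ρ x.1 * diagDist σ x.2 := by
    ext x
    have := (isState_kronecker h h').ofReal_diagDist x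
    rw [kroneckerMap_apply, ← h.ofReal_diagDist, ← h'.ofReal_diagDist] at this
    exact_mod_cast this
  rw [cohRel_eq h, cohRel_eq h', cohRel_eq (isState_kronecker h h'), entropy_kronecker h h', e]
  simp only [Fintype.sum_prod_type, eta_mul, sum_add_distrib, ← mul_sum, ← sum_mul,
    h.sum_diagDist, h'.sum_diagDist]
  ring

lemma cohRel_relabel (e : ι ≃ κ) {ρ : Matrix ι ι ℂ} (h : IsState ρ) :
    cohRel (relabel e ρ) = cohRel ρ := by
  rw [cohRel_eq h, cohRel_eq (isState_relabel e h), entropy_relabel e h.1.isHermitian]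
  congr 1
  exact e.symm.sum_comp fun x => eta (diagDist ρ x)

lemma cohRel_proj {v : ι → ℂ} (h : ∑ x, wt v x = 1) : cohRel (proj v) = vcoh v := by
  rw [cohRel_eq (isState_proj h), entropy_proj h, sub_zero, ← cohPure_eq_vcoh h, cohPure_eq_sum]
  refine sum_congr rfl fun x _ => ?_
  rw [diagDist, proj_self_apply, Complex.ofReal_re]

end RelativeEntropy

/-! ### Coherence of formation and its additivity -/

section Formation

variable {ι κ J : Type*} [Fintype ι] [DecidableEq ι] [Fintype κ] [DecidableEq κ] [Fintype J]

lemma eq_zero_of_sum_wt_eq_zero {v : ι → ℂ} (h : ∑ x, wt v x = 0) : v = 0 := by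
  ext x
  have := (sum_eq_zero_iff_of_nonneg fun x _ => wt_nonneg v x).1 h x (mem_univ x)
  exact Complex.normSq_eq_zero.1 this

@[simp] lemma vcoh_zero : vcoh (0 : ι → ℂ) = 0 := by simp [vcoh, shannon, wt]

lemma wt_single (x : ι) (c : ℂ) : wt (Pi.single x c) = Pi.single x (Complex.normSq c) := by
  ext y
  by_cases h : y = x
  · subst h; simp [wt]
  · simp [wt, h]

lemma sum_wt_single (x : ι) (c : ℂ) : ∑ y, wt (Pi.single x c) y = Complex.normSq c := by
  rw [wt_single]; simp

lemma vcoh_single (x : ι) (c : ℂ) : vcoh (Pi.single x c : ι → ℂ) = 0 := by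
  rw [vcoh, shannon, sum_wt_single, wt_single, sub_eq_zero]
  rw [Finset.sum_eq_single x]
  · simp
  · intro y _ hy; simp [hy]
  · simp

lemma normSq_sqrt {r : ℝ} (hr : 0 ≤ r) : Complex.normSq (Real.sqrt r : ℂ) = r := by
  rw [Complex.normSq_ofReal, Real.mul_self_sqrt hr]

lemma exists_unit_smul [Nonempty ι] (v : ι → ℂ) :
    ∃ u : ι → ℂ, ∑ x, wt u x = 1 ∧ v = (Real.sqrt (∑ x, wt v x) : ℂ) • u := by
  set P := ∑ x, wt v x with hP
  have hP0 : 0 ≤ P := sum_nonneg fun x _ => wt_nonneg v x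
  rcases eq_or_lt_of_le hP0 with h | h
  · refine ⟨Pi.single (Classical.arbitrary ι) 1, by rw [sum_wt_single]; simp, ?_⟩
    rw [← h, eq_zero_of_sum_wt_eq_zero (v := v) (by rw [← hP, ← h])]
    simp
  · have hs : (Real.sqrt P : ℂ) ≠ 0 := by
      rw [Ne, Complex.ofReal_eq_zero]; exact (Real.sqrt_pos.2 h).ne'
    refine ⟨(Real.sqrt P : ℂ)⁻¹ • v, ?_, by rw [smul_smul, mul_inv_cancel₀ hs, one_smul]⟩
    rw [wt_smul, ← mul_sum, ← hP, Complex.normSq_inv, normSq_sqrt hP0, inv_mul_cancel₀ h.ne']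

/-- Normalizing the vectors turns their squared norms into the probabilities of an ensemble;
homogeneity of `vcoh` keeps the cost the same. Zero vectors receive an arbitrary unit vector with
probability zero. -/
lemma mem_ensemble {ρ : Matrix ι ι ℂ} (hρ : IsState ρ) (v : J → ι → ℂ)
    (h : ρ = ∑ j, proj (v j)) :
    ∑ j, vcoh (v j) ∈ {x : ℝ | ∃ (m : ℕ) (p : Fin m → ℝ) (ψ : Fin m → ι → ℂ),
      (∀ i, 0 ≤ p i) ∧ ∑ i, p i = 1 ∧ (∀ i, IsUnitVector (ψ i)) ∧
      ρ = ∑ i, (p i : ℂ) • proj (ψ i) ∧ x = ∑ i, p i * cohPure (ψ i)} := by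
  have := hρ.nonempty
  choose u hu hv using fun j => exists_unit_smul (v j)
  let e := (Fintype.equivFin J).symm
  have hn : ∀ j, 0 ≤ ∑ x, wt (v j) x := fun j => sum_nonneg fun x _ => wt_nonneg (v j) x
  have hp : ∀ j, proj (v j) = ((∑ x, wt (v j) x : ℝ) : ℂ) • proj (u j) := fun j => by
    conv_lhs => rw [hv j, proj_smul, normSq_sqrt (hn j)]
  have hc : ∀ j, vcoh (v j) = (∑ x, wt (v j) x) * cohPure (u j) := fun j => by
    conv_lhs => rw [hv j, vcoh_smul, normSq_sqrt (hn j), ← cohPure_eq_vcoh (hu j)]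
  refine ⟨Fintype.card J, fun i => ∑ x, wt (v (e i)) x, fun i => u (e i), fun i => hn _, ?_,
    fun i => (isUnitVector_iff _).2 (hu _), ?_, ?_⟩
  · rw [e.sum_comp fun j => ∑ x, wt (v j) x]
    have := hρ.2
    rw [h, Matrix.trace_sum] at this
    simp only [trace_proj] at this
    exact_mod_cast this
  · rw [h]
    simp only [← hp]
    exact (e.sum_comp fun j => proj (v j)).symm
  · simp only [← hc]
    exact (e.sum_comp fun j => vcoh (v j)).symm

lemma cohForm_le {ρ : Matrix ι ι ℂ} (hρ : IsState ρ) (v : J → ι → ℂ)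
    (h : ρ = ∑ j, proj (v j)) : cohForm ρ ≤ ∑ j, vcoh (v j) := by
  refine csInf_le ⟨0, ?_⟩ (mem_ensemble hρ v h)
  rintro x ⟨m, p, ψ, hp, -, hψ, -, rfl⟩
  exact sum_nonneg fun i _ => mul_nonneg (hp i)
    (by rw [cohPure_eq_vcoh ((isUnitVector_iff _).1 (hψ i))]; exact vcoh_nonneg _)

lemma exists_eq_sum_proj {ρ : Matrix ι ι ℂ} (h : ρ.PosSemidef) :
    ∃ v : ι → ι → ℂ, ρ = ∑ j, proj (v j) := by
  obtain ⟨V, -, -, hV⟩ := exists_isDiagonalization h.isHermitian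
  refine ⟨fun k => (Real.sqrt (h.isHermitian.eigenvalues k) : ℂ) • fun x => V x k, ?_⟩
  conv_lhs => rw [hV]
  ext x y
  simp only [Matrix.sum_apply, proj_smul, normSq_sqrt (h.eigenvalues_nonneg _), Matrix.smul_apply,
    proj_apply, Matrix.mul_apply (N := Vᴴ), realDiag, mul_diagonal, conjTranspose_apply,
    smul_eq_mul]
  exact sum_congr rfl fun k _ => by ring

lemma le_cohForm {ρ : Matrix ι ι ℂ} (hρ : IsState ρ) {b : ℝ}
    (h : ∀ (m : ℕ) (v : Fin m → ι → ℂ), ρ = ∑ j, proj (v j) → b ≤ ∑ j, vcoh (v j)) :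
    b ≤ cohForm ρ := by
  refine le_csInf ?_ ?_
  · obtain ⟨v, hv⟩ := exists_eq_sum_proj hρ.1
    exact ⟨_, mem_ensemble hρ v hv⟩
  · rintro x ⟨m, p, ψ, hp, -, hψ, hρ, rfl⟩
    refine (h m (fun i => (Real.sqrt (p i) : ℂ) • ψ i) ?_).trans_eq ?_
    · rw [hρ]
      exact sum_congr rfl fun i _ => by rw [proj_smul, normSq_sqrt (hp i)]
    · exact sum_congr rfl fun i _ => by
        rw [vcoh_smul, normSq_sqrt (hp i), cohPure_eq_vcoh ((isUnitVector_iff _).1 (hψ i))]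

/-- To bound the coherence of formation of `σ` by that of `ρ`, it suffices to transform
decompositions. -/
lemma cohForm_le_cohForm_add {ρ : Matrix ι ι ℂ} (hρ : IsState ρ) {σ : Matrix κ κ ℂ} {c : ℝ}
    (h : ∀ (m : ℕ) (v : Fin m → ι → ℂ), ρ = ∑ j, proj (v j) →
      cohForm σ ≤ ∑ j, vcoh (v j) + c) : cohForm σ ≤ cohForm ρ + c :=
  sub_le_iff_le_add.1 (le_cohForm hρ fun m v hv => sub_le_iff_le_add.2 (h m v hv))

lemma cohForm_relabel_le (e : ι ≃ κ) {ρ : Matrix ι ι ℂ} (h : IsState ρ) :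
    cohForm (relabel e ρ) ≤ cohForm ρ := by
  rw [← add_zero (cohForm ρ)]
  refine cohForm_le_cohForm_add h fun m v hv => ?_
  rw [add_zero]
  refine (cohForm_le (isState_relabel e h) (fun j => v j ∘ e.symm) ?_).trans_eq ?_
  · rw [hv, map_sum]; rfl
  · simp only [vcoh_comp_equiv]

lemma cohForm_relabel (e : ι ≃ κ) {ρ : Matrix ι ι ℂ} (h : IsState ρ) :
    cohForm (relabel e ρ) = cohForm ρ := by
  refine le_antisymm (cohForm_relabel_le e h) ?_
  have := cohForm_relabel_le e.symm (isState_relabel e h)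
  rwa [relabel_symm_relabel] at this

lemma sum_wt_eq_one_of_isState {ρ : Matrix ι ι ℂ} (h : IsState ρ) {v : J → ι → ℂ}
    (hv : ρ = ∑ j, proj (v j)) : ∑ j, ∑ x, wt (v j) x = 1 := by
  have := h.2
  rw [hv, Matrix.trace_sum] at this
  simp only [trace_proj] at this
  exact_mod_cast this

lemma cohForm_kronecker_le {ρ : Matrix ι ι ℂ} {σ : Matrix κ κ ℂ} (h : IsState ρ)
    (h' : IsState σ) : cohForm (ρ ⊗ₖ σ) ≤ cohForm ρ + cohForm σ := by
  refine cohForm_le_cohForm_add h fun m v hv => ?_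
  rw [add_comm]
  refine cohForm_le_cohForm_add h' fun n w hw => ?_
  refine (cohForm_le (J := Fin m × Fin n) (isState_kronecker h h')
    (fun j => tmul (v j.1) (w j.2)) ?_).trans_eq ?_
  · rw [hv, hw, Fintype.sum_prod_type]
    simp only [proj_tmul]
    ext x y
    simp only [kroneckerMap_apply, Matrix.sum_apply, sum_mul_sum]
  · simp only [vcoh_tmul, Fintype.sum_prod_type, sum_add_distrib, ← sum_mul, ← mul_sum,
      sum_wt_eq_one_of_isState h hv, sum_wt_eq_one_of_isState h' hw]
    ring

/-- Fixing the second coordinate in a decomposition of `ρ ⊗ σ` decomposes `ρ` because `σ` has trace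
one, and likewise for `σ`. The chain rule splits each `vcoh (v j)` into the cost of the slices for
`ρ` and the entropy of the marginal on the other factor; by concavity the latter dominates the cost
of the slices for `σ`. -/
lemma le_cohForm_kronecker {ρ : Matrix ι ι ℂ} {σ : Matrix κ κ ℂ} (h : IsState ρ)
    (h' : IsState σ) : cohForm ρ + cohForm σ ≤ cohForm (ρ ⊗ₖ σ) := by
  refine le_cohForm (isState_kronecker h h') fun m v hv => ?_
  have hρ : ρ = ∑ j : Fin m × κ, proj (fun x => v j.1 (x, j.2)) := by
    ext x y
    have e : ∀ z, ∑ j, proj (v j) (x, z) (y, z) = ρ x y * σ z z := fun z => by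
      rw [← Matrix.sum_apply, ← hv]; rfl
    rw [Matrix.sum_apply, Fintype.sum_prod_type_right]
    change ρ x y = ∑ z, ∑ j, proj (v j) (x, z) (y, z)
    simp only [e, ← mul_sum]
    have : ∑ z, σ z z = 1 := h'.2
    rw [this, mul_one]
  have hσ : σ = ∑ j : Fin m × ι, proj (fun z => v j.1 (j.2, z)) := by
    ext x y
    have e : ∀ z, ∑ j, proj (v j) (z, x) (z, y) = ρ z z * σ x y := fun z => by
      rw [← Matrix.sum_apply, ← hv]; rfl
    rw [Matrix.sum_apply, Fintype.sum_prod_type_right]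
    change σ x y = ∑ z, ∑ j, proj (v j) (z, x) (z, y)
    simp only [e, ← sum_mul]
    have : ∑ z, ρ z z = 1 := h.2
    rw [this, one_mul]
  have h1 := cohForm_le h _ hρ
  have h2 := cohForm_le h' _ hσ
  rw [Fintype.sum_prod_type] at h1 h2
  refine (add_le_add h1 h2).trans ?_
  rw [← sum_add_distrib]
  refine sum_le_sum fun j _ => ?_
  rw [vcoh_chain (v j), add_le_add_iff_left]
  exact sum_shannon_le (fun x z => wt (v j) (x, z)) fun x z => wt_nonneg _ _

lemma cohForm_kronecker {ρ : Matrix ι ι ℂ} {σ : Matrix κ κ ℂ} (h : IsState ρ)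
    (h' : IsState σ) : cohForm (ρ ⊗ₖ σ) = cohForm ρ + cohForm σ :=
  le_antisymm (cohForm_kronecker_le h h') (le_cohForm_kronecker h h')

end Formation

/-! ### Monotonicity of pure-state coherence under incoherent Kraus operators -/

section IncoherentOperations

variable {ι κ ν α : Type*} [Fintype ι] [DecidableEq ι] [Fintype κ] [DecidableEq κ]
  [Fintype ν] [DecidableEq ν] [Fintype α]

/-- Every column has at most one nonzero entry. -/
def ColSparse (K : Matrix κ ι ℂ) : Prop := ∀ x y y', K y x ≠ 0 → K y' x ≠ 0 → y = y'

lemma isIncoherentKraus_iff (K : Matrix κ ι ℂ) : IsIncoherentKraus K ↔ ColSparse K := by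
  constructor
  · intro h x y y' hy hy'
    by_contra hne
    have hinc : IsIncoherent (realDiag (Pi.single x (1 : ℝ))) :=
      isIncoherent_realDiag (fun z => by
        by_cases hz : z = x
        · subst hz; simp
        · simp [hz]) (by simp)
    have : (K * realDiag (Pi.single x (1 : ℝ)) * Kᴴ) y y' = 0 := h _ hinc hne
    rw [Matrix.mul_apply, Finset.sum_eq_single x] at this
    · simp [realDiag, hy, hy'] at this
    · intro z _ hz
      simp [realDiag, hz]
    · simp
  · intro h δ hδ y y' hne
    rw [hδ.eq_realDiag, Matrix.mul_apply]
    refine sum_eq_zero fun x _ => ?_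
    simp only [realDiag, mul_diagonal, conjTranspose_apply]
    by_cases hy : K y x = 0
    · simp [hy]
    · have : K y' x = 0 := by
        by_contra hy'
        exact hne (h x y y' hy hy')
      simp [this]

/-- A pure state cannot gain coherence on average under incoherent Kraus operators. -/
lemma sum_vcoh_kraus_le {K : α → Matrix κ ι ℂ} (hK : ∑ a, (K a)ᴴ * K a = 1)
    (hs : ∀ a, ColSparse (K a)) (v : ι → ℂ) : ∑ a, vcoh (K a *ᵥ v) ≤ vcoh v := by
  classical
  set P := ∑ x, wt v x with hP
  by_cases hP0 : P = 0
  · simp [eq_zero_of_sum_wt_eq_zero (hP ▸ hP0)]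
  have hPpos : 0 < P := lt_of_le_of_ne (sum_nonneg fun x _ => wt_nonneg v x) (Ne.symm hP0)
  have hne : Nonempty ι := by
    by_contra hn
    rw [not_nonempty_iff] at hn
    exact hP0 (by simp [hP])
  set lg : ι → ℝ := fun x => -Real.logb 2 (wt v x / P) with hlg
  have hlg0 : ∀ x, 0 ≤ lg x := fun x => by
    rw [hlg, Left.nonneg_neg_iff]
    refine Real.logb_nonpos one_lt_two (div_nonneg (wt_nonneg _ _) hPpos.le) ?_
    rw [div_le_one hPpos]
    exact single_le_sum (f := wt v) (fun i _ => wt_nonneg v i) (mem_univ x)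
  -- `M` exceeds every surprisal `lg x`. It serves as the level of the indices of weight zero, so
  -- that a minimizer of `l` has weight zero only if all its competitors do.
  set M := 1 + ∑ x, lg x with hM
  have hlgM : ∀ x, lg x < M := fun x => by
    have := single_le_sum (f := lg) (fun i _ => hlg0 i) (mem_univ x)
    linarith
  have hM0 : 0 ≤ M := (hlg0 (Classical.arbitrary ι)).trans (hlgM _).le
  set l : ι → ℝ := fun x => if wt v x = 0 then M else lg x with hl
  have hlb : ∀ x, 0 ≤ l x ∧ l x ≤ M := fun x => by
    simp only [hl]
    split
    · exact ⟨hM0, le_rfl⟩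
    · exact ⟨hlg0 x, (hlgM x).le⟩
  -- Each output `(a, y)` is assigned the most probable input `g` that feeds it, the one of least
  -- level `l`.
  have hg : ∀ a y, ∃ g : ι, (∃ x, K a y x ≠ 0) →
      K a y g ≠ 0 ∧ ∀ x, K a y x ≠ 0 → l g ≤ l x := fun a y => by
    by_cases hx : ∃ x, K a y x ≠ 0
    · obtain ⟨g, hg1, hg2⟩ := exists_min_image ({x | K a y x ≠ 0} : Finset ι) l
        (by obtain ⟨x, hx⟩ := hx; exact ⟨x, by simpa using hx⟩)
      exact ⟨g, fun _ => ⟨by simpa using hg1, fun x hx => hg2 x (by simpa using hx)⟩⟩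
    · exact ⟨Classical.arbitrary ι, fun h => absurd h hx⟩
  choose g hg using hg
  have hQ0 : ∀ a y, ¬ (∃ x, K a y x ≠ 0) → ∀ w : ι → ℂ, (K a *ᵥ w) y = 0 := fun a y h w => by
    push Not at h
    simp [mulVec, dotProduct, h]
  set L : α × κ → ℝ := fun z => if ∃ x, K z.1 z.2 x ≠ 0 then l (g z.1 z.2) else 0 with hL
  set Q : α × κ → ℝ := fun z => wt (K z.1 *ᵥ v) z.2 with hQ
  have hzero : ∀ a y, wt v (g a y) = 0 → (∃ x, K a y x ≠ 0) → (K a *ᵥ v) y = 0 := by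
    intro a y h0 hex
    refine sum_eq_zero fun x _ => ?_
    change K a y x * v x = 0
    by_cases hx : K a y x = 0
    · rw [hx, zero_mul]
    have h1 := (hg a y hex).2 x hx
    have h2 : wt v x = 0 := by
      by_contra hne
      have : l x < M := by simp only [hl, if_neg hne]; exact hlgM x
      rw [hl] at h1
      simp only [h0, if_true] at h1
      exact absurd this (not_lt.2 h1)
    rw [Complex.normSq_eq_zero.1 h2, mul_zero]
  -- For fixed `a` the choice `g a` is injective on nonzero rows, by sparsity of columns. The
  -- weights of the chosen inputs thus form a subdistribution on the outputs, to which Gibbs'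
  -- inequality applies.
  have step1 : ∀ a, vcoh (K a *ᵥ v) ≤ ∑ y, Q (a, y) * L (a, y) := by
    intro a
    set s : κ → ℝ := fun y => if ∃ x, K a y x ≠ 0 then wt v (g a y) / P else 0 with hs'
    have hs1 : ∑ y, s y ≤ 1 := by
      have : ∑ y, s y = ∑ y with ∃ x, K a y x ≠ 0, wt v (g a y) / P := by
        rw [sum_filter]
      rw [this, ← sum_div, div_le_one hPpos]
      have hinj : Set.InjOn (g a) (({y | ∃ x, K a y x ≠ 0} : Finset κ) : Set κ) := by
        intro y hy y' hy' he
        have h1 := (hg a y (by simpa using hy)).1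
        have h2 := (hg a y' (by simpa using hy')).1
        rw [← he] at h2
        exact hs a _ y y' h1 h2
      rw [← sum_image (f := wt v) hinj]
      exact sum_le_sum_of_subset_of_nonneg (subset_univ _) fun x _ _ => wt_nonneg v x
    refine (shannon_le_cross (s := s) (wt_nonneg _) (fun y => ?_) hs1 fun y hy => ?_).trans
      (sum_le_sum fun y _ => ?_)
    · simp only [hs']
      split
      · exact div_nonneg (wt_nonneg _ _) hPpos.le
      · exact le_rfl
    · by_cases hex : ∃ x, K a y x ≠ 0
      · simp only [hs', if_pos hex, div_eq_zero_iff, hP0, or_false] at hy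
        simp [wt, hzero a y hy hex]
      · simp [wt, hQ0 a y hex]
    · by_cases hex : ∃ x, K a y x ≠ 0
      · by_cases h0 : wt v (g a y) = 0
        · simp [hQ, wt, hzero a y h0 hex]
        · simp only [hQ, hL, hs', if_pos hex, hl, if_neg h0, hlg]
          linarith
      · simp [hQ, wt, hQ0 a y hex]
  calc ∑ a, vcoh (K a *ᵥ v) ≤ ∑ a, ∑ y, Q (a, y) * L (a, y) := sum_le_sum fun a _ => step1 a
    _ = ∑ z, Q z * L z := by rw [Fintype.sum_prod_type]
    _ ≤ ∑ x, wt v x * l x := by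
      refine sum_mul_le_of_superlevel hM0 _ _ _ _ hlb (fun z => ?_) fun t => ?_
      · simp only [hL]
        split
        · exact hlb _
        · exact ⟨le_rfl, hM0⟩
      -- An output of level at least `t` is fed only by inputs of level at least `t`, so it does not
      -- notice the truncation of `v` to those inputs; completeness of the Kraus operators then
      -- bounds the total output weight by that of `w`.
      · set w : ι → ℂ := fun x => if t ≤ l x then v x else 0 with hw
        have e1 : ∀ z : α × κ, t ≤ L z → Q z = wt (K z.1 *ᵥ w) z.2 := fun z hz => by
          by_cases hex : ∃ x, K z.1 z.2 x ≠ 0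
          · simp only [hL, if_pos hex] at hz
            have : (K z.1 *ᵥ v) z.2 = (K z.1 *ᵥ w) z.2 := by
              refine sum_congr rfl fun x _ => ?_
              change K z.1 z.2 x * v x = K z.1 z.2 x * w x
              by_cases hx : K z.1 z.2 x = 0
              · rw [hx, zero_mul, zero_mul]
              · simp only [hw, if_pos (hz.trans ((hg _ _ hex).2 x hx))]
            simp only [hQ, wt, this]
          · simp only [hQ, wt, hQ0 _ _ hex]
        calc ∑ z with t ≤ L z, Q z = ∑ z with t ≤ L z, wt (K z.1 *ᵥ w) z.2 :=
              sum_congr rfl fun z hz => e1 z (by simpa using hz)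
          _ ≤ ∑ z : α × κ, wt (K z.1 *ᵥ w) z.2 :=
              sum_le_sum_of_subset_of_nonneg (subset_univ _) fun z _ _ => wt_nonneg _ _
          _ = ∑ x, wt w x := by rw [Fintype.sum_prod_type, sum_wt_kraus hK]
          _ = ∑ x with t ≤ l x, wt v x := by
              rw [sum_filter]
              refine sum_congr rfl fun x _ => ?_
              simp only [hw, wt]
              split <;> simp
    _ = vcoh v := by
      rw [vcoh, shannon_eq_cross _ (wt_nonneg v)]
      refine sum_congr rfl fun x _ => ?_
      by_cases h0 : wt v x = 0
      · simp [h0]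
      · simp only [hl, if_neg h0, hlg, hP]; ring

end IncoherentOperations

/-! ### Complete powers for a general additive functional -/

section AdditiveFunctionals

/-- A family of functionals on states that does not depend on the labelling of the basis and is
additive on tensor products. -/
structure IsAdditiveFunctional (C : ∀ n : ℕ, Matrix (Fin n) (Fin n) ℂ → ℝ) : Prop where
  relabel : ∀ (m n : ℕ) (e : Fin m ≃ Fin n) (ρ : Matrix (Fin m) (Fin m) ℂ), IsState ρ →
    C n (relabel e ρ) = C m ρ
  kronecker : ∀ (m n : ℕ) (ρ : Matrix (Fin m) (Fin m) ℂ) (σ : Matrix (Fin n) (Fin n) ℂ),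
    IsState ρ → IsState σ →
    C _ (Coherence.relabel (Fintype.equivFin (Fin m × Fin n)) (ρ ⊗ₖ σ)) = C m ρ + C n σ

variable {ι κ ν ι' κ' ν' : Type*} [Fintype ι] [DecidableEq ι] [Fintype κ] [DecidableEq κ]
  [Fintype ν] [DecidableEq ν] [Fintype ι'] [DecidableEq ι'] [Fintype κ'] [DecidableEq κ']
  [Fintype ν'] [DecidableEq ν'] {C : ∀ n : ℕ, Matrix (Fin n) (Fin n) ℂ → ℝ}

/-- The extension of a family of functionals to arbitrary finite index types. -/
noncomputable def onFin (C : ∀ n : ℕ, Matrix (Fin n) (Fin n) ℂ → ℝ) (ρ : Matrix ι ι ℂ) : ℝ :=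
  C (Fintype.card ι) (relabel (Fintype.equivFin ι) ρ)

lemma relabel_trans (e : ι ≃ κ) (f : κ ≃ ν) (ρ : Matrix ι ι ℂ) :
    relabel f (relabel e ρ) = relabel (e.trans f) ρ := rfl

lemma onFin_relabel (hC : IsAdditiveFunctional C) (e : ι ≃ κ) {ρ : Matrix ι ι ℂ}
    (h : IsState ρ) : onFin C (relabel e ρ) = onFin C ρ := by
  rw [onFin, onFin, ← hC.relabel _ _
    ((Fintype.equivFin ι).symm.trans (e.trans (Fintype.equivFin κ))) _ (isState_relabel _ h),
    relabel_trans, relabel_trans]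
  congr 3
  ext x; simp

lemma onFin_kronecker (hC : IsAdditiveFunctional C) {ρ : Matrix ι ι ℂ} {σ : Matrix κ κ ℂ}
    (h : IsState ρ) (h' : IsState σ) : onFin C (ρ ⊗ₖ σ) = onFin C ρ + onFin C σ := by
  have e : relabel ((Fintype.equivFin ι).prodCongr (Fintype.equivFin κ)) (ρ ⊗ₖ σ)
      = relabel (Fintype.equivFin ι) ρ ⊗ₖ relabel (Fintype.equivFin κ) σ := by
    rw [← tensor_relabel, tensor_kronecker]
  rw [← onFin_relabel hC ((Fintype.equivFin ι).prodCongr (Fintype.equivFin κ))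
    (isState_kronecker h h'), e, onFin,
    hC.kronecker _ _ _ _ (isState_relabel _ h) (isState_relabel _ h')]
  rfl

/-- The complete power of a channel with respect to a family of functionals. -/
noncomputable def completePow (C : ∀ n : ℕ, Matrix (Fin n) (Fin n) ℂ → ℝ) (T : SuperOp ι κ) :
    EReal :=
  ⨆ (k : ℕ) (_ : 1 ≤ k) (ρ : {ρ : Matrix (ι × Fin k) (ι × Fin k) ℂ // IsState ρ}),
    ((onFin C (ampl T k ρ) - onFin C (ρ : Matrix (ι × Fin k) (ι × Fin k) ℂ) : ℝ) : EReal)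

lemma le_completePow (hC : IsAdditiveFunctional C) {T : SuperOp ι κ} (hT : IsCPTP T)
    {ρ : Matrix (ι × ν) (ι × ν) ℂ} (h : IsState ρ) :
    ((onFin C (tensor T (LinearMap.id : SuperOp ν ν) ρ) - onFin C ρ : ℝ) : EReal)
      ≤ completePow C T := by
  have hne : Nonempty ν := h.nonempty.map Prod.snd
  set e := (Equiv.refl ι).prodCongr (Fintype.equivFin ν)
  have hs := isState_relabel e h
  have key : ampl T (Fintype.card ν) (relabel e ρ) =
      relabel ((Equiv.refl κ).prodCongr (Fintype.equivFin ν))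
        (tensor T (LinearMap.id : SuperOp ν ν) ρ) := by
    rw [← tensor_relabel, ← tensor_relabel, ampl, ← LinearMap.comp_apply, ← LinearMap.comp_apply,
      tensor_comp, tensor_comp]
    rfl
  refine le_trans ?_ (le_iSup₂_of_le (Fintype.card ν) Fintype.card_pos
    (le_iSup_of_le ⟨relabel e ρ, hs⟩ le_rfl))
  rw [key, onFin_relabel hC _ (hT.isState_tensor h), onFin_relabel hC _ h]

/-- A superoperator that is, up to relabelling, the amplification of a channel. -/
lemma sub_le_completePow (hC : IsAdditiveFunctional C) {T : SuperOp ι κ} (hT : IsCPTP T)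
    {S : SuperOp ι' κ'} (e : ι' ≃ ι × ν) (f : κ' ≃ κ × ν)
    (hS : tensor T (LinearMap.id : SuperOp ν ν) ∘ₗ relabel e = relabel f ∘ₗ S)
    {ρ : Matrix ι' ι' ℂ} (h : IsState ρ) : IsState (S ρ) ∧
    ((onFin C (S ρ) - onFin C ρ : ℝ) : EReal) ≤ completePow C T := by
  have h1 := isState_relabel e h
  have h2 := hT.isState_tensor h1
  have h3 := eq_relabel_symm_of_intertwine hS ρ
  refine ⟨h3 ▸ isState_relabel _ h2, ?_⟩
  have := le_completePow hC hT h1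
  rwa [onFin_relabel hC _ h, ← onFin_relabel hC f.symm h2, ← h3] at this

/-- The gain telescopes through the intermediate state reached after `T₂`; each half is a gain of
one channel, with the other systems as ancilla. Only invariance under relabelling enters here. -/
lemma completePow_tensor_le (hC : IsAdditiveFunctional C) {T₁ : SuperOp ι κ} {T₂ : SuperOp ι' κ'}
    (h₁ : IsCPTP T₁) (h₂ : IsCPTP T₂) :
    completePow C (tensor T₁ T₂) ≤ completePow C T₁ + completePow C T₂ := by
  refine iSup₂_le fun k _ => iSup_le fun ⟨ρ, hρ⟩ => ?_
  simp only
  obtain ⟨hσ, hσ'⟩ := sub_le_completePow hC h₂ _ _ (tensor_id_tensor_id' T₂) hρ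
  obtain ⟨-, hτ'⟩ := sub_le_completePow hC h₁ _ _ (tensor_id_tensor_id T₁) hσ
  refine le_trans (le_of_eq ?_) (add_le_add hτ' hσ')
  rw [← EReal.coe_add, ampl_tensor_eq, LinearMap.comp_apply]
  congr 1; ring

lemma relabel_prodProdProdComm (A : Matrix ι ι ℂ) (B : Matrix κ κ ℂ) (A' : Matrix ι' ι' ℂ)
    (B' : Matrix κ' κ' ℂ) : relabel (Equiv.prodProdProdComm ι κ ι' κ') ((A ⊗ₖ B) ⊗ₖ (A' ⊗ₖ B'))
      = (A ⊗ₖ A') ⊗ₖ (B ⊗ₖ B') := by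
  ext x y
  simp only [relabel_apply, submatrix_apply, kroneckerMap_apply, Equiv.prodProdProdComm_symm,
    Equiv.prodProdProdComm_apply]
  ring

lemma superOp_ext_single {S T : SuperOp ι κ}
    (h : ∀ i j, S (single i j 1) = T (single i j 1)) : S = T := by
  refine LinearMap.ext fun X => ?_
  rw [linearMap_sum_single S X, linearMap_sum_single T X]
  simp only [h]

lemma tensor_prodProdProdComm (T₁ : SuperOp ι κ) (S₁ : SuperOp ν ν) (T₂ : SuperOp ι' κ')
    (S₂ : SuperOp ν' ν') :
    tensor (tensor T₁ T₂) (tensor S₁ S₂) ∘ₗ relabel (Equiv.prodProdProdComm ι ν ι' ν')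
      = relabel (Equiv.prodProdProdComm κ ν κ' ν') ∘ₗ tensor (tensor T₁ S₁) (tensor T₂ S₂) := by
  refine superOp_ext_single fun i j => ?_
  have : single i j (1 : ℂ) = (single i.1.1 j.1.1 (1 : ℂ) ⊗ₖ single i.1.2 j.1.2 (1 : ℂ)) ⊗ₖ
      (single i.2.1 j.2.1 (1 : ℂ) ⊗ₖ single i.2.2 j.2.2 (1 : ℂ)) := by
    simp [single_kronecker_single]
  rw [this, LinearMap.comp_apply, LinearMap.comp_apply, relabel_prodProdProdComm]
  simp only [tensor_kronecker, relabel_prodProdProdComm]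

lemma exists_of_lt_completePow {T : SuperOp ι κ} {a : EReal} (h : a < completePow C T) :
    ∃ (k : ℕ) (ρ : Matrix (ι × Fin k) (ι × Fin k) ℂ), IsState ρ ∧
      a < ((onFin C (ampl T k ρ) - onFin C ρ : ℝ) : EReal) := by
  simp only [completePow, lt_iSup_iff] at h
  obtain ⟨k, -, ⟨ρ, hρ⟩, h⟩ := h
  exact ⟨k, ρ, hρ, h⟩

/-- Nearly optimal inputs for the two channels are tensored. Additivity of `C` is used both before
and after the channels, once the systems have been reordered. -/
lemma le_completePow_tensor (hC : IsAdditiveFunctional C) {T₁ : SuperOp ι κ} {T₂ : SuperOp ι' κ'}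
    (h₁ : IsCPTP T₁) (h₂ : IsCPTP T₂) (h₁₂ : IsCPTP (tensor T₁ T₂)) :
    completePow C T₁ + completePow C T₂ ≤ completePow C (tensor T₁ T₂) := by
  refine EReal.add_le_of_forall_lt fun a ha b hb => ?_
  obtain ⟨k, ρ, hρ, hρ'⟩ := exists_of_lt_completePow ha
  obtain ⟨l, σ, hσ, hσ'⟩ := exists_of_lt_completePow hb
  refine (add_le_add hρ'.le hσ'.le).trans ?_
  have hs := isState_kronecker hρ hσ
  refine le_trans (le_of_eq ?_)
    (le_completePow hC h₁₂ (isState_relabel (Equiv.prodProdProdComm ι (Fin k) ι' (Fin l)) hs))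
  have e : tensor (tensor T₁ T₂) (LinearMap.id : SuperOp (Fin k × Fin l) (Fin k × Fin l))
      (relabel (Equiv.prodProdProdComm ι (Fin k) ι' (Fin l)) (ρ ⊗ₖ σ))
      = relabel (Equiv.prodProdProdComm κ (Fin k) κ' (Fin l)) (ampl T₁ k ρ ⊗ₖ ampl T₂ l σ) := by
    rw [← tensor_id_id, ← LinearMap.comp_apply, tensor_prodProdProdComm, LinearMap.comp_apply,
      tensor_kronecker]
    rfl
  have hk : IsState (ampl T₁ k ρ) := h₁.isState_tensor hρ
  have hl : IsState (ampl T₂ l σ) := h₂.isState_tensor hσ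
  rw [e, onFin_relabel hC _ hs, onFin_relabel hC _ (isState_kronecker hk hl),
    onFin_kronecker hC hk hl, onFin_kronecker hC hρ hσ, ← EReal.coe_add]
  congr 1; ring

end AdditiveFunctionals

/-! ### Additivity of the two complete coherence powers -/

section CoherencePowers

variable {ι κ ι' κ' : Type*} [Fintype ι] [DecidableEq ι] [Fintype κ] [DecidableEq κ]
  [Fintype ι'] [DecidableEq ι'] [Fintype κ'] [DecidableEq κ']

lemma isAdditiveFunctional_cohRel :
    IsAdditiveFunctional (fun n => (cohRel : Matrix (Fin n) (Fin n) ℂ → ℝ)) where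
  relabel _ _ e _ h := cohRel_relabel e h
  kronecker _ _ _ _ h h' := by rw [cohRel_relabel _ (isState_kronecker h h'), cohRel_kronecker h h']

lemma isAdditiveFunctional_cohForm :
    IsAdditiveFunctional (fun n => (cohForm : Matrix (Fin n) (Fin n) ℂ → ℝ)) where
  relabel _ _ e _ h := cohForm_relabel e h
  kronecker _ _ _ _ h h' := by
    rw [cohForm_relabel _ (isState_kronecker h h'), cohForm_kronecker h h']

lemma completePowRel_eq {T : SuperOp ι κ} (hT : IsCPTP T) :
    completePowRel T = completePow (fun _ => cohRel) T := by
  refine iSup_congr fun k => iSup_congr fun _ => iSup_congr fun ⟨ρ, hρ⟩ => ?_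
  rw [onFin, onFin, cohRel_relabel _ hρ, cohRel_relabel]
  exact hT.isState_tensor hρ

lemma completePowForm_eq {T : SuperOp ι κ} (hT : IsCPTP T) :
    completePowForm T = completePow (fun _ => cohForm) T := by
  refine iSup_congr fun k => iSup_congr fun _ => iSup_congr fun ⟨ρ, hρ⟩ => ?_
  rw [onFin, onFin, cohForm_relabel _ hρ, cohForm_relabel]
  exact hT.isState_tensor hρ

theorem completePowRel_tensor {T₁ : SuperOp ι κ} {T₂ : SuperOp ι' κ'} (h₁ : IsCPTP T₁)
    (h₂ : IsCPTP T₂) :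
    completePowRel (tensor T₁ T₂) = completePowRel T₁ + completePowRel T₂ := by
  rw [completePowRel_eq h₁, completePowRel_eq h₂, completePowRel_eq (h₁.tensor h₂)]
  exact le_antisymm (completePow_tensor_le isAdditiveFunctional_cohRel h₁ h₂)
    (le_completePow_tensor isAdditiveFunctional_cohRel h₁ h₂ (h₁.tensor h₂))

theorem completePowForm_tensor {T₁ : SuperOp ι κ} {T₂ : SuperOp ι' κ'} (h₁ : IsCPTP T₁)
    (h₂ : IsCPTP T₂) :
    completePowForm (tensor T₁ T₂) = completePowForm T₁ + completePowForm T₂ := by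
  rw [completePowForm_eq h₁, completePowForm_eq h₂, completePowForm_eq (h₁.tensor h₂)]
  exact le_antisymm (completePow_tensor_le isAdditiveFunctional_cohForm h₁ h₂)
    (le_completePow_tensor isAdditiveFunctional_cohForm h₁ h₂ (h₁.tensor h₂))

end CoherencePowers

/-! ### Pure-state power of isometries -/

section IsometricPower

variable {ι κ ν ι' κ' : Type*} [Fintype ι] [DecidableEq ι] [Fintype κ] [DecidableEq κ]
  [Fintype ν] [DecidableEq ν] [Fintype ι'] [DecidableEq ι'] [Fintype κ'] [DecidableEq κ']

lemma powRelPure_conjMap {V : Matrix κ ι ℂ} (hV : IsIsometry V) :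
    powRelPure (conjMap V) = ⨆ u : {u : ι → ℂ // ∑ x, wt u x = 1},
      ((vcoh (V *ᵥ u) - vcoh (u : ι → ℂ) : ℝ) : EReal) := by
  refine Equiv.iSup_congr (Equiv.subtypeEquivRight isUnitVector_iff) fun ⟨u, hu⟩ => ?_
  rw [isUnitVector_iff] at hu
  rw [conjMap_proj, cohRel_proj ((sum_wt_mulVec_of_isometry hV u).trans hu), cohPure_eq_vcoh hu]
  rfl

lemma le_powRelPure {V : Matrix κ ι ℂ} (hV : IsIsometry V) {u : ι → ℂ} (hu : ∑ x, wt u x = 1) :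
    ((vcoh (V *ᵥ u) - vcoh u : ℝ) : EReal) ≤ powRelPure (conjMap V) := by
  rw [powRelPure_conjMap hV]
  exact le_iSup_of_le ⟨u, hu⟩ le_rfl

lemma powRelPure_le {V : Matrix κ ι ℂ} (hV : IsIsometry V) {P : EReal}
    (h : ∀ u : ι → ℂ, ∑ x, wt u x = 1 → ((vcoh (V *ᵥ u) - vcoh u : ℝ) : EReal) ≤ P) :
    powRelPure (conjMap V) ≤ P := by
  rw [powRelPure_conjMap hV]
  exact iSup_le fun ⟨u, hu⟩ => h u hu

lemma powRelPure_nonneg [Nonempty ι] {V : Matrix κ ι ℂ} (hV : IsIsometry V) :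
    0 ≤ powRelPure (conjMap V) := by
  have hu : ∑ x, wt (Pi.single (Classical.arbitrary ι) 1 : ι → ℂ) x = 1 := by
    rw [sum_wt_single]; simp
  refine le_trans ?_ (le_powRelPure hV hu)
  rw [vcoh_single, sub_zero]
  exact_mod_cast vcoh_nonneg _

lemma powRelPure_eq_top_or [Nonempty ι] {V : Matrix κ ι ℂ} (hV : IsIsometry V) :
    powRelPure (conjMap V) = ⊤ ∨ ∃ P : ℝ, 0 ≤ P ∧ powRelPure (conjMap V) = P := by
  have h0 := powRelPure_nonneg hV
  induction h : powRelPure (conjMap V) using EReal.rec with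
  | bot => rw [h] at h0; simp at h0
  | coe P => rw [h] at h0; exact Or.inr ⟨P, by exact_mod_cast h0, rfl⟩
  | top => exact Or.inl rfl

/-- The gain bound extends from unit vectors by homogeneity of degree two. This form is needed
because slices of a unit vector are not normalized. -/
lemma vcoh_mulVec_le [Nonempty ι] {V : Matrix κ ι ℂ} {P : ℝ}
    (h : ∀ u : ι → ℂ, ∑ x, wt u x = 1 → vcoh (V *ᵥ u) - vcoh u ≤ P) (v : ι → ℂ) :
    vcoh (V *ᵥ v) ≤ vcoh v + P * ∑ x, wt v x := by
  obtain ⟨u, hu, hv⟩ := exists_unit_smul v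
  have hn : 0 ≤ ∑ x, wt v x := sum_nonneg fun x _ => wt_nonneg v x
  have h1 : vcoh v = (∑ x, wt v x) * vcoh u := by
    conv_lhs => rw [hv, vcoh_smul, normSq_sqrt hn]
  have h2 : vcoh (V *ᵥ v) = (∑ x, wt v x) * vcoh (V *ᵥ u) := by
    conv_lhs => rw [hv, mulVec_smul, vcoh_smul, normSq_sqrt hn]
  have := mul_le_mul_of_nonneg_left (h u hu) hn
  rw [h1, h2]
  linarith

/-- Ancillas do not increase the gain of an isometry. -/
lemma vcoh_kronecker_one_mulVec_le [Nonempty ι] {V : Matrix κ ι ℂ} (hV : IsIsometry V) {P : ℝ}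
    (h : ∀ u : ι → ℂ, ∑ x, wt u x = 1 → vcoh (V *ᵥ u) - vcoh u ≤ P) (v : ι × ν → ℂ) :
    vcoh ((V ⊗ₖ (1 : Matrix ν ν ℂ)) *ᵥ v) ≤ vcoh v + P * ∑ x, wt v x := by
  -- `V` acts on each slice along the ancilla and preserves its weight. In the chain rule the
  -- entropy of the ancilla marginal is therefore unchanged, and only the slices contribute to the
  -- gain.
  have e : ∀ z, (fun x => ((V ⊗ₖ (1 : Matrix ν ν ℂ)) *ᵥ v) (x, z)) = V *ᵥ fun x => v (x, z) :=
    fun z => funext fun y => kronecker_one_mulVec V v y z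
  have e' : ∀ z, ∑ y, wt ((V ⊗ₖ (1 : Matrix ν ν ℂ)) *ᵥ v) (y, z) = ∑ x, wt v (x, z) := fun z => by
    have := sum_wt_mulVec_of_isometry hV fun x => v (x, z)
    rw [← e z] at this
    exact this
  rw [vcoh_chain v, vcoh_chain]
  simp only [e, e', Fintype.sum_prod_type_right, mul_sum]
  have : ∑ z, vcoh (V *ᵥ fun x => v (x, z)) ≤
      ∑ z, (vcoh (fun x => v (x, z)) + P * ∑ x, wt v (x, z)) :=
    sum_le_sum fun z _ => vcoh_mulVec_le h _
  simp only [sum_add_distrib, mul_sum] at this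
  linarith

lemma gain_le_of_powRelPure_eq {V : Matrix κ ι ℂ} (hV : IsIsometry V) {P : ℝ}
    (h : powRelPure (conjMap V) = P) (u : ι → ℂ) (hu : ∑ x, wt u x = 1) :
    vcoh (V *ᵥ u) - vcoh u ≤ P := by
  have := le_powRelPure hV hu
  rw [h] at this
  exact_mod_cast this

lemma gain_kronecker_one_le [Nonempty ι] {V : Matrix κ ι ℂ} (hV : IsIsometry V) {v : ι × ν → ℂ}
    (hv : ∑ x, wt v x = 1) :
    ((vcoh ((V ⊗ₖ (1 : Matrix ν ν ℂ)) *ᵥ v) - vcoh v : ℝ) : EReal) ≤ powRelPure (conjMap V) := by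
  rcases powRelPure_eq_top_or hV with h | ⟨P, -, h⟩
  · rw [h]; exact le_top
  · rw [h, EReal.coe_le_coe_iff]
    have := vcoh_kronecker_one_mulVec_le hV (gain_le_of_powRelPure_eq hV h) v
    rw [hv] at this
    linarith

lemma one_kronecker_mulVec_comp_swap (V : Matrix κ ι ℂ) (v : ν × ι → ℂ) :
    ((1 : Matrix ν ν ℂ) ⊗ₖ V) *ᵥ v
      = ((V ⊗ₖ (1 : Matrix ν ν ℂ)) *ᵥ (v ∘ Equiv.prodComm ι ν)) ∘ Equiv.prodComm ν κ := by
  ext ⟨z, y⟩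
  simp [mulVec, dotProduct, Fintype.sum_prod_type, Matrix.one_apply]

theorem completePowRelPure_conjMap [Nonempty ι] {V : Matrix κ ι ℂ} (hV : IsIsometry V) :
    completePowRelPure (conjMap V) = powRelPure (conjMap V) := by
  have ha : ∀ k, ampl (conjMap V) k = conjMap (V ⊗ₖ (1 : Matrix (Fin k) (Fin k) ℂ)) := fun k =>
    tensor_conjMap_id V
  have hi : ∀ k : ℕ, IsIsometry (V ⊗ₖ (1 : Matrix (Fin k) (Fin k) ℂ)) := fun k =>
    isIsometry_kronecker hV isIsometry_one
  apply le_antisymm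
  · refine iSup₂_le fun k _ => ?_
    rw [ha]
    exact powRelPure_le (hi k) fun u hu => gain_kronecker_one_le hV hu
  · refine le_iSup₂_of_le 1 le_rfl ?_
    rw [ha]
    refine powRelPure_le hV fun u hu => ?_
    have h1 : ∑ x, wt (Pi.single 0 1 : Fin 1 → ℂ) x = 1 := by rw [sum_wt_single]; simp
    have hu' : ∑ x, wt (tmul u (Pi.single 0 1 : Fin 1 → ℂ)) x = 1 := by
      rw [sum_wt_tmul, hu, h1, one_mul]
    refine le_trans (le_of_eq ?_) (le_powRelPure (hi 1) hu')
    rw [kronecker_mulVec_tmul, one_mulVec, vcoh_tmul, vcoh_tmul, h1, vcoh_single]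
    simp

theorem powRelPure_tensor [Nonempty ι] [Nonempty ι'] {V : Matrix κ ι ℂ} {W : Matrix κ' ι' ℂ}
    (hV : IsIsometry V) (hW : IsIsometry W) :
    powRelPure (tensor (conjMap V) (conjMap W)) = powRelPure (conjMap V) + powRelPure (conjMap W) := by
  rw [tensor_conjMap]
  have hVW := isIsometry_kronecker hV hW
  apply le_antisymm
  · refine powRelPure_le hVW fun u hu => ?_
    -- `W` acts first and `V` second, each with the other system as ancilla, so both gains are
    -- bounded by the powers without ancillas.
    have e : V ⊗ₖ W = (V ⊗ₖ (1 : Matrix κ' κ' ℂ)) * ((1 : Matrix ι ι ℂ) ⊗ₖ W) := by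
      rw [← mul_kronecker_mul]; simp
    set u' := ((1 : Matrix ι ι ℂ) ⊗ₖ W) *ᵥ u with hu'
    have h1 : ∑ x, wt u' x = 1 := by
      rw [sum_wt_mulVec_of_isometry (isIsometry_kronecker isIsometry_one hW), hu]
    have h2 := gain_kronecker_one_le hV h1
    have h3 := gain_kronecker_one_le hW (v := u ∘ Equiv.prodComm ι' ι)
      (by rw [sum_wt_comp_equiv, hu])
    rw [vcoh_comp_equiv, ← vcoh_comp_equiv (Equiv.prodComm ι κ'),
      ← one_kronecker_mulVec_comp_swap, ← hu'] at h3
    refine le_trans (le_of_eq ?_) (add_le_add h2 h3)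
    rw [e, ← mulVec_mulVec, ← EReal.coe_add]
    congr 1; ring
  · refine EReal.add_le_of_forall_lt fun a ha b hb => ?_
    rw [powRelPure_conjMap hV, lt_iSup_iff] at ha
    rw [powRelPure_conjMap hW, lt_iSup_iff] at hb
    obtain ⟨⟨u, hu⟩, ha⟩ := ha
    obtain ⟨⟨w, hw⟩, hb⟩ := hb
    refine (add_le_add ha.le hb.le).trans ?_
    refine le_trans (le_of_eq ?_) (le_powRelPure hVW (u := tmul u w)
      (by rw [sum_wt_tmul, hu, hw, one_mul]))
    rw [kronecker_mulVec_tmul, vcoh_tmul, vcoh_tmul, sum_wt_mulVec_of_isometry hV,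
      sum_wt_mulVec_of_isometry hW, hu, hw, ← EReal.coe_add]
    congr 1; ring

end IsometricPower

/-! ### Upper bound on the generating capacity -/

section Converse

variable {ι κ α : Type*} [Fintype ι] [DecidableEq ι] [Fintype κ] [DecidableEq κ] [Fintype α]

lemma isState_kraus {K : α → Matrix κ ι ℂ} (hK : ∑ a, (K a)ᴴ * K a = 1) {ρ : Matrix ι ι ℂ}
    (h : IsState ρ) : IsState (∑ a, K a * ρ * (K a)ᴴ) := by
  refine ⟨posSemidef_sum _ fun a _ => h.1.mul_mul_conjTranspose_same (K a), ?_⟩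
  have : ∀ a, (K a * ρ * (K a)ᴴ).trace = ((K a)ᴴ * K a * ρ).trace := fun a => by
    rw [Matrix.trace_mul_comm, ← Matrix.mul_assoc]
  simp only [Matrix.trace_sum, this]
  rw [← Matrix.trace_sum, ← Matrix.sum_mul, hK, Matrix.one_mul, h.2]

lemma cohForm_kraus_le {K : α → Matrix κ ι ℂ} (hK : ∑ a, (K a)ᴴ * K a = 1)
    (hs : ∀ a, ColSparse (K a)) {ρ : Matrix ι ι ℂ} (h : IsState ρ) :
    cohForm (∑ a, K a * ρ * (K a)ᴴ) ≤ cohForm ρ := by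
  rw [← add_zero (cohForm ρ)]
  refine cohForm_le_cohForm_add h fun m v hv => ?_
  rw [add_zero]
  refine (cohForm_le (J := Fin m × α) (isState_kraus hK h) (fun j => K j.2 *ᵥ v j.1) ?_).trans ?_
  · rw [hv, Fintype.sum_prod_type_right]
    simp only [Matrix.mul_sum, Matrix.sum_mul, mul_proj_mul]
  · rw [Fintype.sum_prod_type]
    exact sum_le_sum fun j _ => sum_vcoh_kraus_le hK hs (v j)

lemma IsIncoherentOp.isState {Λ : SuperOp ι κ} (hΛ : IsIncoherentOp Λ) {ρ : Matrix ι ι ℂ}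
    (h : IsState ρ) : IsState (Λ ρ) := by
  obtain ⟨m, K, hK, -, hΛ⟩ := hΛ
  rw [hΛ]
  exact isState_kraus hK h

lemma IsIncoherentOp.cohForm_le {Λ : SuperOp ι κ} (hΛ : IsIncoherentOp Λ) {ρ : Matrix ι ι ℂ}
    (h : IsState ρ) : cohForm (Λ ρ) ≤ cohForm ρ := by
  obtain ⟨m, K, hK, hs, hΛ⟩ := hΛ
  rw [hΛ]
  exact cohForm_kraus_le hK (fun a => (isIncoherentKraus_iff _).1 (hs a)) h

/-- The Kraus operator `⟨i| ⊗ 1`. -/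
def braLeft (κ : Type*) [DecidableEq κ] (i : ι) : Matrix κ (ι × κ) ℂ :=
  Matrix.of fun k x => if x = (i, k) then 1 else 0

lemma sum_braLeft : ∑ i : ι, (braLeft κ i)ᴴ * braLeft κ i = 1 := by
  ext ⟨i, k⟩ ⟨j, l⟩
  simp only [Matrix.sum_apply, Matrix.mul_apply, conjTranspose_apply, braLeft, of_apply,
    Matrix.one_apply, Prod.mk.injEq]
  rw [Finset.sum_eq_single i (by intro b _ hb; simp [hb.symm]) (by simp),
    Finset.sum_eq_single k (by intro b _ hb; simp [hb.symm]) (by simp)]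
  by_cases h : i = j ∧ k = l
  · obtain ⟨rfl, rfl⟩ := h; simp
  · have h' : ¬ (j = i ∧ l = k) := fun ⟨a, b⟩ => h ⟨a.symm, b.symm⟩
    simp [h, h']

lemma colSparse_braLeft (i : ι) : ColSparse (braLeft κ i) := by
  intro x y y' h h'
  simp only [braLeft, of_apply, ne_eq, ite_eq_right_iff, one_ne_zero, imp_false, not_not] at h h'
  have := h.symm.trans h'
  simpa using this

lemma traceLeft_eq_sum_braLeft (ρ : Matrix (ι × κ) (ι × κ) ℂ) :
    traceLeft ρ = ∑ i : ι, braLeft κ i * ρ * (braLeft κ i)ᴴ := by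
  ext k l
  rw [Matrix.sum_apply]
  refine sum_congr rfl fun i _ => ?_
  simp [Matrix.mul_apply, braLeft]

/-- The fidelity with the maximally coherent state. -/
noncomputable def maxFid {d : ℕ} (σ : Matrix (Fin d) (Fin d) ℂ) : ℝ :=
  (star (maxCoherent d) ⬝ᵥ (σ *ᵥ maxCoherent d)).re

lemma maxFid_sum {d : ℕ} (σ : α → Matrix (Fin d) (Fin d) ℂ) :
    maxFid (∑ a, σ a) = ∑ a, maxFid (σ a) := by
  simp only [maxFid, sum_mulVec, dotProduct_sum, Complex.re_sum]

lemma maxFid_proj {d : ℕ} (u : Fin d → ℂ) :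
    maxFid (proj u) = Complex.normSq (∑ x, u x) / d := by
  have h1 : (star (maxCoherent d) ⬝ᵥ u) = ((1 / Real.sqrt d : ℝ) : ℂ) * ∑ x, u x := by
    simp [dotProduct, maxCoherent, mul_sum]
  have h2 : (star u ⬝ᵥ maxCoherent d) = ((1 / Real.sqrt d : ℝ) : ℂ) * star (∑ x, u x) := by
    simp [dotProduct, maxCoherent, mul_sum, mul_comm]
  rw [maxFid, proj, vecMulVec_mulVec, dotProduct_smul, h2, h1]
  rw [show ∀ a b : ℂ, MulOpposite.op a • b = b * a from fun _ _ => rfl]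
  have h3 : ∀ r : ℝ, ∀ z : ℂ, (((r : ℂ) * z) * ((r : ℂ) * star z)) = ((r ^ 2 * Complex.normSq z : ℝ) : ℂ) := by
    intro r z
    rw [Complex.ofReal_mul, ← Complex.mul_conj, Complex.star_def, Complex.ofReal_pow]; ring
  rw [h3, Complex.ofReal_re, div_pow, Real.sq_sqrt (Nat.cast_nonneg d)]
  ring

/-- Every index of relative weight at most `t / d` has surprisal at least `log (d / t)`. The
remaining indices number at most `d / t`, so by Cauchy–Schwarz their amplitudes add little to the
overlap with the flat vector: most of the fidelity must come from weight spread over the light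
indices `S`. -/
lemma vcoh_ge_of_maxFid {d : ℕ} {t : ℝ} (ht : 1 ≤ t) (htd : t ≤ d) (u : Fin d → ℂ) :
    (maxFid (proj u) - 2 / Real.sqrt t * ∑ x, wt u x) * Real.logb 2 (d / t) ≤ vcoh u := by
  set W := ∑ x, wt u x with hW
  have hd : (0 : ℝ) < d := by linarith
  have hWn : 0 ≤ W := sum_nonneg fun x _ => wt_nonneg u x
  have hlog : 0 ≤ Real.logb 2 (d / t) :=
    Real.logb_nonneg one_lt_two (by rw [le_div_iff₀ (by linarith)]; linarith)
  rcases eq_or_lt_of_le hWn with hW0 | hWpos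
  · rw [eq_zero_of_sum_wt_eq_zero (v := u) (hW ▸ hW0.symm), ← hW0]
    simp [maxFid_proj]
  set S : Finset (Fin d) := {x | wt u x ≤ t / d * W} with hS
  have h1 : (∑ x ∈ S, wt u x) * Real.logb 2 (d / t) ≤ vcoh u := by
    rw [vcoh, shannon_eq_cross _ (wt_nonneg u), sum_mul]
    refine (sum_le_sum fun x hx => ?_).trans
      (sum_le_sum_of_subset_of_nonneg (subset_univ S) fun x _ _ => ?_)
    · rw [← mul_neg]
      rcases eq_or_lt_of_le (wt_nonneg u x) with h0 | h0
      · simp [← h0]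
      refine mul_le_mul_of_nonneg_left ?_ h0.le
      rw [← Real.logb_inv]
      refine Real.logb_le_logb_of_le one_lt_two (by positivity) ?_
      have hx' : wt u x ≤ t / d * W := by simpa [hS] using hx
      rw [inv_div, ← hW, le_div_iff₀ h0, div_mul_eq_mul_div, div_le_iff₀ (by linarith)]
      rw [div_mul_eq_mul_div, le_div_iff₀ hd] at hx'
      linarith
    · rw [← mul_neg]
      refine mul_nonneg (wt_nonneg u x) ?_
      rw [neg_nonneg]
      refine Real.logb_nonpos one_lt_two (div_nonneg (wt_nonneg _ _) hWn) ?_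
      rw [div_le_one hWpos]
      exact single_le_sum (f := wt u) (fun i _ => wt_nonneg u i) (mem_univ x)
  refine le_trans (mul_le_mul_of_nonneg_right ?_ hlog) h1
  have hnorm : ∀ x, ‖u x‖ ^ 2 = wt u x := fun x => (Complex.normSq_eq_norm_sq _).symm
  set a := ∑ x ∈ S, ‖u x‖ with ha
  set b := ∑ x ∈ Sᶜ, ‖u x‖ with hb
  have hab : a + b = ∑ x, ‖u x‖ := sum_add_sum_compl S _
  have ha0 : 0 ≤ a := sum_nonneg fun _ _ => norm_nonneg _
  have hb0 : 0 ≤ b := sum_nonneg fun _ _ => norm_nonneg _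
  have c1 : a ^ 2 ≤ d * ∑ x ∈ S, wt u x := by
    have := sq_sum_le_card_mul_sum_sq (s := S) (f := fun x => ‖u x‖)
    simp only [hnorm] at this
    refine this.trans (mul_le_mul_of_nonneg_right ?_ (sum_nonneg fun x _ => wt_nonneg u x))
    exact_mod_cast (card_le_univ S).trans_eq (Fintype.card_fin d)
  have c2 : (a + b) ^ 2 ≤ d * W := by
    rw [hab]
    have := sq_sum_le_card_mul_sum_sq (s := univ) (f := fun x => ‖u x‖)
    simpa only [hnorm, card_univ, Fintype.card_fin] using this
  have hcard : (#Sᶜ : ℝ) * (t / d * W) ≤ W := by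
    calc (#Sᶜ : ℝ) * (t / d * W) = ∑ x ∈ Sᶜ, t / d * W := by rw [sum_const, nsmul_eq_mul]
      _ ≤ ∑ x ∈ Sᶜ, wt u x := sum_le_sum fun x hx => by
          have : ¬ wt u x ≤ t / d * W := by simpa [hS] using hx
          linarith
      _ ≤ W := sum_le_sum_of_subset_of_nonneg (subset_univ _) fun x _ _ => wt_nonneg u x
  have hcard' : (#Sᶜ : ℝ) * t ≤ d := by
    have e : (#Sᶜ : ℝ) * (t / d * W) = (#Sᶜ : ℝ) * t / d * W := by ring
    rw [e] at hcard
    have : (#Sᶜ : ℝ) * t / d ≤ 1 := le_of_mul_le_mul_right (by linarith) hWpos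
    rwa [div_le_one hd] at this
  have c3 : b ^ 2 * t ≤ d * W := by
    have := sq_sum_le_card_mul_sum_sq (s := Sᶜ) (f := fun x => ‖u x‖)
    simp only [hnorm] at this
    have h2 : ∑ x ∈ Sᶜ, wt u x ≤ W :=
      sum_le_sum_of_subset_of_nonneg (subset_univ _) fun x _ _ => wt_nonneg u x
    have h3 : b ^ 2 ≤ (#Sᶜ : ℝ) * W := this.trans (mul_le_mul_of_nonneg_left h2 (Nat.cast_nonneg _))
    nlinarith
  have hs : 0 < Real.sqrt t := Real.sqrt_pos.2 (by linarith)
  have c4 : b * (a + b) * Real.sqrt t ≤ d * W := by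
    refine abs_le_of_sq_le_sq' ?_ (by positivity) |>.2
    rw [mul_pow, Real.sq_sqrt (by linarith)]
    have := mul_le_mul c3 c2 (sq_nonneg _) (by positivity)
    calc (b * (a + b)) ^ 2 * t = b ^ 2 * t * (a + b) ^ 2 := by ring
      _ ≤ _ := this
      _ = _ := by ring
  have hF : maxFid (proj u) * d ≤ (a + b) ^ 2 := by
    rw [maxFid_proj, div_mul_cancel₀ _ hd.ne', Complex.normSq_eq_norm_sq, hab]
    exact pow_le_pow_left₀ (norm_nonneg _) (norm_sum_le _ _) 2
  have c5 : b * (a + b) ≤ d * W / Real.sqrt t := by rwa [le_div_iff₀ hs]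
  -- The inequality used is `(a + b) ^ 2 ≤ a ^ 2 + 2 * b * (a + b)`, with `c1` for the first term
  -- and `c5` for the second.
  have c6 : maxFid (proj u) * d ≤ (∑ x ∈ S, wt u x + 2 / Real.sqrt t * W) * d := by
    have e : (∑ x ∈ S, wt u x + 2 / Real.sqrt t * W) * d
      = d * ∑ x ∈ S, wt u x + 2 * (d * W / Real.sqrt t) := by ring
    rw [e]
    nlinarith [sq_nonneg b]
  have := le_of_mul_le_mul_right c6 hd
  linarith

lemma cohForm_ge_of_maxFid {d : ℕ} {t : ℝ} (ht : 1 ≤ t) (htd : t ≤ d)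
    {σ : Matrix (Fin d) (Fin d) ℂ} (h : IsState σ) :
    (maxFid σ - 2 / Real.sqrt t) * Real.logb 2 (d / t) ≤ cohForm σ := by
  refine le_cohForm h fun m v hv => ?_
  refine le_trans (le_of_eq ?_) (sum_le_sum fun j _ => vcoh_ge_of_maxFid ht htd (v j))
  rw [← sum_mul, sum_sub_distrib, ← mul_sum, sum_wt_eq_one_of_isState h hv, mul_one, hv,
    maxFid_sum]

lemma cohForm_of_isIncoherent_le {ρ : Matrix ι ι ℂ} (h : IsIncoherent ρ) : cohForm ρ ≤ 0 := by
  refine (cohForm_le h.1 (fun x => Pi.single x (Real.sqrt (diagDist ρ x) : ℂ)) ?_).trans_eq ?_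
  · conv_lhs => rw [h.eq_realDiag]
    ext i j
    rw [Matrix.sum_apply]
    by_cases hij : i = j
    · subst hij
      rw [Finset.sum_eq_single i]
      · rw [proj_self_apply, wt_single, Pi.single_eq_same, normSq_sqrt (h.1.diagDist_nonneg i)]
        simp [realDiag]
      · intro x _ hx; simp [proj_apply, hx.symm]
      · simp
    · rw [sum_eq_zero]
      · simp [realDiag, hij]
      · intro x _
        by_cases hx : i = x
        · subst hx; simp [proj_apply, Ne.symm hij]
        · simp [proj_apply, hx]
  · simp [vcoh_single]

lemma cohForm_ampl_conjMap_le [Nonempty ι] {V : Matrix κ ι ℂ} (hV : IsIsometry V) {P : ℝ}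
    (hP : ∀ u : ι → ℂ, ∑ x, wt u x = 1 → vcoh (V *ᵥ u) - vcoh u ≤ P) {k : ℕ}
    {ρ : Matrix (ι × Fin k) (ι × Fin k) ℂ} (h : IsState ρ) :
    IsState (ampl (conjMap V) k ρ) ∧ cohForm (ampl (conjMap V) k ρ) ≤ cohForm ρ + P := by
  rw [ampl, tensor_conjMap_id]
  have hs := isState_conjMap (isIsometry_kronecker (W := (1 : Matrix (Fin k) (Fin k) ℂ)) hV
    isIsometry_one) h
  refine ⟨hs, cohForm_le_cohForm_add h fun m v hv => ?_⟩
  refine (cohForm_le hs (fun j => (V ⊗ₖ (1 : Matrix (Fin k) (Fin k) ℂ)) *ᵥ v j) ?_).trans ?_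
  · rw [hv, map_sum]
    simp only [conjMap_proj]
  · refine (sum_le_sum fun j _ => vcoh_kronecker_one_mulVec_le hV hP (v j)).trans_eq ?_
    rw [sum_add_distrib, ← mul_sum, sum_wt_eq_one_of_isState h hv, mul_one]

/-- `C_f` is followed along the protocol: zero at the start, at most `P` more at each use of `V`,
not increased by the incoherent operations nor by discarding `A`. The target fidelity bounds its
final value from below. -/
lemma HasProtocol.rate_bound [Nonempty ι] {V : Matrix κ ι ℂ} (hV : IsIsometry V) {P : ℝ}
    (hP0 : 0 ≤ P) (hP : ∀ u : ι → ℂ, ∑ x, wt u x = 1 → vcoh (V *ᵥ u) - vcoh u ≤ P)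
    {n : ℕ} {R ε t : ℝ} (h : HasProtocol (conjMap V) n R ε) (ht : 1 ≤ t)
    (hε : 0 ≤ 1 - ε - 2 / Real.sqrt t) :
    (1 - ε - 2 / Real.sqrt t) * (n * R - Real.logb 2 t) ≤ n * P := by
  obtain ⟨dim, ρ, h0, hstep, hdim, hfid⟩ := h
  have key : ∀ s ≤ n, IsState (ρ s) ∧ cohForm (ρ s) ≤ s * P := by
    intro s
    induction s with
    | zero => exact fun _ => ⟨h0.1, by simpa using cohForm_of_isIncoherent_le h0⟩
    | succ s ih =>
      intro hs
      obtain ⟨h1, h2⟩ := ih (by omega)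
      obtain ⟨Λ, hΛ, e⟩ := hstep s (by omega)
      obtain ⟨h3, h4⟩ := cohForm_ampl_conjMap_le hV hP h1
      rw [e]
      refine ⟨hΛ.isState h3, (hΛ.cohForm_le h3).trans (h4.trans ?_)⟩
      push_cast; linarith
  obtain ⟨hs, hc⟩ := key n le_rfl
  have hlog : Real.logb 2 (dim n) = n * R := by
    rw [hdim, Real.logb_rpow two_pos (by norm_num)]
  have hnP : 0 ≤ n * P := by positivity
  -- The fidelity bound requires `t ≤ dim n`; otherwise `n * R < log t` and the left side is
  -- nonpositive.
  by_cases htd : t ≤ dim n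
  · have hs' : IsState (traceLeft (ρ n)) := by
      rw [traceLeft_eq_sum_braLeft]; exact isState_kraus sum_braLeft hs
    have hc' : cohForm (traceLeft (ρ n)) ≤ cohForm (ρ n) := by
      rw [traceLeft_eq_sum_braLeft]; exact cohForm_kraus_le sum_braLeft colSparse_braLeft hs
    have := cohForm_ge_of_maxFid ht htd hs'
    rw [Real.logb_div (by linarith) (by linarith), hlog] at this
    have h5 : 0 ≤ n * R - Real.logb 2 t := by
      rw [← hlog, sub_nonneg]
      exact Real.logb_le_logb_of_le one_lt_two (by linarith) htd
    refine (mul_le_mul_of_nonneg_right ?_ h5).trans (this.trans (hc'.trans hc))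
    change 1 - ε ≤ maxFid _ at hfid
    linarith
  · refine le_trans (mul_nonpos_of_nonneg_of_nonpos hε ?_) hnP
    rw [← hlog, sub_nonpos]
    refine Real.logb_le_logb_of_le one_lt_two ?_ (not_le.1 htd).le
    rw [hdim]; positivity

/-- The rate bound is divided by `n`, with `n → ∞` at fixed `t` to remove `log t`, and `t → ∞`
afterwards. The threshold `16` makes `2 / √t ≤ 1 / 2`, so the prefactor is nonnegative once the
error is below `1 / 2`. -/
lemma IsAchievable.le [Nonempty ι] {V : Matrix κ ι ℂ} (hV : IsIsometry V) {P : ℝ}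
    (hP0 : 0 ≤ P) (hP : ∀ u : ι → ℂ, ∑ x, wt u x = 1 → vcoh (V *ᵥ u) - vcoh u ≤ P)
    {R : ℝ} (h : IsAchievable (conjMap V) R) : R ≤ P := by
  obtain ⟨r, ε, hp, hε, hr⟩ := h
  have h1 : ∀ t : ℝ, 16 ≤ t → (1 - 2 / Real.sqrt t) * R ≤ P := by
    intro t ht
    have hst : 2 / Real.sqrt t ≤ 1 / 2 := by
      have : (4 : ℝ) ≤ Real.sqrt t := Real.le_sqrt_of_sq_le (by linarith)
      rw [div_le_iff₀ (by linarith)]; linarith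
    have hlim : Tendsto (fun n : ℕ => (1 - ε n - 2 / Real.sqrt t) *
        (r n - Real.logb 2 t / n)) atTop (𝓝 ((1 - 0 - 2 / Real.sqrt t) * (R - 0))) :=
      ((tendsto_const_nhds.sub hε).sub tendsto_const_nhds).mul
        (hr.sub (tendsto_const_div_atTop_nhds_zero_nat _))
    rw [sub_zero, sub_zero] at hlim
    refine le_of_tendsto hlim ?_
    filter_upwards [hε.eventually (gt_mem_nhds (show (0 : ℝ) < 1 / 2 by norm_num)),
      eventually_gt_atTop 0] with n hn hn0
    have hn0' : (0 : ℝ) < n := by exact_mod_cast hn0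
    have := (hp n).rate_bound hV hP0 hP (t := t) (by linarith) (by linarith)
    have e : (n : ℝ) * r n - Real.logb 2 t = n * (r n - Real.logb 2 t / n) := by
      field_simp
    rw [e, mul_left_comm] at this
    exact le_of_mul_le_mul_left this hn0'
  have hlim : Tendsto (fun t : ℝ => (1 - 2 / Real.sqrt t) * R) atTop (𝓝 ((1 - 0) * R)) :=
    (tendsto_const_nhds.sub
      (Real.tendsto_sqrt_atTop.const_div_atTop 2)).mul_const R
  rw [sub_zero, one_mul] at hlim
  exact le_of_tendsto hlim (by filter_upwards [eventually_ge_atTop 16] with t ht using h1 t ht)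

theorem genCapacity_le [Nonempty ι] {V : Matrix κ ι ℂ} (hV : IsIsometry V) :
    genCapacity (conjMap V) ≤ powRelPure (conjMap V) := by
  refine iSup_le fun ⟨R, hR⟩ => ?_
  rcases powRelPure_eq_top_or hV with h | ⟨P, hP0, h⟩
  · rw [h]; exact le_top
  · rw [h, EReal.coe_le_coe_iff]
    exact hR.le hV hP0 (gain_le_of_powRelPure_eq hV h)

end Converse

/-! ### One-shot conversion of flat pure states -/

section KrausConversion

variable {X Y : Type*} [Fintype X] [DecidableEq X] [Fintype Y] [DecidableEq Y]

/-- A distribution bounded by `1 / N` is the image of any distribution supported on an `N`-element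
set under a doubly stochastic matrix, hence a mixture of relabellings of it. -/
lemma exists_perm_weights {p : X → ℝ} (hp0 : ∀ x, 0 ≤ p x) (hp1 : ∑ x, p x = 1) {T : Finset X}
    (hT : ∀ x, p x * #T ≤ 1) : ∃ w : Equiv.Perm X → ℝ, (∀ σ, 0 ≤ w σ) ∧
      ∀ x, ∀ z ∈ T, ∑ σ, (if σ x = z then w σ else 0) = p x := by
  set N : ℝ := ((#T : ℕ) : ℝ) with hN
  set n : ℝ := (Fintype.card X : ℝ) with hn
  have hcompl : ((#Tᶜ : ℕ) : ℝ) = n - N := by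
    rw [card_compl, Nat.cast_sub (card_le_univ T)]
  have hNn : 0 ≤ n - N := hcompl ▸ Nat.cast_nonneg _
  -- Columns in `T` equal `p`; the mass still missing in each row is spread evenly over the other
  -- columns. Birkhoff's theorem then provides the weights.
  set M : Matrix X X ℝ := Matrix.of fun x z => if z ∈ T then p x else (1 - p x * N) / (n - N)
  have hM : M ∈ doublyStochastic ℝ X := by
    rw [mem_doublyStochastic_iff_sum]
    refine ⟨fun x z => ?_, fun x => ?_, fun z => ?_⟩
    · simp only [M, of_apply]
      split
      · exact hp0 x
      · exact div_nonneg (by linarith [hT x]) hNn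
    · simp only [M, of_apply]
      rw [← sum_add_sum_compl T, sum_congr rfl fun z hz => if_pos hz,
        sum_congr rfl fun z (hz : z ∈ Tᶜ) => if_neg (mem_compl.1 hz), sum_const, sum_const,
        nsmul_eq_mul, nsmul_eq_mul, hcompl]
      -- If `T` is everything there is nowhere to spread mass, but then `p` is forced to be uniform
      -- and no mass is missing.
      rcases eq_or_lt_of_le hNn with h0 | h0
      · have h1 : ∑ x, (1 - p x * N) = 0 := by
          rw [sum_sub_distrib, ← sum_mul, hp1, sum_const, nsmul_eq_mul, card_univ]
          linarith
        have h2 := (sum_eq_zero_iff_of_nonneg fun x _ => sub_nonneg.2 (hT x)).1 h1 x (mem_univ x)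
        rw [← h0]
        linarith
      · rw [mul_div_cancel₀ _ h0.ne']; ring
    · simp only [M, of_apply]
      by_cases hz : z ∈ T
      · simp only [if_pos hz, hp1]
      · have h0 : 0 < n - N := by
          rw [← hcompl]; exact_mod_cast card_pos.2 ⟨z, mem_compl.2 hz⟩
        simp only [if_neg hz]
        rw [← sum_div, sum_sub_distrib, ← sum_mul, hp1, sum_const, nsmul_eq_mul, card_univ,
          mul_one, one_mul, div_self h0.ne']
  obtain ⟨w, hw0, -, hw⟩ := exists_eq_sum_perm_of_mem_doublyStochastic hM
  refine ⟨w, hw0, fun x z hz => ?_⟩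
  have := congrFun (congrFun hw x) z
  simp only [Matrix.sum_apply, Matrix.smul_apply, smul_eq_mul, M, of_apply, if_pos hz,
    Equiv.Perm.permMatrix, PEquiv.toMatrix_apply, Equiv.toPEquiv_apply, Option.mem_def,
    Option.some.injEq, mul_ite, mul_one, mul_zero] at this
  exact this

/-- A vector with weights at most `1 / N` is converted to any vector with at most `N` nonzero
entries by incoherent Kraus operators. -/
lemma exists_kraus_conversion {a : X → ℂ} {b : Y → ℂ} (ha : ∑ x, wt a x = 1)
    (hb : ∑ y, wt b y = 1) (h : ∀ x, wt a x * #{y | b y ≠ 0} ≤ 1) :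
    ∃ (K : Equiv.Perm X ⊕ X → Matrix Y X ℂ) (c : Equiv.Perm X ⊕ X → ℂ),
      ∑ i, (K i)ᴴ * K i = 1 ∧ (∀ i, ColSparse (K i)) ∧ ∀ i, K i *ᵥ a = c i • b := by
  classical
  set S : Finset Y := {y | b y ≠ 0} with hS
  have hX : Nonempty X := by
    by_contra hn
    rw [not_nonempty_iff] at hn
    simp at ha
  have hY : Nonempty Y := by
    by_contra hn
    rw [not_nonempty_iff] at hn
    simp at hb
  have hcard : #S ≤ Fintype.card X := by
    have : ∑ x, wt a x * (#S : ℝ) ≤ ∑ x : X, (1 : ℝ) := sum_le_sum fun x _ => h x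
    rw [← sum_mul, ha, one_mul, sum_const, nsmul_eq_mul, mul_one, card_univ] at this
    exact_mod_cast this
  obtain ⟨j, hj⟩ : ∃ j : Y → X, Set.InjOn j (S : Set Y) := by
    obtain ⟨f⟩ : Nonempty (S ↪ X) :=
      Function.Embedding.nonempty_of_card_le (by rwa [Fintype.card_coe])
    refine ⟨fun y => if hy : y ∈ S then f ⟨y, hy⟩ else Classical.arbitrary X, ?_⟩
    intro y hy y' hy' e
    simp only [mem_coe] at hy hy'
    simp only [dif_pos hy, dif_pos hy'] at e
    exact congrArg Subtype.val (f.injective e)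
  obtain ⟨w, hw0, hw⟩ := exists_perm_weights (wt_nonneg a) ha (T := S.image j)
    (by rw [card_image_of_injOn hj]; exact h)
  have hw' : ∀ x y, b y ≠ 0 → ∑ σ : Equiv.Perm X, (if σ x = j y then w σ else 0) = wt a x :=
    fun x y hy => hw x (j y) (mem_image_of_mem j (by simpa [hS] using hy))
  set y₀ := Classical.arbitrary Y
  -- The operator for `σ` moves the amplitude at `σ⁻¹ (j y)` to `y` and rescales it to that of `b`,
  -- so every outcome yields a multiple of `b`. On the zeros of `a` division makes these columns
  -- vanish; the second family restores completeness there and annihilates `a`.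
  set K : Equiv.Perm X ⊕ X → Matrix Y X ℂ := Sum.elim
    (fun σ => Matrix.of fun y x => if σ x = j y then (Real.sqrt (w σ) : ℂ) * b y / a x else 0)
    (fun z => Matrix.of fun y x => if a x = 0 ∧ x = z ∧ y = y₀ then 1 else 0) with hK
  set c : Equiv.Perm X ⊕ X → ℂ := Sum.elim (fun σ => (Real.sqrt (w σ) : ℂ)) fun _ => 0 with hc
  refine ⟨K, c, ?_, ?_, ?_⟩
  · ext x x'
    rw [Matrix.sum_apply, Fintype.sum_sum_type]
    simp only [hK, Sum.elim_inl, Sum.elim_inr, Matrix.mul_apply, conjTranspose_apply, of_apply]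
    by_cases hxx : x = x'
    · subst hxx
      rw [Matrix.one_apply_eq]
      have e1 : ∑ σ : Equiv.Perm X, ∑ y,
          star (if σ x = j y then (Real.sqrt (w σ) : ℂ) * b y / a x else 0) *
            (if σ x = j y then (Real.sqrt (w σ) : ℂ) * b y / a x else 0)
          = ((∑ y, wt b y * (wt a x / wt a x) : ℝ) : ℂ) := by
        rw [sum_comm, Complex.ofReal_sum]
        refine sum_congr rfl fun y _ => ?_
        by_cases hy : b y = 0
        · simp [hy, wt]
        · have e : wt b y * (wt a x / wt a x)
              = ∑ σ : Equiv.Perm X, if σ x = j y then w σ * wt b y / wt a x else 0 := by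
            have e' : ∀ σ : Equiv.Perm X, (if σ x = j y then w σ * wt b y / wt a x else 0)
                = (if σ x = j y then w σ else 0) * (wt b y / wt a x) := fun σ => by
              split <;> ring
            simp only [e']
            rw [← sum_mul, hw' x y hy]
            ring
          rw [e, Complex.ofReal_sum]
          refine sum_congr rfl fun σ _ => ?_
          by_cases hσ : σ x = j y
          · rw [if_pos hσ, if_pos hσ, Complex.star_def, ← Complex.normSq_eq_conj_mul_self,
              Complex.normSq_div, Complex.normSq_mul, normSq_sqrt (hw0 σ)]
            rfl
          · simp [hσ]
      have e2 : ∑ z, ∑ y, star (if a x = 0 ∧ x = z ∧ y = y₀ then (1 : ℂ) else 0) *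
          (if a x = 0 ∧ x = z ∧ y = y₀ then (1 : ℂ) else 0) = if a x = 0 then 1 else 0 := by
        rw [Finset.sum_eq_single x (by intro z _ hz; simp [hz.symm]) (by simp),
          Finset.sum_eq_single y₀ (by intro z _ hz; simp [hz]) (by simp)]
        by_cases h0 : a x = 0 <;> simp [h0]
      rw [e1, e2, ← sum_mul, hb, one_mul]
      by_cases h0 : a x = 0
      · simp [h0, wt]
      · have : wt a x ≠ 0 := by simpa [wt] using h0
        rw [div_self this, if_neg h0]; simp
    · rw [Matrix.one_apply_ne hxx, sum_eq_zero, sum_eq_zero, add_zero]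
      · refine fun z _ => sum_eq_zero fun y _ => ?_
        by_cases hz : x = z
        · have : x' ≠ z := fun h => hxx (hz.trans h.symm)
          simp [this]
        · simp [hz]
      · refine fun σ _ => sum_eq_zero fun y _ => ?_
        by_cases hσ : σ x = j y
        · have : σ x' ≠ j y := fun h => hxx (σ.injective (hσ.trans h.symm))
          simp [this]
        · simp [hσ]
  · rintro (σ | z) x y y' hy hy'
    · simp only [hK, Sum.elim_inl, of_apply, ne_eq, ite_eq_right_iff, not_forall] at hy hy'
      obtain ⟨h1, h2⟩ := hy
      obtain ⟨h1', h2'⟩ := hy'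
      refine hj ?_ ?_ (h1.symm.trans h1')
      · simp only [hS, coe_filter, mem_univ, true_and, Set.mem_ofPred_eq]
        exact fun h0 => h2 (by simp [h0])
      · simp only [hS, coe_filter, mem_univ, true_and, Set.mem_ofPred_eq]
        exact fun h0 => h2' (by simp [h0])
    · simp only [hK, Sum.elim_inr, of_apply, ne_eq, ite_eq_right_iff, one_ne_zero, imp_false,
        not_not] at hy hy'
      rw [hy.2.2, hy'.2.2]
  · rintro (σ | z)
    · ext y
      simp only [hK, hc, Sum.elim_inl, Pi.smul_apply, smul_eq_mul, mulVec, dotProduct, of_apply]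
      rw [Finset.sum_eq_single (σ.symm (j y))]
      · rw [Equiv.apply_symm_apply, if_pos rfl]
        -- Here the rescaling would divide by zero, but the permutations sending this index to `j y`
        -- have total weight `wt a x = 0`, so `w σ = 0`.
        by_cases h0 : a (σ.symm (j y)) = 0
        · by_cases hy : b y = 0
          · simp [hy]
          · have h1 := hw' (σ.symm (j y)) y hy
            rw [show wt a (σ.symm (j y)) = 0 by simp [wt, h0]] at h1
            have h2 := (sum_eq_zero_iff_of_nonneg fun τ _ => by
              split
              · exact hw0 τ
              · exact le_rfl).1 h1 σ (mem_univ σ)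
            rw [Equiv.apply_symm_apply, if_pos rfl] at h2
            simp [h2]
        · rw [div_mul_cancel₀ _ h0]
      · intro x _ hx
        have : σ x ≠ j y := fun h => hx (by rw [← h, Equiv.symm_apply_apply])
        simp [this]
      · simp
    · ext y
      simp only [hK, hc, Sum.elim_inr, zero_smul, Pi.zero_apply, mulVec, dotProduct, of_apply]
      refine sum_eq_zero fun x _ => ?_
      by_cases h0 : a x = 0
      · simp [h0]
      · simp [h0]

end KrausConversion

/-! ### Closure properties of incoherent operations -/

section OperationCalculus

variable {ι κ ν α : Type*} [Fintype ι] [DecidableEq ι] [Fintype κ] [DecidableEq κ]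
  [Fintype ν] [DecidableEq ν] [Fintype α]

/-- The map with the given Kraus operators. -/
def krausMap (K : α → Matrix κ ι ℂ) : SuperOp ι κ := ∑ a, conjMap (K a)

lemma krausMap_apply (K : α → Matrix κ ι ℂ) (X : Matrix ι ι ℂ) :
    krausMap K X = ∑ a, K a * X * (K a)ᴴ := by
  simp [krausMap, LinearMap.sum_apply, conjMap_apply]

lemma isIncoherentOp_of_kraus (K : α → Matrix κ ι ℂ) (hK : ∑ a, (K a)ᴴ * K a = 1)
    (hs : ∀ a, ColSparse (K a)) {Λ : SuperOp ι κ} (hΛ : ∀ X, Λ X = ∑ a, K a * X * (K a)ᴴ) :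
    IsIncoherentOp Λ := by
  let e := (Fintype.equivFin α).symm
  refine ⟨Fintype.card α, fun i => K (e i), ?_, fun i => (isIncoherentKraus_iff _).2 (hs _),
    fun X => ?_⟩
  · rw [← hK]; exact e.sum_comp fun a => (K a)ᴴ * K a
  · rw [hΛ]; exact (e.sum_comp fun a => K a * X * (K a)ᴴ).symm

lemma ColSparse.mul {K : Matrix κ ι ℂ} {L : Matrix ν κ ℂ} (hL : ColSparse L) (hK : ColSparse K) :
    ColSparse (L * K) := by
  intro x y y' h h'
  rw [Matrix.mul_apply] at h h'
  obtain ⟨z, -, hz⟩ := exists_ne_zero_of_sum_ne_zero h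
  obtain ⟨z', -, hz'⟩ := exists_ne_zero_of_sum_ne_zero h'
  have e := hK x z z' (right_ne_zero_of_mul hz) (right_ne_zero_of_mul hz')
  subst e
  exact hL z y y' (left_ne_zero_of_mul hz) (left_ne_zero_of_mul hz')

lemma ColSparse.kronecker_one {K : Matrix κ ι ℂ} (hK : ColSparse K) :
    ColSparse (K ⊗ₖ (1 : Matrix ν ν ℂ)) := by
  rintro ⟨x, z⟩ ⟨y, w⟩ ⟨y', w'⟩ h h'
  simp only [kroneckerMap_apply, Matrix.one_apply, mul_ite, mul_one, mul_zero, ne_eq,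
    ite_eq_right_iff, not_forall] at h h'
  obtain ⟨h1, h2⟩ := h
  obtain ⟨h1', h2'⟩ := h'
  rw [hK x y y' h2 h2', h1, h1']

lemma IsIncoherentOp.comp {Λ : SuperOp ι κ} {Λ' : SuperOp κ ν} (h' : IsIncoherentOp Λ')
    (h : IsIncoherentOp Λ) : IsIncoherentOp (Λ' ∘ₗ Λ) := by
  obtain ⟨m, K, hK, hs, hΛ⟩ := h
  obtain ⟨n, L, hL, hs', hΛ'⟩ := h'
  refine isIncoherentOp_of_kraus (α := Fin m × Fin n) (fun i => L i.2 * K i.1) ?_ (fun i =>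
    ((isIncoherentKraus_iff _).1 (hs' _)).mul ((isIncoherentKraus_iff _).1 (hs _))) fun X => ?_
  · have e : ∀ a b, (L b * K a)ᴴ * (L b * K a) = (K a)ᴴ * ((L b)ᴴ * L b) * K a := fun a b => by
      rw [conjTranspose_mul]; simp only [Matrix.mul_assoc]
    simp only [Fintype.sum_prod_type, e, ← Matrix.sum_mul, ← Matrix.mul_sum, hL, Matrix.mul_one, hK]
  · rw [LinearMap.comp_apply, hΛ', hΛ, Fintype.sum_prod_type_right]
    simp only [Matrix.mul_sum, Matrix.sum_mul, conjTranspose_mul, Matrix.mul_assoc]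

lemma isIncoherentOp_relabel (e : ι ≃ κ) : IsIncoherentOp (relabel e) := by
  have hK : ∀ K : Matrix κ ι ℂ, K = (Matrix.of fun y x => if e x = y then 1 else 0) →
      Kᴴ * K = 1 ∧ ∀ X, relabel e X = K * X * Kᴴ := by
    rintro K rfl
    constructor
    · ext x x'
      simp [Matrix.mul_apply, Matrix.one_apply, eq_comm]
    · intro X
      ext y y'
      obtain ⟨x, rfl⟩ := e.surjective y
      obtain ⟨x', rfl⟩ := e.surjective y'
      simp [Matrix.mul_apply, relabel_apply]
  obtain ⟨h1, h2⟩ := hK _ rfl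
  refine isIncoherentOp_of_kraus (α := Unit) (fun _ => _) (by simpa using h1) ?_
    (by simpa using h2)
  rintro - x y y' h h'
  simp only [of_apply, ne_eq, ite_eq_right_iff, one_ne_zero, imp_false, not_not] at h h'
  rw [← h, ← h']

lemma IsIncoherentOp.posSemidef {Λ : SuperOp ι κ} (h : IsIncoherentOp Λ) {X : Matrix ι ι ℂ}
    (hX : X.PosSemidef) : (Λ X).PosSemidef := by
  obtain ⟨m, K, -, -, hΛ⟩ := h
  rw [hΛ]
  exact posSemidef_sum _ fun a _ => hX.mul_mul_conjTranspose_same (K a)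

lemma IsIncoherentOp.trace {Λ : SuperOp ι κ} (h : IsIncoherentOp Λ) (X : Matrix ι ι ℂ) :
    (Λ X).trace = X.trace := by
  obtain ⟨m, K, hK, -, hΛ⟩ := h
  have : ∀ a, (K a * X * (K a)ᴴ).trace = ((K a)ᴴ * K a * X).trace := fun a => by
    rw [Matrix.trace_mul_comm, ← Matrix.mul_assoc]
  rw [hΛ]
  simp only [Matrix.trace_sum, this]
  rw [← Matrix.trace_sum, ← Matrix.sum_mul, hK, Matrix.one_mul]

lemma IsIncoherentOp.isIncoherent {Λ : SuperOp ι κ} (h : IsIncoherentOp Λ) {ρ : Matrix ι ι ℂ}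
    (hρ : IsIncoherent ρ) : IsIncoherent (Λ ρ) := by
  refine ⟨h.isState hρ.1, ?_⟩
  obtain ⟨m, K, hK, hs, hΛ⟩ := h
  rw [hΛ]
  intro i j hij
  rw [Matrix.sum_apply]
  exact sum_eq_zero fun a _ => hs a ρ hρ hij

end OperationCalculus

/-! ### States reachable with finitely many uses, and their approximation -/

section Preparation

variable {ι κ X Y Z : Type*} [Fintype ι] [DecidableEq ι] [Fintype κ] [DecidableEq κ]
  [Fintype X] [DecidableEq X] [Fintype Y] [DecidableEq Y] [Fintype Z] [DecidableEq Z]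

/-- The states on `A ⊗ A_n` that arise in generation protocols with `n` uses of `T`. -/
inductive Prepared (T : SuperOp ι κ) :
    ℕ → ∀ d : ℕ, Matrix (ι × Fin d) (ι × Fin d) ℂ → Prop
  | init {d : ℕ} {ρ : Matrix (ι × Fin d) (ι × Fin d) ℂ} (h : IsIncoherent ρ) : Prepared T 0 d ρ
  | step {n d d' : ℕ} {ρ : Matrix (ι × Fin d) (ι × Fin d) ℂ}
      {Λ : SuperOp (κ × Fin d) (ι × Fin d')} (h : Prepared T n d ρ) (hΛ : IsIncoherentOp Λ) :
      Prepared T (n + 1) d' (Λ (ampl T d ρ))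

/-- One round of a generation protocol: a use of `T` followed by an incoherent operation. -/
def ProtocolStep (T : SuperOp ι κ) (x y : Σ d : ℕ, Matrix (ι × Fin d) (ι × Fin d) ℂ) : Prop :=
  ∃ Λ : SuperOp (κ × Fin x.1) (ι × Fin y.1), IsIncoherentOp Λ ∧ y.2 = Λ (ampl T x.1 x.2)

lemma Prepared.exists_sequence {T : SuperOp ι κ} {n d : ℕ}
    {σ : Matrix (ι × Fin d) (ι × Fin d) ℂ} (h : Prepared T n d σ) :
    ∃ s : ℕ → (Σ d : ℕ, Matrix (ι × Fin d) (ι × Fin d) ℂ), IsIncoherent (s 0).2 ∧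
      (∀ t < n, ProtocolStep T (s t) (s (t + 1))) ∧ s n = ⟨d, σ⟩ := by
  induction h with
  | @init d ρ h => exact ⟨fun _ => ⟨d, ρ⟩, h, fun t ht => absurd ht (Nat.not_lt_zero t), rfl⟩
  | @step n d d' ρ Λ h hΛ ih =>
    obtain ⟨s, h0, hs, hn⟩ := ih
    have hle : ∀ t ≤ n, (if t ≤ n then s t else ⟨d', Λ (ampl T d ρ)⟩) = s t := fun t ht => if_pos ht
    have hlast : (if n + 1 ≤ n then s (n + 1) else ⟨d', Λ (ampl T d ρ)⟩) = ⟨d', Λ (ampl T d ρ)⟩ :=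
      if_neg (Nat.not_succ_le_self n)
    refine ⟨fun t => if t ≤ n then s t else ⟨d', Λ (ampl T d ρ)⟩, h0, fun t ht => ?_, hlast⟩
    rcases Nat.lt_succ_iff_lt_or_eq.1 ht with h1 | rfl
    · simp only [hle t h1.le, hle (t + 1) h1]
      exact hs t h1
    · beta_reduce
      rw [hlast, hle t le_rfl, hn]
      exact ⟨Λ, hΛ, rfl⟩

/-- The states on `X` that can be produced by incoherent operations with `n` uses of `T`. -/
def Produces (T : SuperOp ι κ) : ℕ → Matrix X X ℂ → Prop
  | 0, σ => IsIncoherent σ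
  | n + 1, σ => ∃ (d : ℕ) (ρ : Matrix (ι × Fin d) (ι × Fin d) ℂ) (Λ : SuperOp (κ × Fin d) X),
      Prepared T n d ρ ∧ IsIncoherentOp Λ ∧ σ = Λ (ampl T d ρ)

lemma Produces.map {T : SuperOp ι κ} {n : ℕ} {σ : Matrix X X ℂ} (h : Produces T n σ)
    {Λ : SuperOp X Y} (hΛ : IsIncoherentOp Λ) : Produces T n (Λ σ) := by
  cases n with
  | zero => exact hΛ.isIncoherent h
  | succ n =>
    obtain ⟨d, ρ, Λ', h1, h2, rfl⟩ := h
    exact ⟨d, ρ, Λ ∘ₗ Λ', h1, hΛ.comp h2, rfl⟩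

lemma Produces.prepared {T : SuperOp ι κ} {n d : ℕ} {σ : Matrix (ι × Fin d) (ι × Fin d) ℂ}
    (h : Produces T n σ) : Prepared T n d σ := by
  cases n with
  | zero => exact .init h
  | succ n =>
    obtain ⟨d, ρ, Λ', h1, h2, rfl⟩ := h
    exact .step h1 h2

lemma Produces.use {T : SuperOp ι κ} {n : ℕ} {σ : Matrix (ι × X) (ι × X) ℂ}
    (h : Produces T n σ) : Produces T (n + 1) (tensor T (LinearMap.id : SuperOp X X) σ) := by
  set e := Fintype.equivFin X
  refine ⟨Fintype.card X, relabel ((Equiv.refl ι).prodCongr e) σ,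
    relabel ((Equiv.refl κ).prodCongr e.symm), (h.map (isIncoherentOp_relabel _)).prepared,
    isIncoherentOp_relabel _, ?_⟩
  rw [← tensor_relabel, ← tensor_relabel, ampl, ← LinearMap.comp_apply, ← LinearMap.comp_apply,
    tensor_comp, tensor_comp]
  congr 2
  ext1 M
  exact (relabel_symm_relabel e M).symm

/-- With `n` uses of the isometry `V` one can produce a state that dominates `|ψ⟩⟨ψ|` up to an
error operator of trace at most `ε`. -/
def Approximates (V : Matrix κ ι ℂ) (n : ℕ) (ψ : X → ℂ) (ε : ℝ) : Prop :=
  ∃ σ E : Matrix X X ℂ, Produces (conjMap V) n σ ∧ E.PosSemidef ∧ E.trace.re ≤ ε ∧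
    (σ + E - proj ψ).PosSemidef

lemma Approximates.mono {V : Matrix κ ι ℂ} {n : ℕ} {ψ : X → ℂ} {ε ε' : ℝ}
    (h : Approximates V n ψ ε) (hε : ε ≤ ε') : Approximates V n ψ ε' := by
  obtain ⟨σ, E, h1, h2, h3, h4⟩ := h
  exact ⟨σ, E, h1, h2, h3.trans hε, h4⟩

/-- The error is an operator inequality, so a positive trace-preserving linear map carries it along
without loss. This is why `Approximates` is one-sided and involves no norm. -/
lemma Approximates.map {V : Matrix κ ι ℂ} {n : ℕ} {ψ : X → ℂ} {χ : Y → ℂ} {ε : ℝ}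
    (h : Approximates V n ψ ε) {Λ : SuperOp X Y} (hΛ : IsIncoherentOp Λ)
    (he : Λ (proj ψ) = proj χ) : Approximates V n χ ε := by
  obtain ⟨σ, E, h1, h2, h3, h4⟩ := h
  refine ⟨Λ σ, Λ E, h1.map hΛ, hΛ.posSemidef h2, by rwa [hΛ.trace], ?_⟩
  have := hΛ.posSemidef h4
  rwa [map_sub, map_add, he] at this

lemma Approximates.relabel {V : Matrix κ ι ℂ} {n : ℕ} {ψ : X → ℂ} {ε : ℝ}
    (h : Approximates V n ψ ε) (e : Y ≃ X) : Approximates V n (ψ ∘ e) ε :=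
  h.map (isIncoherentOp_relabel e.symm) rfl

lemma Approximates.use {V : Matrix κ ι ℂ} (hV : IsIsometry V) {n : ℕ} {ψ : ι × X → ℂ} {ε : ℝ}
    (h : Approximates V n ψ ε) :
    Approximates V (n + 1) ((V ⊗ₖ (1 : Matrix X X ℂ)) *ᵥ ψ) ε := by
  obtain ⟨σ, E, h1, h2, h3, h4⟩ := h
  have hu := h1.use
  rw [tensor_conjMap_id] at hu
  refine ⟨_, conjMap (V ⊗ₖ (1 : Matrix X X ℂ)) E, hu, h2.mul_mul_conjTranspose_same _, ?_, ?_⟩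
  · rwa [conjMap_apply, Matrix.trace_mul_comm, ← Matrix.mul_assoc,
      isIsometry_kronecker hV isIsometry_one, Matrix.one_mul]
  · rw [← conjMap_proj, ← map_add, ← map_sub]
    exact h4.mul_mul_conjTranspose_same _

/-- An operator form of Young's inequality: the difference is the rank-one operator of `√s u - v /
√s`. -/
lemma proj_add_le {s : ℝ} (hs : 0 < s) (u v : X → ℂ) :
    ((1 + s : ℝ) • proj u + (1 + s⁻¹ : ℝ) • proj v - proj (u + v)).PosSemidef := by
  have : (1 + s : ℝ) • proj u + (1 + s⁻¹ : ℝ) • proj v - proj (u + v)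
      = proj ((Real.sqrt s : ℂ) • u - ((Real.sqrt s)⁻¹ : ℂ) • v) := by
    have h1 : (Real.sqrt s : ℂ) * Real.sqrt s = s := by
      rw [← Complex.ofReal_mul, Real.mul_self_sqrt hs.le]
    have h0 : (Real.sqrt s : ℂ) ≠ 0 := by
      rw [Ne, Complex.ofReal_eq_zero]; exact (Real.sqrt_pos.2 hs).ne'
    have h2 : ((Real.sqrt s)⁻¹ : ℂ) * (Real.sqrt s : ℂ)⁻¹ = (s : ℂ)⁻¹ := by
      rw [← mul_inv, h1]
    have h3 : (Real.sqrt s : ℂ) * (Real.sqrt s : ℂ)⁻¹ = 1 := mul_inv_cancel₀ h0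
    ext x y
    simp only [Matrix.sub_apply, Matrix.add_apply, Matrix.smul_apply, proj_apply, Pi.add_apply,
      Pi.sub_apply, Pi.smul_apply, smul_eq_mul, star_add, star_sub, star_mul', Complex.star_def,
      Complex.conj_ofReal, map_inv₀, Complex.real_smul, Complex.ofReal_add, Complex.ofReal_one,
      Complex.ofReal_inv]
    linear_combination (-u x * (starRingEnd ℂ) (u y)) * h1 - (v x * (starRingEnd ℂ) (v y)) * h2
      + (u x * (starRingEnd ℂ) (v y) + v x * (starRingEnd ℂ) (u y)) * h3
  rw [this]
  exact proj_posSemidef _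

lemma Approximates.perturb {V : Matrix κ ι ℂ} {n : ℕ} {ψ ψ' : X → ℂ} {ε s : ℝ} (hs : 0 < s)
    (h : Approximates V n ψ ε) (hψ : ∑ x, wt ψ x = 1) (hd : ∑ x, wt (ψ' - ψ) x ≤ s ^ 2) :
    Approximates V n ψ' (ε + (2 * s + s ^ 2)) := by
  obtain ⟨σ, E, h1, h2, h3, h4⟩ := h
  -- The two added terms have trace at most `s + (1 + s⁻¹) * s ^ 2 = 2 * s + s ^ 2`.
  refine ⟨σ, E + (s • proj ψ + (1 + s⁻¹ : ℝ) • proj (ψ' - ψ)), h1,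
    h2.add (((proj_posSemidef ψ).smul hs.le).add ((proj_posSemidef _).smul (by positivity))),
    ?_, ?_⟩
  · rw [Matrix.trace_add, Matrix.trace_add, Matrix.trace_smul, Matrix.trace_smul, trace_proj,
      trace_proj, hψ]
    simp only [Complex.add_re, Complex.real_smul, Complex.mul_re, Complex.ofReal_re,
      Complex.ofReal_im, mul_zero, sub_zero, mul_one]
    have : (1 + s⁻¹) * ∑ x, wt (ψ' - ψ) x ≤ (1 + s⁻¹) * s ^ 2 :=
      mul_le_mul_of_nonneg_left hd (by positivity)
    have e : (1 + s⁻¹) * s ^ 2 = s ^ 2 + s := by field_simp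
    linarith
  · have := h4.add (proj_add_le hs ψ (ψ' - ψ))
    rw [show ψ + (ψ' - ψ) = ψ' by abel] at this
    convert this using 1
    module

end Preparation

/-! ### Calculus of approximate pure-state transformations -/

section Transformation

variable {ι κ X Y Z W : Type*} [Fintype ι] [DecidableEq ι] [Fintype κ] [DecidableEq κ]
  [Fintype X] [DecidableEq X] [Fintype Y] [DecidableEq Y] [Fintype Z] [DecidableEq Z]
  [Fintype W] [DecidableEq W]

/-- In the presence of any unit vector on an ancilla, `a` can be transformed into `b` with `c` uses
of `V` and an additional error `δ`. -/
def Transforms (V : Matrix κ ι ℂ) (c : ℕ) (δ : ℝ) (a : X → ℂ) (b : Y → ℂ) : Prop :=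
  ∀ (k n : ℕ) (ζ : Fin k → ℂ) (ε : ℝ), ∑ z, wt ζ z = 1 →
    Approximates V n (tmul a ζ) ε → Approximates V (n + c) (tmul b ζ) (ε + δ)

variable {V : Matrix κ ι ℂ}

lemma Transforms.apply {c : ℕ} {δ : ℝ} {a : X → ℂ} {b : Y → ℂ} (h : Transforms V c δ a b)
    {n : ℕ} {ζ : Z → ℂ} {ε : ℝ} (hζ : ∑ z, wt ζ z = 1) (ha : Approximates V n (tmul a ζ) ε) :
    Approximates V (n + c) (tmul b ζ) (ε + δ) := by
  set e := Fintype.equivFin Z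
  have h1 := ha.relabel ((Equiv.refl X).prodCongr e.symm)
  have h2 := h _ n (ζ ∘ e.symm) ε (by rw [sum_wt_comp_equiv, hζ]) h1
  have h3 := h2.relabel ((Equiv.refl Y).prodCongr e)
  convert h3 using 1
  ext x
  simp [tmul]

lemma Transforms.mono {c : ℕ} {δ δ' : ℝ} {a : X → ℂ} {b : Y → ℂ} (h : Transforms V c δ a b)
    (hδ : δ ≤ δ') : Transforms V c δ' a b := fun k n ζ ε hζ ha =>
  (h k n ζ ε hζ ha).mono (by linarith)

lemma Transforms.trans {c c' : ℕ} {δ δ' : ℝ} {a : X → ℂ} {b : Y → ℂ} {d : Z → ℂ}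
    (h : Transforms V c δ a b) (h' : Transforms V c' δ' b d) :
    Transforms V (c + c') (δ + δ') a d := fun k n ζ ε hζ ha => by
  rw [← add_assoc, ← add_assoc]
  exact h' k _ ζ _ hζ (h k n ζ ε hζ ha)

lemma Transforms.relabel (a : X → ℂ) (e : Y ≃ X) : Transforms V 0 0 a (a ∘ e) :=
  fun k n ζ ε _ ha => by
    rw [add_zero, add_zero]
    exact ha.relabel (e.prodCongr (Equiv.refl _))

/-- The spectator is absorbed into the ancilla over which `Transforms` quantifies. Hence
transformations may act on parts of a larger product, with errors and uses adding up. -/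
lemma Transforms.tmul_right {c : ℕ} {δ : ℝ} {a : X → ℂ} {b : Y → ℂ} (h : Transforms V c δ a b)
    {w : W → ℂ} (hw : ∑ x, wt w x = 1) : Transforms V c δ (tmul a w) (tmul b w) := by
  intro k n ζ ε hζ ha
  have h1 := ha.relabel (Equiv.prodAssoc X W (Fin k)).symm
  have e1 : tmul (tmul a w) ζ ∘ (Equiv.prodAssoc X W (Fin k)).symm = tmul a (tmul w ζ) := by
    ext x; simp [tmul, mul_assoc]
  rw [e1] at h1
  have h2 := (h.apply (by rw [sum_wt_tmul, hw, hζ, one_mul]) h1).relabel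
    (Equiv.prodAssoc Y W (Fin k))
  have e2 : tmul b (tmul w ζ) ∘ (Equiv.prodAssoc Y W (Fin k)) = tmul (tmul b w) ζ := by
    ext x; simp [tmul, mul_assoc]
  rwa [e2] at h2

lemma tmul_swap (a : X → ℂ) (w : W → ℂ) : tmul w a ∘ Equiv.prodComm X W = tmul a w := by
  ext x; simp [tmul, mul_comm]

lemma Transforms.tmul_left {c : ℕ} {δ : ℝ} {a : X → ℂ} {b : Y → ℂ} (h : Transforms V c δ a b)
    {w : W → ℂ} (hw : ∑ x, wt w x = 1) : Transforms V c δ (tmul w a) (tmul w b) := by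
  have h1 : Transforms V 0 0 (tmul w a) (tmul a w) := by
    rw [← tmul_swap a w]; exact .relabel _ _
  have h2 : Transforms V 0 0 (tmul b w) (tmul w b) := by
    rw [← tmul_swap w b]; exact .relabel _ _
  simpa using (h1.trans (h.tmul_right hw)).trans h2

lemma Transforms.use (hV : IsIsometry V) (φ : ι → ℂ) : Transforms V 1 0 φ (V *ᵥ φ) := by
  intro k n ζ ε _ ha
  have := ha.use hV
  rwa [kronecker_mulVec_tmul, one_mulVec, ← add_zero ε] at this

lemma Transforms.perturb {a a' : X → ℂ} {s : ℝ} (hs : 0 < s) (ha : ∑ x, wt a x = 1)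
    (hd : ∑ x, wt (a' - a) x ≤ s ^ 2) : Transforms V 0 (2 * s + s ^ 2) a a' := by
  intro k n ζ ε hζ h
  refine h.perturb hs (by rw [sum_wt_tmul, ha, hζ, one_mul]) ?_
  have : tmul a' ζ - tmul a ζ = tmul (a' - a) ζ := by
    ext x; simp [tmul, sub_mul]
  rw [this, sum_wt_tmul, hζ, mul_one]
  exact hd

/-- All Kraus operators send `a` to multiples of the same `b`, so the outcomes recombine into a pure
`b`, and tensoring with an ancilla does not disturb this. -/
lemma Transforms.of_weights {a : X → ℂ} {b : Y → ℂ} (ha : ∑ x, wt a x = 1)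
    (hb : ∑ y, wt b y = 1) (h : ∀ x, wt a x * #{y | b y ≠ 0} ≤ 1) : Transforms V 0 0 a b := by
  intro k n ζ ε _ hap
  rw [add_zero, add_zero]
  obtain ⟨K, c, hK, hs, hKa⟩ := exists_kraus_conversion ha hb h
  have hc : ∑ i, Complex.normSq (c i) = 1 := by
    have := sum_wt_kraus hK a
    simpa only [hKa, wt_smul, ← mul_sum, hb, mul_one, ha] using this
  refine hap.map (isIncoherentOp_of_kraus (fun i => K i ⊗ₖ (1 : Matrix (Fin k) (Fin k) ℂ)) ?_
    (fun i => (hs i).kronecker_one) (krausMap_apply _)) ?_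
  · have : ∀ i, (K i ⊗ₖ (1 : Matrix (Fin k) (Fin k) ℂ))ᴴ * (K i ⊗ₖ (1 : Matrix (Fin k) (Fin k) ℂ))
        = ((K i)ᴴ * K i) ⊗ₖ (1 : Matrix (Fin k) (Fin k) ℂ) := fun i => by
      rw [conjTranspose_kronecker, ← mul_kronecker_mul]; simp
    simp only [this]
    have e : ∑ i, ((K i)ᴴ * K i) ⊗ₖ (1 : Matrix (Fin k) (Fin k) ℂ)
        = (∑ i, (K i)ᴴ * K i) ⊗ₖ (1 : Matrix (Fin k) (Fin k) ℂ) := by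
      ext x y; simp only [kroneckerMap_apply, Matrix.sum_apply, sum_mul]
    rw [e, hK, one_kronecker_one]
  · rw [krausMap_apply]
    simp only [mul_proj_mul, kronecker_mulVec_tmul, hKa, one_mulVec]
    have : ∀ i, tmul (c i • b) ζ = c i • tmul b ζ := fun i => by
      ext x; simp [tmul, mul_assoc]
    simp only [this, proj_smul]
    rw [← sum_smul, ← Complex.ofReal_sum, hc]
    simp

/-- The tensor power of a vector. -/
def tpow (a : X → ℂ) (m : ℕ) : (Fin m → X) → ℂ := fun x => ∏ i, a (x i)

lemma tpow_succ (a : X → ℂ) (m : ℕ) :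
    tpow a (m + 1) ∘ (Fin.consEquiv fun _ => X) = tmul a (tpow a m) := by
  ext x
  simp [tpow, tmul, Fin.prod_univ_succ, Fin.consEquiv]

lemma sum_wt_tpow {a : X → ℂ} (ha : ∑ x, wt a x = 1) (m : ℕ) : ∑ x, wt (tpow a m) x = 1 := by
  induction m with
  | zero => simp [tpow, wt]
  | succ m ih => rw [← sum_wt_comp_equiv (Fin.consEquiv fun _ => X), tpow_succ, sum_wt_tmul, ha, ih,
      one_mul]

lemma vcoh_tpow {a : X → ℂ} (ha : ∑ x, wt a x = 1) (m : ℕ) : vcoh (tpow a m) = m * vcoh a := by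
  induction m with
  | zero => simp [tpow, vcoh, shannon, wt]
  | succ m ih =>
    rw [← vcoh_comp_equiv (Fin.consEquiv fun _ => X), tpow_succ, vcoh_tmul, ih, ha, sum_wt_tpow ha]
    push_cast; ring

lemma Transforms.tpow_succ_iff (a : X → ℂ) (m : ℕ) :
    Transforms V 0 0 (tpow a (m + 1)) (tmul a (tpow a m)) ∧
      Transforms V 0 0 (tmul a (tpow a m)) (tpow a (m + 1)) := by
  rw [← tpow_succ]
  refine ⟨.relabel _ _, ?_⟩
  have := Transforms.relabel (V := V) (tpow a (m + 1) ∘ (Fin.consEquiv fun _ => X))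
    (Fin.consEquiv fun _ => X).symm
  rwa [Function.comp_assoc, Equiv.self_comp_symm, Function.comp_id] at this

lemma Transforms.tpow {c : ℕ} {a : X → ℂ} {b : Y → ℂ} (h : Transforms V c 0 a b)
    (ha : ∑ x, wt a x = 1) (hb : ∑ y, wt b y = 1) (m : ℕ) :
    Transforms V (c * m) 0 (tpow a m) (tpow b m) := by
  induction m with
  | zero =>
    have : Coherence.tpow a 0 ∘ (Equiv.ofUnique (Fin 0 → Y) (Fin 0 → X)) = Coherence.tpow b 0 := by
      ext x; simp [Coherence.tpow]
    rw [mul_zero, ← this]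
    exact .relabel _ _
  | succ m ih =>
    have h1 := (((Transforms.tpow_succ_iff a m).1.trans (h.tmul_right (sum_wt_tpow ha m))).trans
      (ih.tmul_left hb)).trans (Transforms.tpow_succ_iff b m).2
    convert h1 using 1
    · ring
    · ring

end Transformation

/-! ### Typical sets and truncation -/

section Typicality

variable {X Y : Type*} [Fintype X] [DecidableEq X] [Fintype Y] [DecidableEq Y]

lemma sum_fin_succ_fun (m : ℕ) (F : (Fin (m + 1) → X) → ℝ) :
    ∑ x, F x = ∑ y : X, ∑ x : Fin m → X, F (Fin.cons y x) := by
  rw [← (Fin.consEquiv fun _ => X).sum_comp, Fintype.sum_prod_type]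
  rfl

/-- The variance of a sum of independent centred variables. -/
lemma sum_prod_mul_sum_sq {p g : X → ℝ} (hp : ∑ x, p x = 1) (hg : ∑ x, p x * g x = 0) (m : ℕ) :
    ∑ x : Fin m → X, ∏ i, p (x i) = 1 ∧
    ∑ x : Fin m → X, (∏ i, p (x i)) * ∑ i, g (x i) = 0 ∧
    ∑ x : Fin m → X, (∏ i, p (x i)) * (∑ i, g (x i)) ^ 2 = m * ∑ x, p x * g x ^ 2 := by
  induction m with
  | zero => simp
  | succ m ih =>
    obtain ⟨h1, h2, h3⟩ := ih
    simp only [sum_fin_succ_fun, Fin.prod_univ_succ, Fin.sum_univ_succ, Fin.cons_zero,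
      Fin.cons_succ]
    refine ⟨?_, ?_, ?_⟩
    · simp only [← mul_sum, h1, mul_one, hp]
    · have e : ∀ y, ∑ x : Fin m → X, p y * (∏ i, p (x i)) * (g y + ∑ i, g (x i)) = p y * g y := by
        intro y
        calc _ = p y * g y * ∑ x : Fin m → X, ∏ i, p (x i)
              + p y * ∑ x : Fin m → X, (∏ i, p (x i)) * ∑ i, g (x i) := by
              rw [mul_sum, mul_sum, ← sum_add_distrib]
              exact sum_congr rfl fun x _ => by ring
          _ = _ := by rw [h1, h2]; ring
      simp only [e, hg]
    · have e : ∀ y, ∑ x : Fin m → X, p y * (∏ i, p (x i)) * (g y + ∑ i, g (x i)) ^ 2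
          = p y * g y ^ 2 + p y * (m * ∑ x, p x * g x ^ 2) := by
        intro y
        calc _ = p y * g y ^ 2 * ∑ x : Fin m → X, ∏ i, p (x i)
              + 2 * p y * g y * ∑ x : Fin m → X, (∏ i, p (x i)) * ∑ i, g (x i)
              + p y * ∑ x : Fin m → X, (∏ i, p (x i)) * (∑ i, g (x i)) ^ 2 := by
              rw [mul_sum, mul_sum, mul_sum, ← sum_add_distrib, ← sum_add_distrib]
              exact sum_congr rfl fun x _ => by ring
          _ = _ := by rw [h1, h2, h3]; ring
      simp only [e, sum_add_distrib, ← sum_mul, hp]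
      push_cast; ring

lemma wt_tpow (a : X → ℂ) (m : ℕ) (x : Fin m → X) : wt (tpow a m) x = ∏ i, wt a (x i) := by
  simp [wt, tpow, map_prod]

/-- Asymptotic equipartition. -/
lemma exists_typical {a : X → ℂ} (ha : ∑ x, wt a x = 1) {η ε : ℝ} (hη : 0 < η) (hε : 0 < ε) :
    ∃ m₀ : ℕ, ∀ m ≥ m₀, ∃ S : Finset (Fin m → X), 1 - ε ≤ ∑ x ∈ S, wt (tpow a m) x ∧
      ∀ x ∈ S, (2 : ℝ) ^ (-(m * (vcoh a + η))) ≤ wt (tpow a m) x ∧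
        wt (tpow a m) x ≤ (2 : ℝ) ^ (-(m * (vcoh a - η))) := by
  set H := vcoh a with hH
  set g : X → ℝ := fun x => -Real.logb 2 (wt a x) - H with hg
  have hg0 : ∑ x, wt a x * g x = 0 := by
    have : ∀ x, wt a x * g x = eta (wt a x) - wt a x * H := fun x => by rw [hg, eta]; ring
    simp only [this, sum_sub_distrib, ← sum_mul, ha]
    rw [hH, vcoh, shannon_eq_sum_of_sum_eq_one ha]; ring
  set v := ∑ x, wt a x * g x ^ 2 with hv
  have hv0 : 0 ≤ v := sum_nonneg fun x _ => mul_nonneg (wt_nonneg _ _) (sq_nonneg _)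
  -- Chebyshev's bound for a deviation of `m * η` is `m * v / (m * η) ^ 2`, which is below `ε` past
  -- this threshold.
  obtain ⟨m₀, hm₀⟩ := exists_nat_gt (v / (η ^ 2 * ε))
  refine ⟨max m₀ 1, fun m hm => ?_⟩
  have hm1 : (1 : ℝ) ≤ m := by exact_mod_cast (le_max_right _ _).trans hm
  have hm2 : v / (η ^ 2 * ε) < m :=
    hm₀.trans_le (by exact_mod_cast (le_max_left _ _).trans hm)
  obtain ⟨h1, -, h3⟩ := sum_prod_mul_sum_sq ha hg0 m
  classical
  set G : (Fin m → X) → ℝ := fun x => ∑ i, g (x i) with hG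
  -- Sequences of weight zero are excluded, since the logarithm of their weight is a junk value and
  -- the lower bound would fail.
  set S : Finset (Fin m → X) := {x | wt (tpow a m) x ≠ 0 ∧ |G x| < m * η} with hS
  have hmη : 0 < m * η := by positivity
  refine ⟨S, ?_, fun x hx => ?_⟩
  · have hc : ∑ x ∈ Sᶜ, wt (tpow a m) x * (m * η) ^ 2 ≤ m * v := by
      rw [← h3]
      simp only [← wt_tpow]
      refine (sum_le_sum (g := fun x => wt (tpow a m) x * G x ^ 2) fun x hx => ?_).trans
        (sum_le_sum_of_subset_of_nonneg (subset_univ Sᶜ) fun x _ _ =>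
          mul_nonneg (wt_nonneg _ _) (sq_nonneg _))
      · by_cases h0 : wt (tpow a m) x = 0
        · simp [h0]
        · have : m * η ≤ |G x| := by
            by_contra hlt
            exact (mem_compl.1 hx) (by simpa [hS] using ⟨h0, not_le.1 hlt⟩)
          refine mul_le_mul_of_nonneg_left ?_ (wt_nonneg _ _)
          rw [← sq_abs (G x)]
          exact pow_le_pow_left₀ hmη.le this 2
    rw [← sum_mul] at hc
    have hc2 : ∑ x ∈ Sᶜ, wt (tpow a m) x ≤ ε := by
      rw [div_lt_iff₀ (by positivity)] at hm2
      have : (∑ x ∈ Sᶜ, wt (tpow a m) x) * (m * η) ^ 2 ≤ ε * (m * η) ^ 2 := by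
        refine hc.trans ?_
        have : m * v ≤ m * (m * (η ^ 2 * ε)) := mul_le_mul_of_nonneg_left hm2.le (by linarith)
        calc m * v ≤ _ := this
          _ = _ := by ring
      exact le_of_mul_le_mul_right this (by positivity)
    have := sum_add_sum_compl S (wt (tpow a m))
    rw [sum_wt_tpow ha] at this
    linarith
  · obtain ⟨hx0, hxG⟩ : wt (tpow a m) x ≠ 0 ∧ |G x| < m * η := by simpa [hS] using hx
    have hpos : 0 < wt (tpow a m) x := lt_of_le_of_ne (wt_nonneg _ _) (Ne.symm hx0)
    have hlog : Real.logb 2 (wt (tpow a m) x) = -(G x + m * H) := by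
      rw [wt_tpow] at hx0 ⊢
      rw [Real.logb_prod _ _ fun i hi => prod_ne_zero_iff.1 hx0 i hi]
      simp only [hG, hg, sum_sub_distrib, sum_neg_distrib, sum_const, card_univ, Fintype.card_fin,
        nsmul_eq_mul]
      ring
    have e : wt (tpow a m) x = (2 : ℝ) ^ (-(G x + m * H)) := by
      rw [← hlog, Real.rpow_logb two_pos (by norm_num) hpos]
    rw [abs_lt] at hxG
    rw [e]
    constructor
    · exact Real.rpow_le_rpow_of_exponent_le one_le_two (by nlinarith)
    · exact Real.rpow_le_rpow_of_exponent_le one_le_two (by nlinarith)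

/-- Restrict to `S` and renormalize. With `c` the weight of `S`, renormalizing costs a factor `1 / c
≤ 2`, and the squared distance is `2 - 2 * √c ≤ 2 * (1 - c)`. -/
lemma exists_truncation {a : X → ℂ} (ha : ∑ x, wt a x = 1) {S : Finset X} {ε : ℝ}
    (hε : ε ≤ 1 / 2) (hS : 1 - ε ≤ ∑ x ∈ S, wt a x) :
    ∃ a' : X → ℂ, ∑ x, wt a' x = 1 ∧ (∀ x ∉ S, a' x = 0) ∧ (∀ x, wt a' x ≤ 2 * wt a x) ∧
      ∑ x, wt (a' - a) x ≤ 2 * ε := by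
  set c := ∑ x ∈ S, wt a x with hc
  have hc1 : c ≤ 1 := ha ▸ sum_le_sum_of_subset_of_nonneg (subset_univ _) fun x _ _ => wt_nonneg a x
  have hc0 : 1 / 2 ≤ c := by linarith
  have hcpos : 0 < c := by linarith
  set r : ℝ := (Real.sqrt c)⁻¹ with hr
  have hsc : 0 < Real.sqrt c := Real.sqrt_pos.2 hcpos
  have hr2 : r ^ 2 * c = 1 := by
    rw [hr, inv_pow, Real.sq_sqrt hcpos.le, inv_mul_cancel₀ hcpos.ne']
  have hrc : r * c = Real.sqrt c := by
    rw [hr, inv_mul_eq_div, Real.div_sqrt]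
  have hsq : c ≤ Real.sqrt c := Real.le_sqrt_of_sq_le (by nlinarith)
  set a' : X → ℂ := fun x => if x ∈ S then (r : ℂ) * a x else 0 with ha'
  have hw : ∀ x, wt a' x = if x ∈ S then r ^ 2 * wt a x else 0 := fun x => by
    simp only [wt, ha']
    split
    · rw [Complex.normSq_mul, Complex.normSq_ofReal, sq]
    · simp
  have hd : ∀ x, wt (a' - a) x = if x ∈ S then (r - 1) ^ 2 * wt a x else wt a x := fun x => by
    simp only [wt, ha', Pi.sub_apply]
    split
    · rw [show (r : ℂ) * a x - a x = ((r - 1 : ℝ) : ℂ) * a x by push_cast; ring,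
        Complex.normSq_mul, Complex.normSq_ofReal, sq]
    · simp
  refine ⟨a', ?_, fun x hx => by simp only [ha', if_neg hx], fun x => ?_, ?_⟩
  · simp only [hw, sum_ite_mem, univ_inter, ← mul_sum]
    exact hr2
  · rw [hw]
    split
    · exact mul_le_mul_of_nonneg_right (by nlinarith) (wt_nonneg _ _)
    · exact mul_nonneg two_pos.le (wt_nonneg _ _)
  · have h1 : ∑ x, wt (a' - a) x = (r - 1) ^ 2 * c + ∑ x ∈ Sᶜ, wt a x := by
      rw [← sum_add_sum_compl S, hc, mul_sum]
      congr 1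
      · exact sum_congr rfl fun x hx => by rw [hd, if_pos hx]
      · exact sum_congr rfl fun x hx => by rw [hd, if_neg (mem_compl.1 hx)]
    have h2 : c + ∑ x ∈ Sᶜ, wt a x = 1 := ha ▸ sum_add_sum_compl S (wt a)
    have h3 : (r - 1) ^ 2 * c = 1 - 2 * Real.sqrt c + c := by
      have : (r - 1) ^ 2 * c = r ^ 2 * c - 2 * (r * c) + c := by ring
      rw [this, hr2, hrc]
    rw [h1, h3]
    linarith

lemma wt_maxCoherent {d : ℕ} (x : Fin d) : wt (maxCoherent d) x = (d : ℝ)⁻¹ := by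
  rw [wt, maxCoherent, Complex.normSq_ofReal, ← sq, div_pow, Real.sq_sqrt (Nat.cast_nonneg d)]
  simp

lemma sum_wt_maxCoherent {d : ℕ} (hd : 1 ≤ d) : ∑ x, wt (maxCoherent d) x = 1 := by
  simp only [wt_maxCoherent, sum_const, card_univ, Fintype.card_fin, nsmul_eq_mul]
  exact mul_inv_cancel₀ (by positivity)

end Typicality

/-! ### Asymptotic conversion, coherent columns and trivial transformations -/

section Conversion

variable {ι κ X Y : Type*} [Fintype ι] [DecidableEq ι] [Fintype κ] [DecidableEq κ]
  [Fintype X] [DecidableEq X] [Fintype Y] [DecidableEq Y] {V : Matrix κ ι ℂ}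

/-- Asymptotic conversion of pure states by incoherent operations at all rates below the one given
by the entropies, with a maximally coherent state as a by-product. -/
lemma transforms_asymptotic {a : X → ℂ} {b : Y → ℂ} (ha : ∑ x, wt a x = 1)
    (hb : ∑ y, wt b y = 1) {R δ : ℝ} (hab : vcoh b + R < vcoh a) (hδ : 0 < δ) :
    ∃ m₀ : ℕ, ∀ m ≥ m₀, ∀ D : ℕ, 1 ≤ D → (D : ℝ) ≤ 2 ^ (m * R) →
      Transforms V 0 δ (tpow a m) (tmul (tpow b m) (maxCoherent D)) := by
  -- A third of the slack pays for the typicality of `a`, a third for that of `b`, and a third for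
  -- the factor `2` from truncation, once `m * η ≥ 1`.
  set η := (vcoh a - vcoh b - R) / 3 with hη
  have hη0 : 0 < η := by rw [hη]; linarith
  set s := min 1 (δ / 6) with hs
  have hs0 : 0 < s := lt_min one_pos (by linarith)
  have hs1 : 2 * s + s ^ 2 ≤ δ / 2 := by
    have h1 : s ≤ 1 := min_le_left _ _
    have h2 : s ≤ δ / 6 := min_le_right _ _
    nlinarith
  set ε := s ^ 2 / 2 with hε
  have hε0 : 0 < ε := by positivity
  have hε1 : ε ≤ 1 / 2 := by
    have h1 : s ≤ 1 := min_le_left _ _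
    rw [hε]; nlinarith
  obtain ⟨m₁, h₁⟩ := exists_typical ha hη0 hε0
  obtain ⟨m₂, h₂⟩ := exists_typical hb hη0 hε0
  obtain ⟨m₃, h₃⟩ := exists_nat_ge (1 / η)
  refine ⟨max m₁ (max m₂ m₃), fun m hm D hD hDR => ?_⟩
  have hm₁ : m₁ ≤ m := (le_max_left _ _).trans hm
  have hm₂ : m₂ ≤ m := (le_max_left _ _).trans ((le_max_right _ _).trans hm)
  have hm₃ : 1 ≤ m * η := by
    have h4 : (m₃ : ℝ) ≤ m := by
      exact_mod_cast (le_max_right _ _).trans ((le_max_right _ _).trans hm)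
    rw [← div_le_iff₀ hη0]
    exact h₃.trans h4
  obtain ⟨S, hS1, hS2⟩ := h₁ m hm₁
  obtain ⟨S', hS1', hS2'⟩ := h₂ m hm₂
  obtain ⟨a', ha1, ha2, ha3, ha4⟩ := exists_truncation (sum_wt_tpow ha m) hε1 hS1
  obtain ⟨b', hb1, hb2, hb3, hb4⟩ := exists_truncation (sum_wt_tpow hb m) hε1 hS1'
  have hΨ := sum_wt_maxCoherent hD
  have hcard : (#S' : ℝ) ≤ 2 ^ (m * (vcoh b + η)) := by
    have h5 : (#S' : ℝ) * 2 ^ (-(m * (vcoh b + η))) ≤ 1 := by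
      calc (#S' : ℝ) * 2 ^ (-(m * (vcoh b + η))) = ∑ x ∈ S', (2 : ℝ) ^ (-(m * (vcoh b + η))) := by
            rw [sum_const, nsmul_eq_mul]
        _ ≤ ∑ x ∈ S', wt (tpow b m) x := sum_le_sum fun x hx => (hS2' x hx).1
        _ ≤ ∑ x, wt (tpow b m) x :=
            sum_le_sum_of_subset_of_nonneg (subset_univ _) fun x _ _ => wt_nonneg _ x
        _ = 1 := sum_wt_tpow hb m
    rwa [Real.rpow_neg two_pos.le, ← div_eq_mul_inv, div_le_one (by positivity)] at h5
  have hsupp : (#{y | tmul b' (maxCoherent D) y ≠ 0} : ℝ) ≤ 2 ^ (m * (vcoh b + η)) * 2 ^ (m * R) := by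
    have h6 : ({y | tmul b' (maxCoherent D) y ≠ 0} : Finset _) ⊆ S' ×ˢ univ := by
      intro y hy
      rw [mem_product]
      refine ⟨?_, mem_univ _⟩
      by_contra hn
      simp [tmul, hb2 _ hn] at hy
    have h7 := card_le_card h6
    rw [card_product, card_univ, Fintype.card_fin] at h7
    have h8 : (#{y | tmul b' (maxCoherent D) y ≠ 0} : ℝ) ≤ (#S' : ℝ) * D := by exact_mod_cast h7
    exact h8.trans (mul_le_mul hcard hDR (Nat.cast_nonneg _) (by positivity))
  -- The truncated source is nearly flat and the truncated target has small support, so the one-shot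
  -- conversion is exact; all errors come from the two truncations.
  have hmid : Transforms V 0 0 a' (tmul b' (maxCoherent D)) := by
    refine .of_weights ha1 (by rw [sum_wt_tmul, hb1, hΨ, one_mul]) fun x => ?_
    by_cases hx : x ∈ S
    · have h9 : wt a' x ≤ 2 * 2 ^ (-(m * (vcoh a - η))) :=
        (ha3 x).trans (mul_le_mul_of_nonneg_left (hS2 x hx).2 two_pos.le)
      refine (mul_le_mul h9 hsupp (Nat.cast_nonneg _) (by positivity)).trans ?_
      have e : (2 : ℝ) * 2 ^ (-(m * (vcoh a - η))) * (2 ^ (m * (vcoh b + η)) * 2 ^ (m * R))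
          = 2 ^ (1 + -(m * (vcoh a - η)) + (m * (vcoh b + η) + m * R)) := by
        rw [Real.rpow_add two_pos, Real.rpow_add two_pos, Real.rpow_add two_pos, Real.rpow_one]
      rw [e]
      refine Real.rpow_le_one_of_one_le_of_nonpos one_le_two ?_
      have : vcoh a = vcoh b + R + 3 * η := by rw [hη]; ring
      rw [this]
      nlinarith
    · simp [wt, ha2 x hx]
  have h10 : Transforms V 0 (2 * s + s ^ 2) (tpow a m) a' :=
    .perturb hs0 (sum_wt_tpow ha m) (by rw [hε] at ha4; linarith)
  have h11 : Transforms V 0 (2 * s + s ^ 2) b' (tpow b m) := by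
    refine .perturb hs0 hb1 ?_
    have : wt (tpow b m - b') = wt (b' - tpow b m) := by
      ext x; simp only [wt, Pi.sub_apply]; rw [← Complex.normSq_neg, neg_sub]
    rw [this]
    rw [hε] at hb4; linarith
  have h12 := (h10.trans hmid).trans (h11.tmul_right hΨ)
  rw [add_zero, add_zero, add_zero] at h12
  exact h12.mono (by linarith)

/-- A normalized column of zero entropy is concentrated on a single entry: any nonzero weight must
equal one, and two of them would exceed the total. -/
lemma colSparse_of_vcoh_eq_zero (hV : IsIsometry V)
    (h : ∀ i, vcoh (V *ᵥ Pi.single i 1) = 0) : ColSparse V := by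
  intro i y y' hy hy'
  by_contra hne
  set w := V *ᵥ Pi.single i 1 with hw
  have hwy : ∀ y, w y = V y i := fun y => by simp [hw]
  have h1 : ∑ y, wt w y = 1 := by
    rw [hw, sum_wt_mulVec_of_isometry hV, sum_wt_single]; simp
  have hle : ∀ y, wt w y ≤ 1 := fun y =>
    h1 ▸ single_le_sum (f := wt w) (fun z _ => wt_nonneg w z) (mem_univ y)
  have h2 : ∑ y, eta (wt w y) = 0 := by rw [← shannon_eq_sum_of_sum_eq_one h1]; exact h i
  have h3 := (sum_eq_zero_iff_of_nonneg fun y _ => eta_nonneg (wt_nonneg w y) (hle y)).1 h2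
  have key : ∀ z, V z i ≠ 0 → wt w z = 1 := fun z hz => by
    have h4 := h3 z (mem_univ z)
    have h5 : 0 < wt w z := by
      rw [wt, hwy]; exact Complex.normSq_pos.2 hz
    rw [eta, neg_eq_zero, mul_eq_zero, or_iff_right h5.ne'] at h4
    by_contra hne1
    have := Real.logb_neg one_lt_two h5 (lt_of_le_of_ne (hle z) hne1)
    linarith
  have h6 := sum_le_sum_of_subset_of_nonneg (subset_univ ({y, y'} : Finset κ))
    fun z _ _ => wt_nonneg w z
  rw [sum_pair hne, key y hy, key y' hy', h1] at h6
  linarith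

/-- An isometry that can increase coherence creates some from an incoherent basis state. -/
lemma exists_coherent_column (hV : IsIsometry V) {φ : ι → ℂ} (h : vcoh φ < vcoh (V *ᵥ φ)) :
    ∃ i, 0 < vcoh (V *ᵥ Pi.single i 1) := by
  by_contra! hn
  have hs := colSparse_of_vcoh_eq_zero hV fun i => le_antisymm (hn i) (vcoh_nonneg _)
  have := sum_vcoh_kraus_le (α := Unit) (K := fun _ => V) (by simpa [IsIsometry] using hV) (fun _ => hs) φ
  simp only [univ_unique, sum_const, card_singleton, one_smul] at this
  linarith

/-- The unit vector of the trivial system. -/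
def unitVec : Unit → ℂ := fun _ => 1

lemma sum_wt_unitVec : ∑ x, wt unitVec x = 1 := by simp [wt, unitVec]

lemma card_support_single_le (x : X) (c : ℂ) :
    #{y | (Pi.single x c : X → ℂ) y ≠ 0} ≤ 1 := by
  refine (card_le_card (t := {x}) fun y hy => ?_).trans (card_singleton x).le
  by_contra hne
  simp only [mem_singleton] at hne
  simp [hne] at hy

lemma wt_le_one {a : X → ℂ} (ha : ∑ x, wt a x = 1) (x : X) : wt a x ≤ 1 :=
  ha ▸ single_le_sum (f := wt a) (fun z _ => wt_nonneg a z) (mem_univ x)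

lemma Transforms.single {a : X → ℂ} (ha : ∑ x, wt a x = 1) (y : Y) :
    Transforms V 0 0 a (Pi.single y 1) := by
  refine .of_weights ha (by rw [sum_wt_single]; simp) fun x => ?_
  have h1 : ((#{z | (Pi.single y 1 : Y → ℂ) z ≠ 0} : ℕ) : ℝ) ≤ 1 := by
    exact_mod_cast card_support_single_le y 1
  exact (mul_le_mul (wt_le_one ha x) h1 (Nat.cast_nonneg _) zero_le_one).trans_eq (one_mul 1)

lemma Transforms.unitVec {a : X → ℂ} (ha : ∑ x, wt a x = 1) : Transforms V 0 0 a unitVec := by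
  have : Coherence.unitVec = Pi.single () 1 := by ext; simp [Coherence.unitVec]
  rw [this]; exact .single ha ()

/-- Uses of the channel can be wasted. -/
lemma Transforms.waste [Nonempty ι] (hV : IsIsometry V) (n : ℕ) :
    Transforms V n 0 Coherence.unitVec Coherence.unitVec := by
  have h1 : Transforms V 1 0 Coherence.unitVec Coherence.unitVec := by
    have hs : ∑ x, wt (Pi.single (Classical.arbitrary ι) 1 : ι → ℂ) x = 1 := by
      rw [sum_wt_single]; simp
    have := ((Transforms.single sum_wt_unitVec (Classical.arbitrary ι)).trans
      (Transforms.use hV (Pi.single (Classical.arbitrary ι) 1))).trans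
      (Transforms.unitVec (by rw [sum_wt_mulVec_of_isometry hV, hs]))
    simpa using this
  induction n with
  | zero => exact .relabel _ (Equiv.refl _)
  | succ n ih => simpa using ih.trans h1

lemma approximates_unitVec : Approximates V 0 (tmul unitVec unitVec) 0 := by
  refine ⟨proj (tmul unitVec unitVec), 0, ?_, PosSemidef.zero, by simp, by simpa using PosSemidef.zero⟩
  refine ⟨isState_proj (by rw [sum_wt_tmul, sum_wt_unitVec, one_mul]), fun i j hij => ?_⟩
  exact absurd (Subsingleton.elim i j) hij

lemma Transforms.approximates {c : ℕ} {δ : ℝ} {b : Y → ℂ}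
    (h : Transforms V c δ Coherence.unitVec b) : Approximates V c b δ := by
  have h1 := h.apply sum_wt_unitVec approximates_unitVec
  have h2 := h1.relabel (Equiv.prodPUnit Y).symm
  have e : tmul b Coherence.unitVec ∘ (Equiv.prodPUnit Y).symm = b := by
    ext x; simp [tmul, Coherence.unitVec]
  rwa [e, zero_add, zero_add] at h2

end Conversion

/-! ### Fidelity with the maximally coherent state -/

section Fidelity

variable {ι κ : Type*} [Fintype ι] [DecidableEq ι] [Fintype κ] [DecidableEq κ]

lemma maxFid_add {d : ℕ} (σ τ : Matrix (Fin d) (Fin d) ℂ) :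
    maxFid (σ + τ) = maxFid σ + maxFid τ := by
  simp only [maxFid, add_mulVec, dotProduct_add, Complex.add_re]

lemma normSq_sum_le {d : ℕ} (u : Fin d → ℂ) :
    Complex.normSq (∑ x, u x) ≤ d * ∑ x, wt u x := by
  have h1 : ‖∑ x, u x‖ ^ 2 ≤ (∑ x, ‖u x‖) ^ 2 :=
    pow_le_pow_left₀ (norm_nonneg _) (norm_sum_le _ _) 2
  have h2 := sq_sum_le_card_mul_sum_sq (s := univ) (f := fun x => ‖u x‖)
  rw [card_univ, Fintype.card_fin] at h2
  simp only [wt, Complex.normSq_eq_norm_sq]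
  exact h1.trans h2

lemma maxFid_posSemidef {d : ℕ} {τ : Matrix (Fin d) (Fin d) ℂ} (h : τ.PosSemidef) :
    0 ≤ maxFid τ ∧ maxFid τ ≤ τ.trace.re := by
  obtain ⟨v, rfl⟩ := exists_eq_sum_proj h
  rw [maxFid_sum, Matrix.trace_sum, Complex.re_sum]
  simp only [maxFid_proj, trace_proj, Complex.ofReal_re]
  refine ⟨sum_nonneg fun j _ => div_nonneg (Complex.normSq_nonneg _) (Nat.cast_nonneg d),
    sum_le_sum fun j _ => div_le_of_le_mul₀ (Nat.cast_nonneg d)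
      (sum_nonneg fun x _ => wt_nonneg _ x) ?_⟩
  rw [mul_comm]
  exact normSq_sum_le _

lemma maxFid_proj_maxCoherent {d : ℕ} (hd : 1 ≤ d) : maxFid (proj (maxCoherent d)) = 1 := by
  have hd0 : (0 : ℝ) < d := by exact_mod_cast hd
  have h : ∑ x, maxCoherent d x = ((d * (1 / Real.sqrt d) : ℝ) : ℂ) := by
    simp [maxCoherent]
  rw [maxFid_proj, h, Complex.normSq_ofReal, ← sq, mul_pow, div_pow, Real.sq_sqrt hd0.le]
  field_simp

lemma traceLeft_posSemidef {ρ : Matrix (ι × κ) (ι × κ) ℂ} (h : ρ.PosSemidef) :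
    (traceLeft ρ).PosSemidef := by
  rw [traceLeft_eq_sum_braLeft]
  exact posSemidef_sum _ fun i _ => h.mul_mul_conjTranspose_same _

lemma traceLeft_add (ρ σ : Matrix (ι × κ) (ι × κ) ℂ) :
    traceLeft (ρ + σ) = traceLeft ρ + traceLeft σ := by
  ext k l; simp [traceLeft, sum_add_distrib]

lemma trace_traceLeft (ρ : Matrix (ι × κ) (ι × κ) ℂ) : (traceLeft ρ).trace = ρ.trace := by
  simp only [Matrix.trace, Matrix.diag, traceLeft, of_apply, Fintype.sum_prod_type_right]

lemma traceLeft_proj_single (i : ι) (ψ : κ → ℂ) :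
    traceLeft (proj (tmul (Pi.single i 1 : ι → ℂ) ψ)) = proj ψ := by
  ext k l
  simp only [traceLeft, of_apply, proj_apply, tmul]
  rw [sum_eq_single i (fun j _ hj => by simp [hj]) (by simp)]
  simp

end Fidelity

/-! ### Lower bound on the generating capacity -/

section Achievability

variable {ι κ : Type*} [Fintype ι] [DecidableEq ι] [Fintype κ] [DecidableEq κ]
  {V : Matrix κ ι ℂ}

/-- Tracing out `A` and testing the dominating inequality against the maximally coherent vector
gives `1 ≤ F(σ) + F(E)`, and `F(E)` is at most the trace of `E`. -/
lemma Approximates.hasProtocol {n d : ℕ} {r ε : ℝ} {i : ι}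
    (h : Approximates V n (tmul (Pi.single i 1 : ι → ℂ) (maxCoherent d)) ε) (hd : 1 ≤ d)
    (hr : (d : ℝ) = (2 : ℝ) ^ ((n : ℝ) * r)) : HasProtocol (conjMap V) n r ε := by
  obtain ⟨σ, E, h1, h2, h3, h4⟩ := h
  obtain ⟨s, h0, hs, hn⟩ := h1.prepared.exists_sequence
  refine ⟨fun t => (s t).1, fun t => (s t).2, h0, hs, ?_, ?_⟩
  · change ((s n).1 : ℝ) = _
    rw [hn]; exact hr
  · change 1 - ε ≤ maxFid (traceLeft (s n).2)
    rw [hn]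
    change 1 - ε ≤ maxFid (traceLeft σ)
    have h5 := (maxFid_posSemidef (traceLeft_posSemidef h4)).1
    have h6 := (maxFid_posSemidef (traceLeft_posSemidef h2)).2
    rw [trace_traceLeft] at h6
    have h7 : maxFid (traceLeft (σ + E - proj (tmul (Pi.single i 1 : ι → ℂ) (maxCoherent d)))) + 1
        = maxFid (traceLeft σ) + maxFid (traceLeft E) := by
      rw [← maxFid_proj_maxCoherent hd, ← traceLeft_proj_single i (maxCoherent d), ← maxFid_add,
        ← traceLeft_add, sub_add_cancel, traceLeft_add, maxFid_add]
    linarith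

lemma approximates_incoherent [Nonempty ι] (hV : IsIsometry V) {X : Type*} [Fintype X]
    [DecidableEq X] (n : ℕ) (x : X) : Approximates V n (Pi.single x 1) 0 := by
  have := (Transforms.waste hV n).trans (Transforms.single sum_wt_unitVec x)
  simpa using this.approximates

lemma sum_wt_sub_le {X : Type*} [Fintype X] (a b : X → ℂ) :
    ∑ x, wt (a - b) x ≤ 2 * ∑ x, wt a x + 2 * ∑ x, wt b x := by
  rw [mul_sum, mul_sum, ← sum_add_distrib]
  refine sum_le_sum fun x _ => ?_
  simp only [wt, Pi.sub_apply, Complex.normSq_apply, Complex.sub_re, Complex.sub_im]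
  nlinarith [sq_nonneg ((a x).re + (b x).re), sq_nonneg ((a x).im + (b x).im)]

/-- A crude bound valid for every `n`, needed because achievability asks for protocols at all `n`
even before the errors are small. Two unit vectors differ by at most `4 = 2 ^ 2` in squared norm,
and `s = 2` gives `2 * s + s ^ 2 = 8`. -/
lemma approximates_eight [Nonempty ι] (hV : IsIsometry V) {X : Type*} [Fintype X]
    [DecidableEq X] (n : ℕ) {a : X → ℂ} (ha : ∑ x, wt a x = 1) : Approximates V n a 8 := by
  have : Nonempty X := by
    by_contra hX
    rw [not_nonempty_iff] at hX
    simp at ha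
  have hs : ∑ x, wt (Pi.single (Classical.arbitrary X) 1 : X → ℂ) x = 1 := by
    rw [sum_wt_single]; simp
  have h := (approximates_incoherent hV n (Classical.arbitrary X)).perturb (ψ' := a) two_pos hs
    ((sum_wt_sub_le _ _).trans (by rw [ha, hs]; norm_num))
  norm_num at h
  exact h

lemma exists_tendsto_zero {A : ℕ → ℝ → Prop} {M : ℝ} (hM : 0 ≤ M) (h : ∀ n, A n M)
    (hA : ∀ δ > 0, ∀ᶠ n in atTop, A n δ) :
    ∃ ε : ℕ → ℝ, (∀ n, A n (ε n)) ∧ Tendsto ε atTop (𝓝 0) := by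
  have hbdd : ∀ n, BddBelow {δ | 0 ≤ δ ∧ A n δ} := fun n => ⟨0, fun δ hδ => hδ.1⟩
  have hex : ∀ n : ℕ, ∃ δ, (0 ≤ δ ∧ A n δ) ∧ δ < sInf {δ | 0 ≤ δ ∧ A n δ} + 1 / ((n : ℝ) + 1) :=
    fun n => exists_lt_of_csInf_lt ⟨M, hM, h n⟩ (lt_add_of_pos_right _ Nat.one_div_pos_of_nat)
  choose ε hε hlt using hex
  refine ⟨ε, fun n => (hε n).2, ?_⟩
  rw [tendsto_order]
  refine ⟨fun a ha => .of_forall fun n => ha.trans_le (hε n).1, fun a ha => ?_⟩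
  have h1 := tendsto_one_div_add_atTop_nhds_zero_nat (𝕜 := ℝ)
  filter_upwards [hA (a / 2) (by linarith), h1.eventually (gt_mem_nhds (half_pos ha))] with n h2 h3
  have h4 : sInf {δ | 0 ≤ δ ∧ A n δ} ≤ a / 2 := csInf_le (hbdd n) ⟨by linarith, h2⟩
  linarith [hlt n]

/-- At `n = 0` a protocol must have output dimension `2 ^ 0 = 1` whatever its rate, whence the
condition on `D 0`. -/
lemma isAchievable_of_approximates [Nonempty ι] (hV : IsIsometry V) {D : ℕ → ℕ} {R : ℝ} (i : ι)
    (hD0 : D 0 = 1) (hD : ∀ n, 1 ≤ D n)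
    (h : ∀ δ > 0, ∀ᶠ n in atTop,
      Approximates V n (tmul (Pi.single i 1 : ι → ℂ) (maxCoherent (D n))) δ)
    (hR : Tendsto (fun n : ℕ => Real.logb 2 (D n) / n) atTop (𝓝 R)) :
    IsAchievable (conjMap V) R := by
  obtain ⟨ε, hε, hlim⟩ := exists_tendsto_zero (M := 8)
    (A := fun n δ => Approximates V n (tmul (Pi.single i 1 : ι → ℂ) (maxCoherent (D n))) δ)
    (by norm_num) (fun n => approximates_eight hV n (by
      rw [sum_wt_tmul, sum_wt_single, sum_wt_maxCoherent (hD n)]; simp)) h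
  refine ⟨_, ε, fun n => (hε n).hasProtocol (hD n) ?_, hlim, hR⟩
  have hpos : (0 : ℝ) < D n := by exact_mod_cast hD n
  rcases Nat.eq_zero_or_pos n with rfl | hn
  · simp [hD0]
  · rw [mul_div_cancel₀ _ (by positivity), Real.rpow_logb two_pos (by norm_num) hpos]

lemma isAchievable_zero [Nonempty ι] (hV : IsIsometry V) : IsAchievable (conjMap V) 0 := by
  refine isAchievable_of_approximates hV (D := fun _ => 1) (Classical.arbitrary ι) rfl
    (fun _ => le_rfl) (fun δ hδ => .of_forall fun n => ?_) (by simp)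
  have e : tmul (Pi.single (Classical.arbitrary ι) 1 : ι → ℂ) (maxCoherent 1)
      = Pi.single (Classical.arbitrary ι, 0) 1 := by
    ext ⟨x, y⟩
    rw [Subsingleton.elim y 0]
    by_cases hx : x = Classical.arbitrary ι <;> simp [tmul, maxCoherent, hx]
  rw [e]
  exact (approximates_incoherent hV n _).mono hδ.le

/-- One catalytic cycle: `V` is applied to each copy of `φ`, and the copies of `V φ` are then
concentrated back into the copies of `φ` plus the surplus coherence. -/
lemma transforms_block (hV : IsIsometry V) {φ : ι → ℂ} (hφ : ∑ x, wt φ x = 1) {R δ : ℝ}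
    (h : vcoh φ + R < vcoh (V *ᵥ φ)) (hδ : 0 < δ) :
    ∃ m₀ : ℕ, ∀ m ≥ m₀, ∀ D : ℕ, 1 ≤ D → (D : ℝ) ≤ 2 ^ (m * R) →
      Transforms V m δ (tpow φ m) (tmul (tpow φ m) (maxCoherent D)) := by
  have hw : ∑ y, wt (V *ᵥ φ) y = 1 := by rw [sum_wt_mulVec_of_isometry hV, hφ]
  obtain ⟨m₀, h₀⟩ := transforms_asymptotic (V := V) hw hφ h hδ
  refine ⟨m₀, fun m hm D hD hDR => ?_⟩
  simpa using ((Transforms.use hV φ).tpow hφ hw m).trans (h₀ m hm D hD hDR)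

lemma tmul_eq_comp_prodUnique {X Y : Type*} [Unique Y] (a : X → ℂ) {b : Y → ℂ}
    (hb : b default = 1) : tmul a b = a ∘ Equiv.prodUnique X Y := by
  ext ⟨x, y⟩
  rw [Subsingleton.elim y default]
  simp [tmul, hb]

/-- Catalyst states can be prepared from incoherent ones, at a bounded number of uses per copy. -/
lemma transforms_seed (hV : IsIsometry V) {φ : ι → ℂ} (hφ : ∑ x, wt φ x = 1) {i : ι} {c : ℕ}
    (h : vcoh φ < c * vcoh (V *ᵥ Pi.single i 1)) {δ : ℝ} (hδ : 0 < δ) :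
    ∃ m₀ : ℕ, ∀ m ≥ m₀, Transforms V (c * m) δ unitVec (tpow φ m) := by
  set w := V *ᵥ Pi.single i 1 with hw
  have hs : ∑ x, wt (Pi.single i 1 : ι → ℂ) x = 1 := by rw [sum_wt_single]; simp
  have hw1 : ∑ y, wt w y = 1 := by rw [hw, sum_wt_mulVec_of_isometry hV, hs]
  -- Blocks of `c` coherent columns are treated as single letters, each with more entropy than one
  -- copy of `φ`; no surplus is extracted.
  obtain ⟨m₀, h₀⟩ := transforms_asymptotic (V := V) (R := 0) (sum_wt_tpow hw1 c) hφ
    (by rw [vcoh_tpow hw1, add_zero]; exact h) hδ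
  refine ⟨m₀, fun m hm => ?_⟩
  have h1 : Transforms V 1 0 unitVec w := by
    simpa only [zero_add, add_zero] using
      (Transforms.single sum_wt_unitVec i).trans (Transforms.use hV (Pi.single i 1))
  have h2 : Transforms V (c * m) 0 (tpow (tpow unitVec c) m) (tpow (tpow w c) m) := by
    simpa using (h1.tpow sum_wt_unitVec hw1 c).tpow (sum_wt_tpow sum_wt_unitVec c)
      (sum_wt_tpow hw1 c) m
  have h3 : Transforms V 0 0 unitVec (tpow (tpow unitVec c) m) := by
    refine .of_weights sum_wt_unitVec (sum_wt_tpow (sum_wt_tpow sum_wt_unitVec c) m) fun x => ?_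
    have h4 : #{y | tpow (tpow unitVec c) m y ≠ 0} ≤ 1 := (card_le_univ _).trans (by simp)
    have h5 : (#{y | tpow (tpow unitVec c) m y ≠ 0} : ℝ) ≤ 1 := by exact_mod_cast h4
    exact mul_le_one₀ (wt_le_one sum_wt_unitVec x) (Nat.cast_nonneg _) h5
  have h4 := h₀ m hm 1 le_rfl (by simp)
  rw [tmul_eq_comp_prodUnique _ (by simp [maxCoherent])] at h4
  have h5 := Transforms.relabel (V := V) (tpow φ m ∘ Equiv.prodUnique (Fin m → ι) (Fin 1))
    (Equiv.prodUnique (Fin m → ι) (Fin 1)).symm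
  rw [Function.comp_assoc, Equiv.self_comp_symm, Function.comp_id] at h5
  simpa using ((h3.trans h2).trans h4).trans h5

lemma Transforms.iterate {X Y : Type*} [Fintype X] [DecidableEq X] [Fintype Y] [DecidableEq Y]
    {a : X → ℂ} {b : Y → ℂ} {m : ℕ} {δ : ℝ} (h : Transforms V m δ a (tmul a b))
    (ha : ∑ x, wt a x = 1) (hb : ∑ y, wt b y = 1) (K : ℕ) :
    Transforms V (K * m) (K * δ) a (tmul a (Coherence.tpow b K)) := by
  induction K with
  | zero =>
    rw [tmul_eq_comp_prodUnique _ (by simp [Coherence.tpow])]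
    simpa using Transforms.relabel (V := V) a (Equiv.prodUnique X (Fin 0 → Y))
  | succ K ih =>
    have h1 : Transforms V 0 0 (tmul (tmul a b) (Coherence.tpow b K))
        (tmul a (tmul b (Coherence.tpow b K))) := by
      have e : tmul (tmul a b) (Coherence.tpow b K) ∘ (Equiv.prodAssoc X Y (Fin K → Y)).symm
          = tmul a (tmul b (Coherence.tpow b K)) := by
        ext x; simp [tmul, mul_assoc]
      rw [← e]
      exact .relabel _ _
    have h2 := ((ih.trans (h.tmul_right (sum_wt_tpow hb K))).trans h1).trans
      ((Transforms.tpow_succ_iff b K).2.tmul_left ha)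
    convert h2 using 1
    · ring
    · push_cast; ring

lemma transforms_maxCoherent_pow {X : Type*} [Fintype X] [DecidableEq X] {a : X → ℂ}
    (ha : ∑ x, wt a x = 1) {D : ℕ} (hD : 1 ≤ D) (K : ℕ) (i : ι) :
    Transforms V 0 0 (tmul a (tpow (maxCoherent D) K))
      (tmul (Pi.single i 1 : ι → ℂ) (maxCoherent (D ^ K))) := by
  have hDK : 1 ≤ D ^ K := Nat.one_le_pow _ _ hD
  refine .of_weights (by rw [sum_wt_tmul, ha, sum_wt_tpow (sum_wt_maxCoherent hD), one_mul])
    (by rw [sum_wt_tmul, sum_wt_single, sum_wt_maxCoherent hDK]; simp) fun x => ?_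
  have h1 : #{y | tmul (Pi.single i 1 : ι → ℂ) (maxCoherent (D ^ K)) y ≠ 0} ≤ D ^ K := by
    refine (card_le_card (t := {i} ×ˢ univ) fun y hy => ?_).trans (by simp)
    rw [mem_product]
    refine ⟨?_, mem_univ _⟩
    by_contra hn
    simp only [mem_singleton] at hn
    simp [tmul, hn] at hy
  have h2 : (#{y | tmul (Pi.single i 1 : ι → ℂ) (maxCoherent (D ^ K)) y ≠ 0} : ℝ) ≤ (D : ℝ) ^ K := by
    exact_mod_cast h1
  have h3 : wt (tmul a (tpow (maxCoherent D) K)) x ≤ ((D : ℝ) ^ K)⁻¹ := by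
    simp only [wt_tmul, wt_tpow, wt_maxCoherent, prod_const, card_univ, Fintype.card_fin, inv_pow]
    exact mul_le_of_le_one_left (by positivity) (wt_le_one ha _)
  have hpos : (0 : ℝ) < (D : ℝ) ^ K := by positivity
  exact (mul_le_mul h3 h2 (Nat.cast_nonneg _) (by positivity)).trans_eq (inv_mul_cancel₀ hpos.ne')

lemma one_le_floor_two_rpow {R : ℝ} (hR : 0 ≤ R) (m : ℕ) : 1 ≤ ⌊(2 : ℝ) ^ (m * R)⌋₊ :=
  Nat.one_le_floor_iff _ |>.2 (Real.one_le_rpow one_le_two (by positivity))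

lemma tendsto_logb_floor {R : ℝ} (hR : 0 ≤ R) :
    Tendsto (fun m : ℕ => Real.logb 2 ⌊(2 : ℝ) ^ (m * R)⌋₊ / m) atTop (𝓝 R) := by
  have h1 : Tendsto (fun m : ℕ => R - 1 / m) atTop (𝓝 R) := by
    simpa using (tendsto_const_nhds (x := R)).sub (tendsto_const_div_atTop_nhds_zero_nat (1 : ℝ))
  refine tendsto_of_tendsto_of_tendsto_of_le_of_le' h1 tendsto_const_nhds ?_ ?_
  all_goals
    filter_upwards [eventually_gt_atTop 0] with m hm
    have hm0 : (0 : ℝ) < m := by exact_mod_cast hm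
    have h2 : (1 : ℝ) ≤ ⌊(2 : ℝ) ^ (m * R)⌋₊ := by exact_mod_cast one_le_floor_two_rpow hR m
    have h3 : Real.logb 2 ((2 : ℝ) ^ (m * R)) = m * R := Real.logb_rpow two_pos (by norm_num)
  · rw [le_div_iff₀ hm0, sub_mul, div_mul_cancel₀ _ hm0.ne']
    have h4 := Nat.lt_floor_add_one ((2 : ℝ) ^ (m * R))
    have h5 : (2 : ℝ) ^ (m * R) / 2 ≤ ⌊(2 : ℝ) ^ (m * R)⌋₊ := by linarith
    have h6 := Real.logb_le_logb_of_le one_lt_two (by positivity) h5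
    rw [Real.logb_div (by positivity) two_ne_zero, h3, Real.logb_self_eq_one one_lt_two] at h6
    linarith
  · rw [div_le_iff₀ hm0]
    have h4 := Real.logb_le_logb_of_le one_lt_two (by linarith)
      (Nat.floor_le (by positivity : (0 : ℝ) ≤ 2 ^ (m * R)))
    linarith

lemma tendsto_natDiv_div {N : ℕ} (hN : 1 ≤ N) :
    Tendsto (fun n : ℕ => ((n / N : ℕ) : ℝ) / n) atTop (𝓝 (1 / N)) := by
  have h := (tendsto_nat_floor_mul_div_atTop (R := ℝ) (a := 1 / N) (by positivity)).comp
    tendsto_natCast_atTop_atTop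
  refine h.congr fun n => ?_
  rw [Function.comp_apply, one_div_mul_eq_div, Nat.floor_div_eq_div]

/-- Out of `(K + c) * m` uses, `c * m` prepare the catalyst `φ^m` and `K * m` drive `K` cycles, each
yielding about `m * R` units of coherence. -/
lemma isAchievable_of_gain [Nonempty ι] (hV : IsIsometry V) {φ : ι → ℂ} (hφ : ∑ x, wt φ x = 1)
    {R : ℝ} (hR : 0 ≤ R) (h : vcoh φ + R < vcoh (V *ᵥ φ)) {i : ι} {c : ℕ} (hc1 : 1 ≤ c)
    (hc : vcoh φ < c * vcoh (V *ᵥ Pi.single i 1)) (K : ℕ) :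
    IsAchievable (conjMap V) (K * R / (K + c)) := by
  set N := K + c with hN
  have hN1 : 1 ≤ N := by omega
  have hdiv : Tendsto (fun n : ℕ => n / N) atTop atTop := Nat.tendsto_div_const_atTop (by omega)
  refine isAchievable_of_approximates hV (D := fun n => ⌊(2 : ℝ) ^ ((n / N : ℕ) * R)⌋₊ ^ K) i
    (by simp) (fun n => Nat.one_le_pow _ _ (one_le_floor_two_rpow hR _)) (fun δ hδ => ?_) ?_
  · have hδ' : 0 < δ / (K + 1) := by positivity
    obtain ⟨m₁, h₁⟩ := transforms_seed hV hφ hc hδ'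
    obtain ⟨m₂, h₂⟩ := transforms_block hV hφ h hδ'
    filter_upwards [hdiv.eventually_ge_atTop (max m₁ m₂)] with n hn
    set m := n / N with hm
    have hD := one_le_floor_two_rpow hR m
    -- Uses left over by the division of `n` by `N` are wasted. The seed and the `K` cycles each
    -- contribute an error `δ / (K + 1)`; the final merging of the `K` maximally coherent states is
    -- exact.
    have h3 := (((Transforms.waste hV (n - N * m)).trans (h₁ m ((le_max_left _ _).trans hn))).trans
      ((h₂ m ((le_max_right _ _).trans hn) _ hD (Nat.floor_le (by positivity))).iterate
        (sum_wt_tpow hφ m) (sum_wt_maxCoherent hD) K)).trans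
      (transforms_maxCoherent_pow (sum_wt_tpow hφ m) hD K i)
    have h4 : N * m ≤ n := Nat.mul_div_le n N
    have h5 : n - N * m + c * m + K * m + 0 = n := by
      have : N * m = K * m + c * m := by rw [hN, add_mul]
      omega
    have h6 : 0 + δ / (K + 1) + K * (δ / (K + 1)) + 0 = δ := by
      have : (K : ℝ) + 1 ≠ 0 := by positivity
      field_simp; ring
    rw [h5, h6] at h3
    exact h3.approximates
  · have h7 := (((tendsto_logb_floor hR).comp hdiv).mul (tendsto_natDiv_div hN1)).const_mul (K : ℝ)
    have e : (K : ℝ) * (R * (1 / N)) = K * R / (K + c) := by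
      rw [hN]; push_cast; ring
    rw [e] at h7
    refine h7.congr fun n => ?_
    rw [Function.comp_apply, Nat.cast_pow, Real.logb_pow, mul_div_assoc]
    congr 1
    rcases Nat.eq_zero_or_pos (n / N) with h0 | h0
    · simp [h0]
    · exact div_mul_div_cancel₀ (by positivity)

theorem powRelPure_le_genCapacity [Nonempty ι] (hV : IsIsometry V) :
    powRelPure (conjMap V) ≤ genCapacity (conjMap V) := by
  refine powRelPure_le hV fun φ hφ => ?_
  have hle : ∀ {R : ℝ}, IsAchievable (conjMap V) R → (R : EReal) ≤ genCapacity (conjMap V) :=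
    fun {R} hR => le_iSup_of_le ⟨R, hR⟩ le_rfl
  rcases le_or_gt (vcoh (V *ᵥ φ)) (vcoh φ) with hg | hg
  · refine le_trans ?_ (hle (isAchievable_zero hV))
    rw [EReal.coe_le_coe_iff]; linarith
  -- With positive gain some basis state becomes coherent under `V`, so `c` copies of that column
  -- contain more coherence than one copy of `φ`.
  obtain ⟨i, hi⟩ := exists_coherent_column hV hg
  obtain ⟨c, hc⟩ := exists_nat_gt (vcoh φ / vcoh (V *ᵥ Pi.single i 1))
  rw [div_lt_iff₀ hi] at hc
  have hc1 : 1 ≤ c := by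
    by_contra h0
    obtain rfl : c = 0 := by omega
    have := vcoh_nonneg φ
    rw [Nat.cast_zero, zero_mul] at hc
    linarith
  set g := vcoh (V *ᵥ φ) - vcoh φ with hgdef
  have hg0 : 0 < g := sub_pos.2 hg
  have hlim : ∀ x y : ℝ, Tendsto (fun k : ℕ => (((k : ℝ) * x / (k + y) : ℝ) : EReal)) atTop
      (𝓝 (x : EReal)) := fun x y => by
    refine (continuous_coe_real_ereal.tendsto x).comp ?_
    have := (tendsto_natCast_div_add_atTop (𝕜 := ℝ) y).mul_const x
    rw [one_mul] at this
    exact this.congr fun k => by ring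
  -- Two limits: the rates `k * g / (k + 1)` stay strictly below `g` and tend to it, and for each of
  -- them `K → ∞` removes the cost of the seed.
  refine le_of_tendsto' (hlim g 1) fun k => ?_
  refine le_of_tendsto' (hlim (k * g / (k + 1)) c) fun K => ?_
  refine hle (isAchievable_of_gain hV hφ (by positivity) ?_ hc1 hc K)
  have : (k : ℝ) * g / (k + 1) < g := by
    rw [div_lt_iff₀ (by positivity)]; linarith
  linarith

theorem genCapacity_conjMap [Nonempty ι] (hV : IsIsometry V) :
    genCapacity (conjMap V) = powRelPure (conjMap V) :=
  (genCapacity_le hV).antisymm (powRelPure_le_genCapacity hV)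

end Achievability

end Coherence

theorem mainTheorem6 {A₁ B₁ A₂ B₂ : Type*}
    [Fintype A₁] [DecidableEq A₁] [Nonempty A₁] [Fintype B₁] [DecidableEq B₁]
    [Fintype A₂] [DecidableEq A₂] [Nonempty A₂] [Fintype B₂] [DecidableEq B₂] :
    (∀ (T₁ : SuperOp A₁ B₁) (T₂ : SuperOp A₂ B₂), IsCPTP T₁ → IsCPTP T₂ →
      completePowRel (tensor T₁ T₂) = completePowRel T₁ + completePowRel T₂ ∧
      completePowForm (tensor T₁ T₂) = completePowForm T₁ + completePowForm T₂) ∧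
    (∀ (V₁ : Matrix B₁ A₁ ℂ) (V₂ : Matrix B₂ A₂ ℂ), IsIsometry V₁ → IsIsometry V₂ →
      (completePowRelPure (conjMap V₁) = powRelPure (conjMap V₁) ∧
        powRelPure (conjMap V₁) = genCapacity (conjMap V₁)) ∧
      (completePowRelPure (conjMap V₂) = powRelPure (conjMap V₂) ∧
        powRelPure (conjMap V₂) = genCapacity (conjMap V₂)) ∧
      powRelPure (tensor (conjMap V₁) (conjMap V₂)) =
        powRelPure (conjMap V₁) + powRelPure (conjMap V₂) ∧
      genCapacity (tensor (conjMap V₁) (conjMap V₂)) =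
        genCapacity (conjMap V₁) + genCapacity (conjMap V₂)) := by
  refine ⟨fun T₁ T₂ h₁ h₂ => ⟨completePowRel_tensor h₁ h₂, completePowForm_tensor h₁ h₂⟩,
    fun V₁ V₂ h₁ h₂ => ⟨⟨completePowRelPure_conjMap h₁, (genCapacity_conjMap h₁).symm⟩,
      ⟨completePowRelPure_conjMap h₂, (genCapacity_conjMap h₂).symm⟩, powRelPure_tensor h₁ h₂, ?_⟩⟩
  rw [tensor_conjMap, genCapacity_conjMap (isIsometry_kronecker h₁ h₂), ← tensor_conjMap,
    powRelPure_tensor h₁ h₂, genCapacity_conjMap h₁, genCapacity_conjMap h₂]
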